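/- Let $\beta>0$ and $\alpha\in\mathbb{R}$ be such that $g:=\tfrac12+\tfrac{\alpha}{\beta}>0$, let $n\ge 1$, and let $\lambda\in\mathbb{C}$ satisfy $\operatorname{Im}\lambda\in(-g,0)$. We use the following objects. **Function spaces.** $\mathcal{E}(\mathbb{R}^n)$ is the space of $\phi\in C^\infty(\mathbb{R}^n,\mathbb{C})$ such that for every multi-index $k$ there are $a,b\ge 0$ with $|\partial^k\phi(x)|\le a\,e^{b(|x_1|+\dots+|x_n|)}$ for all $x$. $\mathcal{E}_n(\mathbb{R}^n)$ is the space of $\phi\in C^\infty(\mathbb{R}^n,\mathbb{C})$ such that for every $k$ there are $a,b\ge0$ and a polynomial $P$ with $|\partial^k\phi(x)|\le a\,e^{b(|x_1|+\dots+|x_{n-1}|)}P(x_n)$ if $x_n\ge 0$, and $|\partial^k\phi(x)|\le a\,e^{b(|x_1|+\dots+|x_{n-1}|)}e^{b|x_n|}$ if $x_n<0$. **Hamiltonians.** For $u\in\mathbb{C}$ put $$L_j(u)=\begin{pmatrix}u+i\partial_{x_j}&e^{-x_j}\\-e^{x_j}&0\end{pmatrix},\quad K(u)=\begin{pmatrix}-\alpha&u-\frac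 i2\\-\beta^2(u-\frac i2)&-\alpha\end{pmatrix},\quad \sigma_2=\begin{pmatrix}0&-i\\ i&0\end{pmatrix},$$ $$\mathbb{T}_n(u)=L_n(u)\cdots L_1(u)\,K(u)\,\sigma_2\,L_1^t(-u)\cdots L_n^t(-u)\,\sigma_2,$$ where $t$ denotes transposition of $2\times2$ matrices. The generating function $\mathbb{B}_n(u)$ of the Hamiltonians of the $BC$ Toda chain is the $(1,2)$ entry of $\mathbb{T}_n(u)$. **Monodromy operator.** On functions of $(x_1,\dots,x_n,x_{n+1})$ define, for $1\le j\le n$, $$[\mathcal{R}_{j}(\lambda)\phi](\dots,x_j,\dots,x_{n+1})=\int_{\mathbb{R}}\exp\bigl(i\lambda(x_j-y)-e^{x_j-y}-e^{y-x_{n+1}}\bigr)\,\phi(\dots,y,\dots,x_j)\,dy,$$ $\mathcal{R}^*_{j}(\lambda)=r_j\mathcal{R}_{j}(\lambda)r_j$ with $r_j$ the reflection $x_j\mapsto -x_j$, and $$[\mathcal{K}(\lambda)\phi](\dots,x_{n+1})=\frac{(2\beta)^{i\lambda}}{\Gamma(g-i\lambda)}\int_{\ln\beta}^\infty e^{-2i\lambda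 y-e^{y-x_{n+1}}}(1+\beta e^{-y})^{-i\lambda-g}(1-\beta e^{-y})^{-i\lambda+g-1}\phi(\dots,-y)\,dy,$$ $$\mathbb{U}_{n,n+1}(\lambda)=\mathcal{R}_{n}(\lambda)\cdots\mathcal{R}_{1}(\lambda)\,\mathcal{K}(\lambda)\,\mathcal{R}^*_{1}(\lambda)\cdots\mathcal{R}^*_{n}(\lambda).$$ **Baxter operator.** For a function $\phi$ of $x_1,\dots,x_n$, regarded as a function of $(x_1,\dots,x_{n+1})$ independent of $x_{n+1}$, put $$[\mathbb{Q}_n(\lambda)\phi](x)=\lim_{x_{n+1}\to+\infty}[\mathbb{U}_{n,n+1}(\lambda)\phi](x,x_{n+1}).$$ **Theorem.** (1) For all $x,y\in\mathbb{R}^n$ the integral $$\begin{aligned}\mathbb{Q}_\lambda(x|y)=\frac{(2\beta)^{i\lambda}}{\Gamma(g-i\lambda)}\int_{\mathbb{R}^{n+1}}dz\;&\exp\Bigl(i\lambda\Bigl(\sum_{j=1}^n x_j+\sum_{j=1}^n y_j-2\sum_{j=1}^{n+1}z_j\Bigr)-\sum_{j=1}^n\bigl(e^{z_j-x_j}+e^{z_j-y_j}+e^{x_j-z_{j+1}}+e^{y_j-z_{j+1}}\bigr)\Bigr)\\&\times(1+\beta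 e^{-z_1})^{-i\lambda-g}(1-\beta e^{-z_1})^{-i\lambda+g-1}\,\theta(z_1-\ln\beta)\end{aligned}$$ converges absolutely, where $\theta$ is the Heaviside step function. (2) For every $\phi\in\mathcal{E}_n(\mathbb{R}^n)$ and $x\in\mathbb{R}^n$ the limit defining $[\mathbb{Q}_n(\lambda)\phi](x)$ exists, and $$[\mathbb{Q}_n(\lambda)\phi](x)=\int_{\mathbb{R}^n}\mathbb{Q}_\lambda(x|y)\,\phi(y)\,dy,$$ where the integral over $y$ converges absolutely. (3) For every $\phi\in\mathcal{E}_n(\mathbb{R}^n)$ and $u\in\mathbb{C}$ one has $\mathbb{B}_n(u)\phi\in\mathcal{E}_n(\mathbb{R}^n)$, $\mathbb{Q}_n(\lambda)\phi\in\mathcal{E}(\mathbb{R}^n)$ and $$\mathbb{B}_n(u)\,\mathbb{Q}_n(\lambda)\,\phi=\mathbb{Q}_n(\lambda)\,\mathbb{B}_n(u)\,\phi.$$ -/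

import Mathlib

open scoped ContDiff Topology
open MeasureTheory Filter

noncomputable section

namespace BCToda

/-! ## Smooth functions and differential operators -/

/-- The complex vector space `C^∞(ℝⁿ)` of smooth complex-valued functions on `ℝⁿ`. -/
def Smooth (n : ℕ) : Submodule ℂ ((Fin n → ℝ) → ℂ) where
  carrier := {f | ContDiff ℝ ∞ f}
  add_mem' := by
    intro f g hf hg
    simp only [Set.mem_ofPred_eq] at hf hg ⊢
    exact hf.add hg
  zero_mem' := by
    simp only [Set.mem_ofPred_eq]
    exact contDiff_const (c := (0 : ℂ))
  smul_mem' := by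
    intro c f hf
    simp only [Set.mem_ofPred_eq] at hf ⊢
    exact hf.const_smul c

theorem smooth_differentiable {n : ℕ} (f : Smooth n) :
    Differentiable ℝ (f : (Fin n → ℝ) → ℂ) :=
  ContDiff.differentiable (n := ∞) f.2 (by simp)

/-- Linear operators on `C^∞(ℝⁿ)`; multiplication is composition. -/
abbrev DiffOp (n : ℕ) : Type := Module.End ℂ (Smooth n)

/-- The partial derivative `∂_{x_j}`. -/
def pd {n : ℕ} (j : Fin n) : DiffOp n where
  toFun f := ⟨fun x => fderiv ℝ (f : (Fin n → ℝ) → ℂ) x (Pi.single j 1),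
    ContDiff.clm_apply (ContDiff.fderiv_right (n := ∞) (m := ∞) f.2 (by simp)) contDiff_const⟩
  map_add' f g := by
    ext x
    simp [fderiv_add (smooth_differentiable f x) (smooth_differentiable g x)]
  map_smul' c f := by
    ext x
    simp [fderiv_const_smul (smooth_differentiable f x) c]

/-- Multiplication by the exponential `e^{s x_j}`. -/
def expMul {n : ℕ} (s : ℝ) (j : Fin n) : DiffOp n where
  toFun f := ⟨fun x => (Real.exp (s * x j) : ℂ) * (f : (Fin n → ℝ) → ℂ) x, by
    have h : ContDiff ℝ ∞ (fun x : Fin n → ℝ => Real.exp (s * x j)) := by fun_prop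
    exact (Complex.ofRealCLM.contDiff.comp h).mul f.2⟩
  map_add' f g := by
    ext x
    simp [mul_add]
  map_smul' c f := by
    ext x
    simp [mul_left_comm]

/-- `∂_{x_1}^{k_1} ⋯ ∂_{x_n}^{k_n}`. -/
def multiPd {n : ℕ} (k : Fin n → ℕ) : DiffOp n :=
  (List.ofFn fun j => pd j ^ k j).prod

/-! ## Spaces of exponentially tempered functions -/

/-- The space `𝓔(ℝⁿ)`: smooth functions exponentially bounded with all their derivatives. -/
def tempered (n : ℕ) : Set (Smooth n) :=
  {f | ∀ k : Fin n → ℕ, ∃ a b : ℝ, 0 ≤ a ∧ 0 ≤ b ∧ ∀ x : Fin n → ℝ,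
    ‖(multiPd k f : (Fin n → ℝ) → ℂ) x‖ ≤ a * Real.exp (b * ∑ i, |x i|)}

/-- The space `𝓔_j(ℝⁿ)`: exponentially bounded with all derivatives, and at most polynomially
growing as `x_j → +∞`. -/
def temperedPoly {n : ℕ} (j : Fin n) : Set (Smooth n) :=
  {f | ∀ k : Fin n → ℕ, ∃ (a b : ℝ) (P : Polynomial ℝ), 0 ≤ a ∧ 0 ≤ b ∧ ∀ x : Fin n → ℝ,
    ‖(multiPd k f : (Fin n → ℝ) → ℂ) x‖ ≤
      a * Real.exp (b * ∑ i ∈ Finset.univ.erase j, |x i|) *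
        (if 0 ≤ x j then P.eval (x j) else Real.exp (b * |x j|))}

/-! ## The monodromy matrix and the generating function of Hamiltonians -/

/-- A scalar `2 × 2` matrix, viewed as a matrix of operators. -/
def scalarMat (n : ℕ) (A : Matrix (Fin 2) (Fin 2) ℂ) : Matrix (Fin 2) (Fin 2) (DiffOp n) :=
  A.map (algebraMap ℂ (DiffOp n))

/-- The Toda Lax matrix `L_j(u)`. -/
def lax {n : ℕ} (j : Fin n) (u : ℂ) : Matrix (Fin 2) (Fin 2) (DiffOp n) :=
  !![algebraMap ℂ (DiffOp n) u + Complex.I • pd j, expMul (-1) j;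
     -expMul 1 j, 0]

/-- The boundary matrix `K(u)`. -/
def boundaryK (α β : ℝ) (u : ℂ) : Matrix (Fin 2) (Fin 2) ℂ :=
  !![-(α : ℂ), u - Complex.I / 2;
     -(β : ℂ) ^ 2 * (u - Complex.I / 2), -(α : ℂ)]

/-- The Pauli matrix `σ₂`. -/
def sigma2 : Matrix (Fin 2) (Fin 2) ℂ :=
  !![0, -Complex.I; Complex.I, 0]

/-- The monodromy matrix
`𝕋_n(u) = L_n(u) ⋯ L_1(u) K(u) σ₂ L_1ᵗ(-u) ⋯ L_nᵗ(-u) σ₂`. -/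
def monodromyMatrix (α β : ℝ) (n : ℕ) (u : ℂ) : Matrix (Fin 2) (Fin 2) (DiffOp n) :=
  (List.ofFn fun j : Fin n => lax j u).reverse.prod *
    scalarMat n (boundaryK α β u) * scalarMat n sigma2 *
    (List.ofFn fun j : Fin n => (lax j (-u)).transpose).prod * scalarMat n sigma2

/-- The generating function of the Hamiltonians: the entry `𝔹_n(u)` in the first row and second
column of `𝕋_n(u)`. -/
def opB (α β : ℝ) (n : ℕ) (u : ℂ) : DiffOp n :=
  monodromyMatrix α β n u 0 1

/-! ## Integral operators -/

/-- The boundary parameter `g = 1/2 + α/β`. -/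
def g (α β : ℝ) : ℝ := 1 / 2 + α / β

/-- Functions `φ(x_1, …, x_n, x_a)`, the auxiliary variable `x_a` being written separately. -/
abbrev AuxFun (n : ℕ) : Type := (Fin n → ℝ) → ℝ → ℂ

/-- The operator `𝓡_{ja}(v)`, acting in the variables `x_j` and `x_a`. -/
def opR {n : ℕ} (v : ℂ) (j : Fin n) : Function.End (AuxFun n) :=
  fun φ x xa => ∫ y : ℝ,
    Complex.exp (Complex.I * v * ((x j : ℂ) - (y : ℂ)) - (Real.exp (x j - y) : ℂ)
      - (Real.exp (y - xa) : ℂ)) * φ (Function.update x j y) (x j)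

/-- The reflection `x_j ↦ -x_j`. -/
def reflect {n : ℕ} (j : Fin n) : Function.End (AuxFun n) :=
  fun φ x xa => φ (Function.update x j (-x j)) xa

/-- The reflected operator `𝓡*_{ja}(v) = r_j 𝓡_{ja}(v) r_j`. -/
def opRstar {n : ℕ} (v : ℂ) (j : Fin n) : Function.End (AuxFun n) :=
  reflect j * opR v j * reflect j

/-- The reflection operator `𝓚_a(v)`, acting in the variable `x_a`. -/
def opK (α β : ℝ) {n : ℕ} (v : ℂ) : Function.End (AuxFun n) :=
  fun φ x xa =>
    ((2 * β : ℝ) : ℂ) ^ (Complex.I * v) / Complex.Gamma (g α β - Complex.I * v) *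
      ∫ y in Set.Ioi (Real.log β),
        Complex.exp (-2 * Complex.I * v * y - (Real.exp (y - xa) : ℂ)) *
          ((1 + β * Real.exp (-y) : ℝ) : ℂ) ^ (-Complex.I * v - g α β) *
          ((1 - β * Real.exp (-y) : ℝ) : ℂ) ^ (-Complex.I * v + g α β - 1) *
          φ x (-y)

/-- The monodromy operator
`𝕌_{na}(v) = 𝓡_{na}(v) ⋯ 𝓡_{1a}(v) 𝓚_a(v) 𝓡*_{1a}(v) ⋯ 𝓡*_{na}(v)`. -/
def opU (α β : ℝ) {n : ℕ} (v : ℂ) : Function.End (AuxFun n) :=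
  (List.ofFn fun j : Fin n => opR v j).reverse.prod * opK α β v *
    (List.ofFn fun j : Fin n => opRstar v j).prod

/-- The monodromy operator restricted to functions that do not depend on `x_a`. -/
def opURestr (α β : ℝ) {n : ℕ} (v : ℂ) (φ : (Fin n → ℝ) → ℂ) : AuxFun n :=
  opU α β v (fun x _ => φ x)

/-- The Baxter operator, `[ℚ_n(λ) φ](x) = lim_{x_a → +∞} [𝕌_{na}(λ) φ](x, x_a)`. -/
def opQ (α β : ℝ) {n : ℕ} (lam : ℂ) (φ : (Fin n → ℝ) → ℂ) (x : Fin n → ℝ) : ℂ :=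
  limUnder atTop fun xa : ℝ => opURestr α β lam φ x xa

/-- The Heaviside step function. -/
def heaviside (t : ℝ) : ℝ := if 0 ≤ t then 1 else 0

/-- The integrand, as a function of `z ∈ ℝ^{n+1}`, in the kernel of the Baxter operator. -/
def kernelIntegrand (α β : ℝ) {n : ℕ} (lam : ℂ) (x y : Fin n → ℝ) (z : Fin (n + 1) → ℝ) : ℂ :=
  Complex.exp (Complex.I * lam * ((∑ i, x i + ∑ i, y i - 2 * ∑ i, z i : ℝ) : ℂ)
      - ((∑ j : Fin n, (Real.exp (z j.castSucc - x j) + Real.exp (z j.castSucc - y j)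
          + Real.exp (x j - z j.succ) + Real.exp (y j - z j.succ)) : ℝ) : ℂ)) *
    ((1 + β * Real.exp (-z 0) : ℝ) : ℂ) ^ (-Complex.I * lam - g α β) *
    ((1 - β * Real.exp (-z 0) : ℝ) : ℂ) ^ (-Complex.I * lam + g α β - 1) *
    (heaviside (z 0 - Real.log β) : ℂ)

/-- The kernel `ℚ_λ(x | y)` of the Baxter operator. -/
def kernelQ (α β : ℝ) {n : ℕ} (lam : ℂ) (x y : Fin n → ℝ) : ℂ :=
  ((2 * β : ℝ) : ℂ) ^ (Complex.I * lam) / Complex.Gamma (g α β - Complex.I * lam) *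
    ∫ z : Fin (n + 1) → ℝ, kernelIntegrand α β lam x y z

end BCToda

end

open scoped ContDiff Topology
open MeasureTheory Filter

noncomputable section

namespace BCToda


/-! Put s = -Im λ, so that 0 < s < g, and number the integration variables z_0, z_1, …. The kernel
of the Baxter operator factorizes: up to the constant `normK` it is ∫ w(z_0) Λ(x|z) Λ(y|z) dz, where
w is `wt` and Λ is `kerLam`, the kernel that links a Toda chain to a chain with one more site
(`kernelIntegrand_eq`). Commutativity is then a kernel identity, and it rests on four algebraic
facts.

First, 𝔹_n(u) is a quadratic expression `bForm` in the first rows r(u), r(-u) of the Lax products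
(`opB_eq_bForm`). The exponential e^{x_n} occurs only in the second row, so 𝔹_n(u) does not contain
it and preserves 𝓔_n.

Second, Λ satisfies a Darboux relation. With S_k = [[u - λ + i e^{z_k - x_k}, e^{-x_k}], [-e^{z_k},
i]], the symbols of the Lax matrices on Λ satisfy S_{k+1} L(x_k) = L'(z_{k+1}) S_k, where L' carries
-∂ instead of ∂. The relation telescopes along the chain (`chain_darboux`). At the far end the
missing e^{-x} is zero, so the first row of the last S is (u - λ, 0). Hence (u - λ) r(u) Λ is a row
ρ(u) in z_1, z_2, … times a matrix `bdMat` in z_0, applied to Λ. Doing this for u and -u turns (u -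
λ)(-u - λ) 𝔹_x(u) Λ into `zOp` Λ, an operator in z alone (`bForm_lamS`).

Third, `zOp` is symmetric for the bilinear pairing with weight w(z_0) (`pairZ_zOp`). In z_1, z_2, …
this is integration by parts. In z_0 the second-order operators `bdOp` fail to be symmetric only by
a total derivative of (1 - β² e^{-2z_0}) w(z_0) times functions; this function vanishes at z_0 = log
β because s < g, so there is no boundary term (`integral_bdTerm`). Thus 𝔹_x(u) and 𝔹_y(u) act
equally on the kernel for u ≠ ±λ, and for all u by continuity (`pairZ_hamLam`).

Fourth, 𝔹_n(u) is its own transpose in y (`pairY_opB`), so it moves from the kernel onto φ.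

The analysis is uniform. All operators that occur keep Λ inside `jointSpan`, the span of e^{m·(x,z)}
Λ with exponents in `jointCone`. The double exponentials in Λ beat every exponential in all
directions but two: z_0 → -∞, which the weight cuts off, and the last z → +∞, where only e^{-s z} is
left. The number s is therefore split into three parts `rate`: one compensates the polynomial growth
of φ, one gives decay in y, and one gives decay in z. The resulting joint integrability
(`integrable_prod_wt`) justifies the Fubini exchanges, and the same bounds, locally uniform in x,
allow differentiation under the integral (`hasFDerivAt_intZ`).

Finally, the monodromy operator is a nest of one-dimensional integrals. Collecting the exponentials
gives the same integrand times exp(-e^{z_last - x_a}) (`opURestr_eq`). This is the only place where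
x_a remains, and the limit x_a → +∞ is dominated convergence. -/

/-! ## Monodromy matrices over an arbitrary algebra -/

section Algebra

variable {R : Type*} [Ring R] [Algebra ℂ R]

/-- The Lax matrix built from elements `d`, `em`, `ep` of an algebra, which play the roles of
`∂`, `e^{-x}` and `e^x`. -/
def laxMat (d em ep : R) (u : ℂ) : Matrix (Fin 2) (Fin 2) R :=
  !![algebraMap ℂ R u + Complex.I • d, em; -ep, 0]

/-- The product `L_n(u) ⋯ L_1(u)` of Lax matrices. -/
def chain : (n : ℕ) → (Fin n → R) → (Fin n → R) → (Fin n → R) → ℂ → Matrix (Fin 2) (Fin 2) R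
  | 0, _, _, _, _ => 1
  | n + 1, d, em, ep, u => laxMat (d (Fin.last n)) (em (Fin.last n)) (ep (Fin.last n)) u *
      chain n (fun j => d j.castSucc) (fun j => em j.castSucc) (fun j => ep j.castSucc) u

theorem chain_succ_zero {n : ℕ} (d em ep : Fin (n + 1) → R) (u : ℂ) (a : Fin 2) :
    chain (n + 1) d em ep u 0 a =
      (algebraMap ℂ R u + Complex.I • d (Fin.last n)) *
        chain n (fun j => d j.castSucc) (fun j => em j.castSucc) (fun j => ep j.castSucc) u 0 a +
      em (Fin.last n) *
        chain n (fun j => d j.castSucc) (fun j => em j.castSucc) (fun j => ep j.castSucc) u 1 a := by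
  simp [chain, laxMat, Matrix.mul_apply, Fin.sum_univ_two]

theorem chain_succ_one {n : ℕ} (d em ep : Fin (n + 1) → R) (u : ℂ) (a : Fin 2) :
    chain (n + 1) d em ep u 1 a =
      -(ep (Fin.last n) *
        chain n (fun j => d j.castSucc) (fun j => em j.castSucc) (fun j => ep j.castSucc) u 0 a) := by
  simp [chain, laxMat, Matrix.mul_apply, Fin.sum_univ_two]

theorem chain_commute {n : ℕ} (d em ep : Fin n → R) (u : ℂ) (r : R)
    (hd : ∀ j, Commute r (d j)) (hm : ∀ j, Commute r (em j)) (hp : ∀ j, Commute r (ep j))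
    (a b : Fin 2) : Commute r (chain n d em ep u a b) := by
  induction n generalizing a with
  | zero =>
    fin_cases a <;> fin_cases b <;> simp [chain]
  | succ n ih =>
    have key := fun a => ih (fun j => d j.castSucc) (fun j => em j.castSucc)
      (fun j => ep j.castSucc) (fun j => hd _) (fun j => hm _) (fun j => hp _) a
    fin_cases a
    · simp only [Fin.zero_eta, chain_succ_zero]
      exact ((Commute.add_right (Algebra.commutes u r).symm ((hd _).smul_right _)).mul_right
        (key 0)).add_right ((hm _).mul_right (key 1))
    · simp only [Fin.mk_one, chain_succ_one]
      exact ((hp _).mul_right (key 0)).neg_right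

/-- The quadratic form in the first rows `r(u)`, `r(-u)` of the chain matrices that gives
`𝔹_n(u)`. -/
def bForm (α β : ℝ) (u : ℂ) (r r' : Fin 2 → R) : R :=
  (u - Complex.I / 2) • (r 0 * r' 0 + (β : ℂ) ^ 2 • (r 1 * r' 1)) +
    (α : ℂ) • (r 0 * r' 1 - r 1 * r' 0)

theorem ofFn_reverse_prod_eq_chain {n : ℕ} (d em ep : Fin n → R) (u : ℂ) :
    (List.ofFn fun j => laxMat (d j) (em j) (ep j) u).reverse.prod = chain n d em ep u := by
  induction n with
  | zero => simp [chain]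
  | succ n ih =>
    rw [List.ofFn_succ', chain, ← ih]
    simp

/-- Over a noncommutative ring a product of transposes is not the transpose of the reversed product.
Here it is, because entries that belong to different sites commute. -/
theorem ofFn_transpose_prod_apply {n : ℕ} (d em ep : Fin n → R) (u : ℂ)
    (hc : ∀ i j, i ≠ j → ∀ r ∈ ({d i, em i, ep i} : Set R), Commute r (d j) ∧ Commute r (em j) ∧
      Commute r (ep j)) (a b : Fin 2) :
    (List.ofFn fun j => (laxMat (d j) (em j) (ep j) u).transpose).prod a b =
      chain n d em ep u b a := by
  induction n generalizing b with
  | zero => simp [chain, Matrix.one_apply, eq_comm]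
  | succ n ih =>
    have hcomm : ∀ r ∈ ({d (Fin.last n), em (Fin.last n), ep (Fin.last n)} : Set R), ∀ c,
        Commute r (chain n (fun j => d j.castSucc) (fun j => em j.castSucc)
          (fun j => ep j.castSucc) u c a) := fun r hr c =>
      chain_commute _ _ _ u r (fun j => (hc _ _ (Fin.castSucc_lt_last j).ne' r hr).1)
        (fun j => (hc _ _ (Fin.castSucc_lt_last j).ne' r hr).2.1)
        (fun j => (hc _ _ (Fin.castSucc_lt_last j).ne' r hr).2.2) c a
    rw [List.ofFn_succ', List.concat_eq_append, List.prod_append, List.prod_singleton,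
      Matrix.mul_apply, Fin.sum_univ_two,
      ih _ _ _ (fun i j hij => hc _ _ (fun h => hij (Fin.castSucc_injective n h))),
      ih _ _ _ (fun i j hij => hc _ _ (fun h => hij (Fin.castSucc_injective n h)))]
    have h1 := hcomm (d (Fin.last n)) (by simp) 0
    have h2 := hcomm (em (Fin.last n)) (by simp) 1
    have h3 := hcomm (ep (Fin.last n)) (by simp) 0
    fin_cases b
    · simp only [Fin.zero_eta, chain_succ_zero, laxMat, Matrix.transpose_apply]
      simp only [Matrix.cons_val', Matrix.cons_val_zero, Matrix.cons_val_one,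
        Matrix.of_apply, Matrix.cons_val_fin_one]
      rw [← h2.eq, add_mul, mul_add, Algebra.commutes, smul_mul_assoc, mul_smul_comm, h1.eq]
    · simp only [Fin.mk_one, chain_succ_one, laxMat, Matrix.transpose_apply]
      simp only [Matrix.cons_val', Matrix.cons_val_zero, Matrix.cons_val_one,
        Matrix.of_apply, Matrix.cons_val_fin_one]
      rw [mul_zero, add_zero, mul_neg, h3.eq]

/-- Chain matrices respect linear relations that are compatible with the generators; the last
exponential `e^{x_n}` is not needed for the first row. -/
theorem chain_rel {M₁ M₂ : Type*} [AddCommGroup M₁] [Module ℂ M₁] [AddCommGroup M₂] [Module ℂ M₂]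
    (S : Submodule ℂ (M₁ × M₂)) {n : ℕ} (d₁ em₁ ep₁ : Fin n → Module.End ℂ M₁)
    (d₂ em₂ ep₂ : Fin n → Module.End ℂ M₂) (u : ℂ)
    (hd : ∀ j, ∀ f ∈ S, (d₁ j f.1, d₂ j f.2) ∈ S)
    (hm : ∀ j, ∀ f ∈ S, (em₁ j f.1, em₂ j f.2) ∈ S)
    (hp : ∀ j, ∀ f ∈ S, (ep₁ j f.1, ep₂ j f.2) ∈ S) (a b : Fin 2) (f : M₁ × M₂) (hf : f ∈ S) :
    (chain n d₁ em₁ ep₁ u a b f.1, chain n d₂ em₂ ep₂ u a b f.2) ∈ S := by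
  induction n generalizing a with
  | zero =>
    fin_cases a <;> fin_cases b <;> simp [chain, hf] <;> exact S.zero_mem
  | succ n ih =>
    have key := fun a => ih (fun j => d₁ j.castSucc) (fun j => em₁ j.castSucc)
      (fun j => ep₁ j.castSucc) (fun j => d₂ j.castSucc) (fun j => em₂ j.castSucc)
      (fun j => ep₂ j.castSucc) (fun j => hd _) (fun j => hm _) (fun j => hp _) a
    fin_cases a
    · simp only [Fin.zero_eta, chain_succ_zero]
      have h := S.add_mem (S.add_mem (S.smul_mem u (key 0)) (S.smul_mem Complex.I
        (hd (Fin.last n) _ (key 0)))) (hm (Fin.last n) _ (key 1))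
      simpa [Module.algebraMap_end_apply] using h
    · simp only [Fin.mk_one, chain_succ_one]
      simpa using S.neg_mem (hp (Fin.last n) _ (key 0))

/-- The last `ep` multiplies only into the second row, so S need not be stable under it. Applied to
S × S this gives invariance of a space; applied to a relation such as `intRel` it carries operators
through a transform. -/
theorem chain_rel_zero {M₁ M₂ : Type*} [AddCommGroup M₁] [Module ℂ M₁] [AddCommGroup M₂]
    [Module ℂ M₂] (S : Submodule ℂ (M₁ × M₂)) {n : ℕ} (d₁ em₁ ep₁ : Fin (n + 1) → Module.End ℂ M₁)
    (d₂ em₂ ep₂ : Fin (n + 1) → Module.End ℂ M₂) (u : ℂ)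
    (hd : ∀ j, ∀ f ∈ S, (d₁ j f.1, d₂ j f.2) ∈ S)
    (hm : ∀ j, ∀ f ∈ S, (em₁ j f.1, em₂ j f.2) ∈ S)
    (hp : ∀ j : Fin n, ∀ f ∈ S, (ep₁ j.castSucc f.1, ep₂ j.castSucc f.2) ∈ S) (b : Fin 2)
    (f : M₁ × M₂) (hf : f ∈ S) :
    (chain (n + 1) d₁ em₁ ep₁ u 0 b f.1, chain (n + 1) d₂ em₂ ep₂ u 0 b f.2) ∈ S := by
  have key := fun a => chain_rel S (fun j => d₁ j.castSucc) (fun j => em₁ j.castSucc)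
      (fun j => ep₁ j.castSucc) (fun j => d₂ j.castSucc) (fun j => em₂ j.castSucc)
      (fun j => ep₂ j.castSucc) u (fun j => hd _) (fun j => hm _) hp a b f hf
  simp only [chain_succ_zero]
  have h := S.add_mem (S.add_mem (S.smul_mem u (key 0)) (S.smul_mem Complex.I
    (hd (Fin.last n) _ (key 0)))) (hm (Fin.last n) _ (key 1))
  simpa [Module.algebraMap_end_apply] using h

theorem bForm_rel {M₁ M₂ : Type*} [AddCommGroup M₁] [Module ℂ M₁] [AddCommGroup M₂]
    [Module ℂ M₂] (S : Submodule ℂ (M₁ × M₂)) (α β : ℝ) (u : ℂ)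
    (r₁ r₁' : Fin 2 → Module.End ℂ M₁) (r₂ r₂' : Fin 2 → Module.End ℂ M₂)
    (h : ∀ a, ∀ f ∈ S, (r₁ a f.1, r₂ a f.2) ∈ S) (h' : ∀ a, ∀ f ∈ S, (r₁' a f.1, r₂' a f.2) ∈ S)
    (f : M₁ × M₂) (hf : f ∈ S) :
    (bForm α β u r₁ r₁' f.1, bForm α β u r₂ r₂' f.2) ∈ S := by
  have H := fun a b => h a _ (h' b f hf)
  have := S.add_mem (S.smul_mem (u - Complex.I / 2)
    (S.add_mem (H 0 0) (S.smul_mem ((β : ℂ) ^ 2) (H 1 1))))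
    (S.smul_mem (α : ℂ) (S.sub_mem (H 0 1) (H 1 0)))
  simpa [bForm] using this

/-- The sign of the transposition of the `a`-th entry of the first row of a chain of length `n`. -/
def chainSign (n : ℕ) (a : Fin 2) : ℂ := (-1) ^ n * (if a = 0 then 1 else -1)

theorem chainSign_sq (n : ℕ) (a : Fin 2) : chainSign n a * chainSign n a = 1 := by
  have : ((-1 : ℂ) ^ n) * (-1) ^ n = 1 := by rw [← mul_pow]; simp
  unfold chainSign; split_ifs <;> linear_combination this

variable {M : Type*} [AddCommGroup M] [Module ℂ M]

/-- The transpose of u + i∂ is u - i∂ = -(-u + i∂), which produces one sign per site. Transposition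
also reverses the order of the sites, and this is undone because different sites commute. Only the
first row is treated, so the last `ep` is not required to preserve the spaces or to be symmetric. -/
theorem chain_adjoint_step {M' : Type*} [AddCommGroup M'] [Module ℂ M']
    (V : Submodule ℂ M) (W : Submodule ℂ M') (B : M → M' → ℂ)
    (hadd₁ : ∀ f ∈ V, ∀ f' ∈ V, ∀ h ∈ W, B (f + f') h = B f h + B f' h)
    (hsmul₁ : ∀ (c : ℂ), ∀ f ∈ V, ∀ h ∈ W, B (c • f) h = c * B f h)
    (hadd₂ : ∀ f ∈ V, ∀ h ∈ W, ∀ h' ∈ W, B f (h + h') = B f h + B f h')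
    (hsmul₂ : ∀ (c : ℂ), ∀ f ∈ V, ∀ h ∈ W, B f (c • h) = c * B f h)
    {n : ℕ} (d₁ em₁ ep₁ : Fin (n + 1) → Module.End ℂ M)
    (d₂ em₂ ep₂ : Fin (n + 1) → Module.End ℂ M') (u : ℂ)
    (hdV : ∀ j, ∀ f ∈ V, d₁ j f ∈ V) (hmV : ∀ j, ∀ f ∈ V, em₁ j f ∈ V)
    (hpV : ∀ j : Fin n, ∀ f ∈ V, ep₁ j.castSucc f ∈ V)
    (hdW : ∀ j, ∀ f ∈ W, d₂ j f ∈ W) (hmW : ∀ j, ∀ f ∈ W, em₂ j f ∈ W)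
    (hpW : ∀ j : Fin n, ∀ f ∈ W, ep₂ j.castSucc f ∈ W)
    (hd : ∀ j, ∀ f ∈ V, ∀ h ∈ W, B (d₁ j f) h = -B f (d₂ j h))
    (hm : ∀ j, ∀ f ∈ V, ∀ h ∈ W, B (em₁ j f) h = B f (em₂ j h))
    (hc : ∀ i j, i ≠ j → ∀ r ∈ ({d₂ i, em₂ i, ep₂ i} : Set (Module.End ℂ M')),
      Commute r (d₂ j) ∧ Commute r (em₂ j) ∧ Commute r (ep₂ j)) (b : Fin 2)
    (IH : ∀ f ∈ V, ∀ h ∈ W,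
      B (chain n (fun j => d₁ j.castSucc) (fun j => em₁ j.castSucc)
        (fun j => ep₁ j.castSucc) u 0 b f) h = chainSign n b *
      B f (chain n (fun j => d₂ j.castSucc) (fun j => em₂ j.castSucc)
        (fun j => ep₂ j.castSucc) (-u) 0 b h) ∧
      B (chain n (fun j => d₁ j.castSucc) (fun j => em₁ j.castSucc)
        (fun j => ep₁ j.castSucc) u 1 b f) h = -chainSign n b *
      B f (chain n (fun j => d₂ j.castSucc) (fun j => em₂ j.castSucc)
        (fun j => ep₂ j.castSucc) (-u) 1 b h)) :
    ∀ f ∈ V, ∀ h ∈ W, B (chain (n + 1) d₁ em₁ ep₁ u 0 b f) h =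
      chainSign (n + 1) b * B f (chain (n + 1) d₂ em₂ ep₂ (-u) 0 b h) := by
  intro f hf h hh
  have hcomm : ∀ r ∈ ({d₂ (Fin.last n), em₂ (Fin.last n), ep₂ (Fin.last n)} :
      Set (Module.End ℂ M')), ∀ c,
      Commute r (chain n (fun j => d₂ j.castSucc) (fun j => em₂ j.castSucc)
        (fun j => ep₂ j.castSucc) (-u) c b) := fun r hr c =>
    chain_commute _ _ _ _ r (fun j => (hc _ _ (Fin.castSucc_lt_last j).ne' r hr).1)
      (fun j => (hc _ _ (Fin.castSucc_lt_last j).ne' r hr).2.1)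
      (fun j => (hc _ _ (Fin.castSucc_lt_last j).ne' r hr).2.2) c b
  have e1 := fun c => LinearMap.congr_fun (hcomm (d₂ (Fin.last n)) (by simp) c).eq h
  have e2 := fun c => LinearMap.congr_fun (hcomm (em₂ (Fin.last n)) (by simp) c).eq h
  have e3 := fun c => LinearMap.congr_fun (hcomm (ep₂ (Fin.last n)) (by simp) c).eq h
  have memV : ∀ a, chain n (fun j => d₁ j.castSucc) (fun j => em₁ j.castSucc)
      (fun j => ep₁ j.castSucc) u a b f ∈ V := fun a => by
    have := chain_rel (V.prod V) (fun j : Fin n => d₁ j.castSucc) (fun j => em₁ j.castSucc)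
      (fun j => ep₁ j.castSucc) (fun j : Fin n => d₁ j.castSucc) (fun j => em₁ j.castSucc)
      (fun j => ep₁ j.castSucc) u (fun j g hg => ⟨hdV _ _ hg.1, hdV _ _ hg.2⟩)
      (fun j g hg => ⟨hmV _ _ hg.1, hmV _ _ hg.2⟩) (fun j g hg => ⟨hpV j _ hg.1, hpV j _ hg.2⟩)
      a b (f, f) ⟨hf, hf⟩
    exact this.1
  have memW : ∀ a, chain n (fun j => d₂ j.castSucc) (fun j => em₂ j.castSucc)
      (fun j => ep₂ j.castSucc) (-u) a b h ∈ W := fun a => by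
    have := chain_rel (W.prod W) (fun j : Fin n => d₂ j.castSucc) (fun j => em₂ j.castSucc)
      (fun j => ep₂ j.castSucc) (fun j : Fin n => d₂ j.castSucc) (fun j => em₂ j.castSucc)
      (fun j => ep₂ j.castSucc) (-u) (fun j g hg => ⟨hdW _ _ hg.1, hdW _ _ hg.2⟩)
      (fun j g hg => ⟨hmW _ _ hg.1, hmW _ _ hg.2⟩) (fun j g hg => ⟨hpW _ _ hg.1, hpW _ _ hg.2⟩)
      a b (h, h) ⟨hh, hh⟩
    exact this.1
  have hs : chainSign (n + 1) b = -chainSign n b := by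
    unfold chainSign; split_ifs <;> ring
  simp only [Module.End.mul_apply] at e1 e2 e3
  simp only [chain_succ_zero, LinearMap.add_apply, Module.End.mul_apply,
    Module.algebraMap_end_apply, LinearMap.smul_apply]
  rw [hadd₁ _ (V.add_mem (V.smul_mem _ (memV 0)) (V.smul_mem _ (hdV _ _ (memV 0)))) _
    (hmV _ _ (memV 1)) _ hh,
    hadd₁ _ (V.smul_mem _ (memV 0)) _ (V.smul_mem _ (hdV _ _ (memV 0))) _ hh,
    hsmul₁ _ _ (memV 0) _ hh, hsmul₁ _ _ (hdV _ _ (memV 0)) _ hh,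
    hd _ _ (memV 0) _ hh, hm _ _ (memV 1) _ hh, (IH f hf h hh).1,
    (IH f hf _ (hdW _ _ hh)).1, (IH f hf _ (hmW _ _ hh)).2, ← e1, ← e2,
    hadd₂ _ hf _ (W.add_mem (W.smul_mem _ (memW 0)) (W.smul_mem _ (hdW _ _ (memW 0)))) _
    (hmW _ _ (memW 1)),
    hadd₂ _ hf _ (W.smul_mem _ (memW 0)) _ (W.smul_mem _ (hdW _ _ (memW 0))),
    hsmul₂ _ _ hf _ (memW 0), hsmul₂ _ _ hf _ (hdW _ _ (memW 0)), hs]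
  ring

/-- Transposition of chain matrices with respect to a bilinear pairing. -/
theorem chain_adjoint {M' : Type*} [AddCommGroup M'] [Module ℂ M']
    (V : Submodule ℂ M) (W : Submodule ℂ M') (B : M → M' → ℂ)
    (hadd₁ : ∀ f ∈ V, ∀ f' ∈ V, ∀ h ∈ W, B (f + f') h = B f h + B f' h)
    (hsmul₁ : ∀ (c : ℂ), ∀ f ∈ V, ∀ h ∈ W, B (c • f) h = c * B f h)
    (hadd₂ : ∀ f ∈ V, ∀ h ∈ W, ∀ h' ∈ W, B f (h + h') = B f h + B f h')
    (hsmul₂ : ∀ (c : ℂ), ∀ f ∈ V, ∀ h ∈ W, B f (c • h) = c * B f h)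
    {n : ℕ} (d₁ em₁ ep₁ : Fin n → Module.End ℂ M) (d₂ em₂ ep₂ : Fin n → Module.End ℂ M') (u : ℂ)
    (hdV : ∀ j, ∀ f ∈ V, d₁ j f ∈ V) (hmV : ∀ j, ∀ f ∈ V, em₁ j f ∈ V)
    (hpV : ∀ j, ∀ f ∈ V, ep₁ j f ∈ V)
    (hdW : ∀ j, ∀ f ∈ W, d₂ j f ∈ W) (hmW : ∀ j, ∀ f ∈ W, em₂ j f ∈ W)
    (hpW : ∀ j, ∀ f ∈ W, ep₂ j f ∈ W)
    (hd : ∀ j, ∀ f ∈ V, ∀ h ∈ W, B (d₁ j f) h = -B f (d₂ j h))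
    (hm : ∀ j, ∀ f ∈ V, ∀ h ∈ W, B (em₁ j f) h = B f (em₂ j h))
    (hp : ∀ j, ∀ f ∈ V, ∀ h ∈ W, B (ep₁ j f) h = B f (ep₂ j h))
    (hc : ∀ i j, i ≠ j → ∀ r ∈ ({d₂ i, em₂ i, ep₂ i} : Set (Module.End ℂ M')),
      Commute r (d₂ j) ∧ Commute r (em₂ j) ∧ Commute r (ep₂ j)) (b : Fin 2) :
    ∀ f ∈ V, ∀ h ∈ W,
      B (chain n d₁ em₁ ep₁ u 0 b f) h = chainSign n b * B f (chain n d₂ em₂ ep₂ (-u) 0 b h) ∧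
      B (chain n d₁ em₁ ep₁ u 1 b f) h = -chainSign n b * B f (chain n d₂ em₂ ep₂ (-u) 1 b h) := by
  induction n with
  | zero =>
    intro f hf h hh
    have h0 : B 0 h = 0 := by simpa using hsmul₁ 0 f hf h hh
    have h0' : B f 0 = 0 := by simpa using hsmul₂ 0 f hf h hh
    fin_cases b <;> simp [chain, chainSign, h0, h0', Matrix.one_apply]
  | succ n ih =>
    intro f hf h hh
    have IH := ih (fun j => d₁ j.castSucc) (fun j => em₁ j.castSucc)
      (fun j => ep₁ j.castSucc) (fun j => d₂ j.castSucc) (fun j => em₂ j.castSucc)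
      (fun j => ep₂ j.castSucc) (fun j => hdV _) (fun j => hmV _) (fun j => hpV _)
      (fun j => hdW _) (fun j => hmW _) (fun j => hpW _) (fun j => hd _) (fun j => hm _)
      (fun j => hp _) (fun i j hij => hc _ _ (fun h => hij (Fin.castSucc_injective n h)))
    have hcomm : ∀ r ∈ ({d₂ (Fin.last n), em₂ (Fin.last n), ep₂ (Fin.last n)} :
        Set (Module.End ℂ M')), ∀ c,
        Commute r (chain n (fun j => d₂ j.castSucc) (fun j => em₂ j.castSucc)
          (fun j => ep₂ j.castSucc) (-u) c b) := fun r hr c =>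
      chain_commute _ _ _ _ r (fun j => (hc _ _ (Fin.castSucc_lt_last j).ne' r hr).1)
        (fun j => (hc _ _ (Fin.castSucc_lt_last j).ne' r hr).2.1)
        (fun j => (hc _ _ (Fin.castSucc_lt_last j).ne' r hr).2.2) c b
    have e1 := fun c => LinearMap.congr_fun (hcomm (d₂ (Fin.last n)) (by simp) c).eq h
    have e2 := fun c => LinearMap.congr_fun (hcomm (em₂ (Fin.last n)) (by simp) c).eq h
    have e3 := fun c => LinearMap.congr_fun (hcomm (ep₂ (Fin.last n)) (by simp) c).eq h
    have memV : ∀ a, chain n (fun j => d₁ j.castSucc) (fun j => em₁ j.castSucc)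
        (fun j => ep₁ j.castSucc) u a b f ∈ V := fun a => by
      have := chain_rel (V.prod V) (fun j : Fin n => d₁ j.castSucc) (fun j => em₁ j.castSucc)
        (fun j => ep₁ j.castSucc) (fun j : Fin n => d₁ j.castSucc) (fun j => em₁ j.castSucc)
        (fun j => ep₁ j.castSucc) u (fun j g hg => ⟨hdV _ _ hg.1, hdV _ _ hg.2⟩)
        (fun j g hg => ⟨hmV _ _ hg.1, hmV _ _ hg.2⟩) (fun j g hg => ⟨hpV _ _ hg.1, hpV _ _ hg.2⟩)
        a b (f, f) ⟨hf, hf⟩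
      exact this.1
    have memW : ∀ a, chain n (fun j => d₂ j.castSucc) (fun j => em₂ j.castSucc)
        (fun j => ep₂ j.castSucc) (-u) a b h ∈ W := fun a => by
      have := chain_rel (W.prod W) (fun j : Fin n => d₂ j.castSucc) (fun j => em₂ j.castSucc)
        (fun j => ep₂ j.castSucc) (fun j : Fin n => d₂ j.castSucc) (fun j => em₂ j.castSucc)
        (fun j => ep₂ j.castSucc) (-u) (fun j g hg => ⟨hdW _ _ hg.1, hdW _ _ hg.2⟩)
        (fun j g hg => ⟨hmW _ _ hg.1, hmW _ _ hg.2⟩) (fun j g hg => ⟨hpW _ _ hg.1, hpW _ _ hg.2⟩)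
        a b (h, h) ⟨hh, hh⟩
      exact this.1
    have hs : chainSign (n + 1) b = -chainSign n b := by
      unfold chainSign; split_ifs <;> ring
    simp only [Module.End.mul_apply] at e1 e2 e3
    refine ⟨chain_adjoint_step V W B hadd₁ hsmul₁ hadd₂ hsmul₂ d₁ em₁ ep₁ d₂ em₂ ep₂ u hdV hmV
      (fun j => hpV _) hdW hmW (fun j => hpW _) hd hm hc b IH f hf h hh, ?_⟩
    simp only [chain_succ_one, LinearMap.neg_apply, Module.End.mul_apply]
    rw [← neg_one_smul ℂ, hsmul₁ _ _ (hpV _ _ (memV 0)) _ hh, hp _ _ (memV 0) _ hh,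
        (IH f hf _ (hpW _ _ hh)).1, ← e3, ← neg_one_smul ℂ (ep₂ _ _),
        hsmul₂ _ _ hf _ (hpW _ _ (memW 0)), hs]
    ring

/-- Transposition of the first row, without the last exponential `e^{x_n}`. -/
theorem chain_adjoint_zero {M' : Type*} [AddCommGroup M'] [Module ℂ M']
    (V : Submodule ℂ M) (W : Submodule ℂ M') (B : M → M' → ℂ)
    (hadd₁ : ∀ f ∈ V, ∀ f' ∈ V, ∀ h ∈ W, B (f + f') h = B f h + B f' h)
    (hsmul₁ : ∀ (c : ℂ), ∀ f ∈ V, ∀ h ∈ W, B (c • f) h = c * B f h)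
    (hadd₂ : ∀ f ∈ V, ∀ h ∈ W, ∀ h' ∈ W, B f (h + h') = B f h + B f h')
    (hsmul₂ : ∀ (c : ℂ), ∀ f ∈ V, ∀ h ∈ W, B f (c • h) = c * B f h)
    {n : ℕ} (d₁ em₁ ep₁ : Fin (n + 1) → Module.End ℂ M)
    (d₂ em₂ ep₂ : Fin (n + 1) → Module.End ℂ M') (u : ℂ)
    (hdV : ∀ j, ∀ f ∈ V, d₁ j f ∈ V) (hmV : ∀ j, ∀ f ∈ V, em₁ j f ∈ V)
    (hpV : ∀ j : Fin n, ∀ f ∈ V, ep₁ j.castSucc f ∈ V)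
    (hdW : ∀ j, ∀ f ∈ W, d₂ j f ∈ W) (hmW : ∀ j, ∀ f ∈ W, em₂ j f ∈ W)
    (hpW : ∀ j : Fin n, ∀ f ∈ W, ep₂ j.castSucc f ∈ W)
    (hd : ∀ j, ∀ f ∈ V, ∀ h ∈ W, B (d₁ j f) h = -B f (d₂ j h))
    (hm : ∀ j, ∀ f ∈ V, ∀ h ∈ W, B (em₁ j f) h = B f (em₂ j h))
    (hp : ∀ j : Fin n, ∀ f ∈ V, ∀ h ∈ W, B (ep₁ j.castSucc f) h = B f (ep₂ j.castSucc h))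
    (hc : ∀ i j, i ≠ j → ∀ r ∈ ({d₂ i, em₂ i, ep₂ i} : Set (Module.End ℂ M')),
      Commute r (d₂ j) ∧ Commute r (em₂ j) ∧ Commute r (ep₂ j)) (b : Fin 2) :
    ∀ f ∈ V, ∀ h ∈ W, B (chain (n + 1) d₁ em₁ ep₁ u 0 b f) h =
      chainSign (n + 1) b * B f (chain (n + 1) d₂ em₂ ep₂ (-u) 0 b h) :=
  chain_adjoint_step V W B hadd₁ hsmul₁ hadd₂ hsmul₂ d₁ em₁ ep₁ d₂ em₂ ep₂ u hdV hmV
    hpV hdW hmW hpW hd hm hc b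
    (chain_adjoint V W B hadd₁ hsmul₁ hadd₂ hsmul₂ _ _ _ _ _ _ u (fun _ => hdV _) (fun _ => hmV _)
      hpV (fun _ => hdW _) (fun _ => hmW _) hpW (fun _ => hd _) (fun _ => hm _) hp
      (fun _ _ hij => hc _ _ (fun h => hij (Fin.castSucc_injective n h))) b)

end Algebra


/-! ## Multiplication operators and partial derivatives -/

theorem pd_apply_eq_deriv {n : ℕ} (j : Fin n) (f : Smooth n) (x : Fin n → ℝ) :
    (pd j f).1 x = deriv (fun t : ℝ => f.1 (x + t • Pi.single j (1 : ℝ))) 0 :=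
  ((smooth_differentiable f x).lineDeriv_eq_fderiv).symm

theorem hasLineDerivAt_pd {n : ℕ} (j : Fin n) (f : Smooth n) (x : Fin n → ℝ) :
    HasLineDerivAt ℝ f.1 ((pd j f).1 x) x (Pi.single j (1 : ℝ)) :=
  (smooth_differentiable f x).hasFDerivAt.hasLineDerivAt _

theorem pd_eq_of_hasDerivAt {n : ℕ} (j : Fin n) (f : Smooth n) (x : Fin n → ℝ) (c : ℂ)
    (h : HasDerivAt (fun t : ℝ => f.1 (x + t • Pi.single j (1 : ℝ))) c 0) : (pd j f).1 x = c := by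
  rw [pd_apply_eq_deriv, h.deriv]

/-- Multiplication by a smooth function. -/
def mulS {n : ℕ} (g : Smooth n) : DiffOp n where
  toFun f := ⟨fun x => g.1 x * f.1 x, by
    have hg : ContDiff ℝ ∞ g.1 := g.2
    have hf : ContDiff ℝ ∞ f.1 := f.2
    exact hg.mul hf⟩
  map_add' f f' := by ext x; simp [mul_add]
  map_smul' c f := by ext x; simp [mul_left_comm]

@[simp] theorem mulS_apply {n : ℕ} (g f : Smooth n) (x : Fin n → ℝ) :
    (mulS g f).1 x = g.1 x * f.1 x := rfl

theorem mulS_commute {n : ℕ} (g h : Smooth n) : Commute (mulS g) (mulS h) := by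
  ext f x
  simp [mul_left_comm]

theorem pd_mulS {n : ℕ} (i : Fin n) (g f : Smooth n) :
    pd i (mulS g f) = mulS (pd i g) f + mulS g (pd i f) := by
  ext x
  apply pd_eq_of_hasDerivAt
  have h := HasDerivAt.fun_mul (hasLineDerivAt_pd i g x) (hasLineDerivAt_pd i f x)
  simpa using h

theorem pd_mulS_apply {n : ℕ} (i : Fin n) (g f : Smooth n) (x : Fin n → ℝ) :
    (pd i (mulS g f)).1 x = (pd i g).1 x * f.1 x + g.1 x * (pd i f).1 x := by
  rw [pd_mulS]; rfl

theorem pd_commute {n : ℕ} (i j : Fin n) : Commute (pd i) (pd j) := by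
  ext f x
  have hf : ContDiff ℝ ∞ f.1 := f.2
  have h1 : ∀ v w : Fin n → ℝ, fderiv ℝ (fun y => fderiv ℝ f.1 y v) x w =
      fderiv ℝ (fderiv ℝ f.1) x w v := fun v w => by
    have hd : DifferentiableAt ℝ (fderiv ℝ f.1) x :=
      ((hf.fderiv_right (m := 1) (by norm_cast)).differentiable (by simp)) x
    rw [fderiv_clm_apply hd (by fun_prop)]
    simp
  have h2 := (hf.contDiffAt (x := x)).isSymmSndFDerivAt (by simp; norm_cast)
  change fderiv ℝ (fun y => fderiv ℝ f.1 y _) x _ = fderiv ℝ (fun y => fderiv ℝ f.1 y _) x _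
  rw [h1, h1, h2]

theorem pd_commute_mulS {n : ℕ} (i : Fin n) (g : Smooth n) (h : pd i g = 0) :
    Commute (pd i) (mulS g) := by
  ext f x
  simp [pd_mulS, h]

/-- The exponential of a linear form. -/
def expS {n : ℕ} (m : Fin n → ℝ) : Smooth n :=
  ⟨fun x => (Real.exp (∑ i, m i * x i) : ℂ), by
    have h : ContDiff ℝ ∞ (fun x : Fin n → ℝ => Real.exp (∑ i, m i * x i)) := by fun_prop
    exact Complex.ofRealCLM.contDiff.comp h⟩

theorem expS_apply {n : ℕ} (m x : Fin n → ℝ) :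
    (expS m).1 x = (Real.exp (∑ i, m i * x i) : ℂ) := rfl

theorem pd_expS {n : ℕ} (i : Fin n) (m : Fin n → ℝ) : pd i (expS m) = (m i : ℂ) • expS m := by
  ext x
  apply pd_eq_of_hasDerivAt
  have h1 : HasDerivAt (fun t : ℝ => ∑ k, m k * (x k + t * (Pi.single i (1 : ℝ) : Fin n → ℝ) k))
      (∑ k, m k * (1 * (Pi.single i (1 : ℝ) : Fin n → ℝ) k)) 0 :=
    HasDerivAt.fun_sum fun k _ => (((hasDerivAt_id (0 : ℝ)).mul_const _).const_add _).const_mul _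
  have h2 := h1.exp.ofReal_comp
  convert! h2 using 1
  simp [expS_apply, Pi.single_apply, mul_comm]

theorem mulS_expS_expS {n : ℕ} (m m' : Fin n → ℝ) (f : Smooth n) :
    mulS (expS m) (mulS (expS m') f) = mulS (expS (m + m')) f := by
  ext x
  simp only [mulS_apply, expS_apply, Pi.add_apply, add_mul, Finset.sum_add_distrib, Real.exp_add]
  push_cast
  ring

theorem mulS_expS_zero {n : ℕ} (f : Smooth n) : mulS (expS 0) f = f := by
  ext x
  simp [expS_apply]

theorem expMul_eq_mulS {n : ℕ} (s : ℝ) (j : Fin n) : expMul s j = mulS (expS (Pi.single j s)) := by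
  ext f x
  simp [expS_apply, expMul, Pi.single_apply]

theorem expMul_apply {n : ℕ} (s : ℝ) (j : Fin n) (f : Smooth n) (x : Fin n → ℝ) :
    (expMul s j f).1 x = (Real.exp (s * x j) : ℂ) * f.1 x := rfl

theorem pd_commute_expMul {n : ℕ} {i j : Fin n} (h : i ≠ j) (s : ℝ) :
    Commute (pd i) (expMul s j) := by
  rw [expMul_eq_mulS]
  exact pd_commute_mulS _ _ (by simp [pd_expS, h])

theorem expMul_commute {n : ℕ} (s t : ℝ) (i j : Fin n) : Commute (expMul s i) (expMul t j) := by
  rw [expMul_eq_mulS, expMul_eq_mulS]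
  exact mulS_commute _ _

theorem pd_expMul_apply {n : ℕ} (i j : Fin n) (s : ℝ) (f : Smooth n) (x : Fin n → ℝ) :
    (pd i (expMul s j f)).1 x = (Real.exp (s * x j) : ℂ) *
      ((if i = j then (s : ℂ) else 0) * f.1 x + (pd i f).1 x) := by
  rw [expMul_eq_mulS, pd_mulS_apply, pd_expS]
  have : (expS (Pi.single j s)).1 x = (Real.exp (s * x j) : ℂ) := by
    simp [expS_apply, Pi.single_apply]
  simp only [Submodule.coe_smul, Pi.smul_apply, smul_eq_mul, this, Pi.single_apply]
  split_ifs <;> simp <;> ring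

/-- The chain matrix in the variables with indices `ι j`; `c = 1`, and `c = -1` for its
transpose. -/
def siteChain {n N : ℕ} (ι : Fin n → Fin N) (c : ℂ) (u : ℂ) : Matrix (Fin 2) (Fin 2) (DiffOp N) :=
  chain n (fun j => c • pd (ι j)) (fun j => expMul (-1) (ι j)) (fun j => expMul 1 (ι j)) u

theorem site_commute {n N : ℕ} (ι : Fin n → Fin N) (hι : Function.Injective ι) (c : ℂ)
    (i j : Fin n) (hij : i ≠ j) : ∀ r ∈ ({c • pd (ι i), expMul (-1) (ι i), expMul 1 (ι i)} :
      Set (DiffOp N)), Commute r (c • pd (ι j)) ∧ Commute r (expMul (-1) (ι j)) ∧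
      Commute r (expMul 1 (ι j)) := by
  have h := hι.ne hij
  intro r hr
  simp only [Set.mem_insert_iff, Set.mem_singleton_iff] at hr
  rcases hr with rfl | rfl | rfl
  · exact ⟨((pd_commute _ _).smul_left _).smul_right _, (pd_commute_expMul h _).smul_left _,
      (pd_commute_expMul h _).smul_left _⟩
  · exact ⟨(pd_commute_expMul h.symm _).symm.smul_right _, expMul_commute _ _ _ _,
      expMul_commute _ _ _ _⟩
  · exact ⟨(pd_commute_expMul h.symm _).symm.smul_right _, expMul_commute _ _ _ _,
      expMul_commute _ _ _ _⟩

/-- The final σ₂ selects, with the factor -i, the first column of the transposed product, that is,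
the first row of the chain at -u. With v = u - i/2 the matrix -i K(u) σ₂ equals [[v, α], [-α, β²
v]], and these are the coefficients of `bForm`. -/
theorem opB_eq_bForm (α β : ℝ) (n : ℕ) (u : ℂ) :
    opB α β n u = bForm α β u (siteChain id 1 u 0) (siteChain id 1 (-u) 0) := by
  have h1 : (List.ofFn fun j : Fin n => lax j u).reverse.prod = siteChain id 1 u := by
    rw [siteChain, ← ofFn_reverse_prod_eq_chain]
    simp [lax, laxMat]
  have h2 : ∀ a b, (List.ofFn fun j : Fin n => (lax j (-u)).transpose).prod a b =
      siteChain id 1 (-u) b a := fun a b => by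
    rw [siteChain, ← ofFn_transpose_prod_apply]
    · simp [lax, laxMat]
    · exact site_commute id Function.injective_id 1
  rw [opB, monodromyMatrix, h1]
  ext f x
  simp only [Matrix.mul_apply, Fin.sum_univ_two, h2, scalarMat, boundaryK, sigma2, bForm,
    Matrix.map_apply, Matrix.of_apply, Matrix.cons_val', Matrix.cons_val_zero, Matrix.cons_val_one,
    Matrix.cons_val_fin_one, LinearMap.add_apply, Module.End.mul_apply, LinearMap.sub_apply,
    Module.algebraMap_end_apply, LinearMap.smul_apply, map_smul, map_zero, LinearMap.zero_apply,
    Submodule.coe_add, Submodule.coe_sub, Submodule.coe_smul, Pi.add_apply, Pi.sub_apply,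
    Pi.smul_apply, smul_eq_mul, Submodule.coe_zero, Pi.zero_apply]
  have h3 : Complex.I ^ 3 = -Complex.I := by rw [pow_succ, Complex.I_sq]; ring
  ring_nf
  simp only [Complex.I_sq, h3]
  ring


/-! ## The kernel of the raising operator of the open Toda chain -/

/-- The kernel `Λ(x|z)` that connects chains with `n` and `n + 1` sites. -/
def kerLam {n : ℕ} (lam : ℂ) (x : Fin n → ℝ) (z : Fin (n + 1) → ℝ) : ℂ :=
  Complex.exp (Complex.I * lam * ((∑ i, x i - ∑ i, z i : ℝ) : ℂ)
    - ((∑ j : Fin n, (Real.exp (z j.castSucc - x j) + Real.exp (x j - z j.succ)) : ℝ) : ℂ))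

/-- The first `n` of `n + (n + 1)` coordinates. -/
abbrev coordX {n : ℕ} (p : Fin (n + (n + 1)) → ℝ) : Fin n → ℝ := fun j => p (Fin.castAdd (n + 1) j)

/-- The last `n + 1` of `n + (n + 1)` coordinates. -/
abbrev coordZ {n : ℕ} (p : Fin (n + (n + 1)) → ℝ) : Fin (n + 1) → ℝ := fun j => p (Fin.natAdd n j)

/-- The kernel `Λ(x|z)` as a smooth function of all its variables. -/
def lamS (n : ℕ) (lam : ℂ) : Smooth (n + (n + 1)) :=
  ⟨fun p => kerLam lam (coordX p) (coordZ p), by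
    have h1 : ContDiff ℝ ∞ (fun p : Fin (n + (n + 1)) → ℝ =>
        (∑ i, coordX p i - ∑ i, coordZ p i : ℝ)) := by
      unfold coordX coordZ; fun_prop
    have h2 : ContDiff ℝ ∞ (fun p : Fin (n + (n + 1)) → ℝ =>
        (∑ j : Fin n, (Real.exp (coordZ p j.castSucc - coordX p j) +
          Real.exp (coordX p j - coordZ p j.succ)) : ℝ)) := by
      unfold coordX coordZ; fun_prop
    exact ((contDiff_const.mul (Complex.ofRealCLM.contDiff.comp h1)).sub
      (Complex.ofRealCLM.contDiff.comp h2)).cexp⟩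

theorem lamS_apply (n : ℕ) (lam : ℂ) (p : Fin (n + (n + 1)) → ℝ) :
    (lamS n lam).1 p = kerLam lam (coordX p) (coordZ p) := rfl

theorem hasDerivAt_kerLam {n : ℕ} (lam : ℂ) (x x' : Fin n → ℝ) (z z' : Fin (n + 1) → ℝ) :
    HasDerivAt (fun t : ℝ => kerLam lam (x + t • x') (z + t • z'))
      ((Complex.I * lam * ((∑ i, x' i - ∑ i, z' i : ℝ) : ℂ)
        - ((∑ j : Fin n, (Real.exp (z j.castSucc - x j) * (z' j.castSucc - x' j) +
          Real.exp (x j - z j.succ) * (x' j - z' j.succ)) : ℝ) : ℂ)) * kerLam lam x z) 0 := by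
  have hx : ∀ j, HasDerivAt (fun t : ℝ => x j + t * x' j) (x' j) 0 := fun j => by
    simpa using ((hasDerivAt_id (0 : ℝ)).mul_const (x' j)).const_add (x j)
  have hz : ∀ j, HasDerivAt (fun t : ℝ => z j + t * z' j) (z' j) 0 := fun j => by
    simpa using ((hasDerivAt_id (0 : ℝ)).mul_const (z' j)).const_add (z j)
  have h1 := ((HasDerivAt.fun_sum fun j (_ : j ∈ Finset.univ) => hx j).sub
    (HasDerivAt.fun_sum fun j (_ : j ∈ Finset.univ) => hz j)).ofReal_comp.const_mul
      (Complex.I * lam)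
  have h2 := (HasDerivAt.fun_sum fun j (_ : j ∈ Finset.univ) =>
    ((hz (Fin.castSucc j)).sub (hx j)).exp.add ((hx j).sub (hz j.succ)).exp).ofReal_comp
  have h3 := (h1.sub h2).cexp
  convert! h3 using 1
  simp [kerLam, mul_comm]

theorem pd_lamS_x {n : ℕ} (lam : ℂ) (j : Fin n) (p : Fin (n + (n + 1)) → ℝ) :
    (pd (Fin.castAdd (n + 1) j) (lamS n lam)).1 p =
      (Complex.I * lam + (Real.exp (coordZ p j.castSucc) : ℂ) * (Real.exp (-coordX p j) : ℂ)
        - (Real.exp (coordX p j) : ℂ) * (Real.exp (-coordZ p j.succ) : ℂ)) * (lamS n lam).1 p := by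
  apply pd_eq_of_hasDerivAt
  have h := hasDerivAt_kerLam lam (coordX p) (Pi.single j 1) (coordZ p) 0
  convert! h using 1
  · funext t
    rw [lamS_apply]
    congr 1
    · funext i
      simp [Pi.single_apply]
    · funext i
      simp [Pi.single_apply, Fin.ext_iff]
      intro h; omega
  · rw [lamS_apply]
    congr 1
    simp [Pi.single_apply, Finset.sum_add_distrib, ← Complex.exp_add, sub_eq_add_neg]
    ring

/-- The exponentials `e^{-x_1}, …, e^{-x_n}`, followed by `0`. -/
def expXi {n : ℕ} (x : Fin n → ℝ) : Fin (n + 1) → ℂ :=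
  Fin.snoc (fun j => (Real.exp (-x j) : ℂ)) 0

@[simp] theorem expXi_castSucc {n : ℕ} (x : Fin n → ℝ) (j : Fin n) :
    expXi x j.castSucc = (Real.exp (-x j) : ℂ) := by simp [expXi]

@[simp] theorem expXi_last {n : ℕ} (x : Fin n → ℝ) : expXi x (Fin.last n) = 0 := by simp [expXi]

theorem pd_lamS_z {n : ℕ} (lam : ℂ) (j : Fin (n + 1)) (p : Fin (n + (n + 1)) → ℝ) :
    (pd (Fin.natAdd n j) (lamS n lam)).1 p =
      (-Complex.I * lam - (Real.exp (coordZ p j) : ℂ) * expXi (coordX p) j +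
        ∑ i : Fin n, if i.succ = j then
          (Real.exp (coordX p i) : ℂ) * (Real.exp (-coordZ p i.succ) : ℂ) else 0) *
        (lamS n lam).1 p := by
  apply pd_eq_of_hasDerivAt
  have h := hasDerivAt_kerLam lam (coordX p) 0 (coordZ p) (Pi.single j 1)
  convert! h using 1
  · funext t
    rw [lamS_apply]
    congr 1
    · funext i
      simp [Pi.single_apply, Fin.ext_iff]
      intro h; omega
    · funext i
      simp [Pi.single_apply]
  · rw [lamS_apply]
    congr 1
    have h1 : (Real.exp (coordZ p j) : ℂ) * expXi (coordX p) j =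
        ∑ i : Fin n, if i.castSucc = j then
          (Real.exp (coordZ p i.castSucc - coordX p i) : ℂ) else 0 := by
      refine Fin.lastCases ?_ (fun k => ?_) j
      · simp [(Fin.castSucc_lt_last _).ne]
      · simp [← Complex.exp_add, sub_eq_add_neg]
    rw [h1]
    have h2 : ∀ i : Fin n, ((Real.exp (coordZ p i.castSucc - coordX p i) *
        ((Pi.single j (1 : ℝ) : Fin (n + 1) → ℝ) i.castSucc - (0 : Fin n → ℝ) i) +
        Real.exp (coordX p i - coordZ p i.succ) *
        ((0 : Fin n → ℝ) i - (Pi.single j (1 : ℝ) : Fin (n + 1) → ℝ) i.succ) : ℝ) : ℂ) =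
        (if i.castSucc = j then (Real.exp (coordZ p i.castSucc - coordX p i) : ℂ) else 0) -
        (if i.succ = j then
          (Real.exp (coordX p i) : ℂ) * (Real.exp (-coordZ p i.succ) : ℂ) else 0) := fun i => by
      simp only [Pi.single_apply, Pi.zero_apply, sub_eq_add_neg, Real.exp_add]
      split_ifs <;> push_cast <;> ring
    rw [Complex.ofReal_sum]
    simp_rw [h2]
    rw [Finset.sum_sub_distrib]
    simp [Pi.single_apply]
    ring

theorem pd_lamS_z_zero {n : ℕ} (lam : ℂ) (p : Fin (n + (n + 1)) → ℝ) :
    (pd (Fin.natAdd n 0) (lamS n lam)).1 p =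
      (-Complex.I * lam - (Real.exp (coordZ p 0) : ℂ) * expXi (coordX p) 0) *
        (lamS n lam).1 p := by
  rw [pd_lamS_z]; simp [Fin.succ_ne_zero]

theorem pd_lamS_z_succ {n : ℕ} (lam : ℂ) (j : Fin n) (p : Fin (n + (n + 1)) → ℝ) :
    (pd (Fin.natAdd n j.succ) (lamS n lam)).1 p =
      (-Complex.I * lam - (Real.exp (coordZ p j.succ) : ℂ) * expXi (coordX p) j.succ +
        (Real.exp (coordX p j) : ℂ) * (Real.exp (-coordZ p j.succ) : ℂ)) *
        (lamS n lam).1 p := by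
  rw [pd_lamS_z]; simp

/-! ## Chains acting on a function with multiplicative symbols -/

/-- The symbol of one site does not change under shifts of the variables of the other sites. The
outermost derivative therefore sees the shorter chain as a constant and differentiates only F, and
the operator product becomes a product of numbers. -/
theorem siteChain_symbol {n N : ℕ} (ι : Fin n → Fin N) (hι : Function.Injective ι) (c : ℂ)
    (F : Smooth N) (s : Fin n → (Fin N → ℝ) → ℂ)
    (hs : ∀ j p, (pd (ι j) F).1 p = s j p * F.1 p)
    (hinv : ∀ i j, i ≠ j → ∀ p (t : ℝ), s i (p + t • Pi.single (ι j) (1 : ℝ)) = s i p) (u : ℂ)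
    (a b : Fin 2) (p : Fin N → ℝ) :
    (siteChain ι c u a b F).1 p = chain n (fun j => c * s j p)
      (fun j => (Real.exp (-p (ι j)) : ℂ)) (fun j => (Real.exp (p (ι j)) : ℂ)) u a b * F.1 p := by
  unfold siteChain
  induction n generalizing a p with
  | zero => fin_cases a <;> fin_cases b <;> simp [chain]
  | succ n ih =>
    have IH := ih (fun j => ι j.castSucc) (hι.comp (Fin.castSucc_injective n))
      (fun j => s j.castSucc) (fun j => hs _)
      (fun i j hij => hinv _ _ (fun h => hij (Fin.castSucc_injective n h)))
    fin_cases a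
    · simp only [Fin.zero_eta, chain_succ_zero]
      have hd : (pd (ι (Fin.last n)) (chain n (fun j => c • pd (ι j.castSucc))
          (fun j => expMul (-1) (ι j.castSucc)) (fun j => expMul 1 (ι j.castSucc)) u 0 b F)).1 p =
          s (Fin.last n) p * (chain n (fun j => c * s j.castSucc p)
            (fun j => (Real.exp (-p (ι j.castSucc)) : ℂ))
            (fun j => (Real.exp (p (ι j.castSucc)) : ℂ)) u 0 b * F.1 p) := by
        apply pd_eq_of_hasDerivAt
        simp_rw [IH 0]
        have h0 : ∀ t : ℝ, ∀ j : Fin n, s j.castSucc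
            (p + t • Pi.single (ι (Fin.last n)) (1 : ℝ)) = s j.castSucc p := fun t j =>
          hinv _ _ (Fin.castSucc_lt_last j).ne _ _
        have h1 : ∀ t : ℝ, ∀ j : Fin n, (p + t • (Pi.single (ι (Fin.last n)) (1 : ℝ) : Fin N → ℝ))
            (ι j.castSucc) = p (ι j.castSucc) := fun t j => by
          simp [hι.eq_iff, (Fin.castSucc_lt_last j).ne]
        simp_rw [h0, h1]
        have h2 := (hasLineDerivAt_pd (ι (Fin.last n)) F p)
        rw [hs] at h2
        convert! HasDerivAt.const_mul _ h2 using 1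
        ring
      simp only [LinearMap.add_apply, Module.End.mul_apply, Module.algebraMap_end_apply,
        LinearMap.smul_apply, Submodule.coe_add, Submodule.coe_smul, Pi.add_apply, Pi.smul_apply,
        smul_eq_mul, hd, IH, expMul_apply, Algebra.algebraMap_self, RingHom.id_apply]
      simp only [neg_mul, one_mul]
      ring
    · simp only [Fin.mk_one, chain_succ_one]
      simp only [LinearMap.neg_apply, Module.End.mul_apply, Submodule.coe_neg, Pi.neg_apply,
        IH, expMul_apply]
      simp only [one_mul]
      ring

/-- The intertwining of Lax matrices under the kernel `Λ(x|z)`, for symbols. -/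
theorem chain_darboux {n : ℕ} (lam u : ℂ) (xm xp : Fin n → ℂ) (zm zp ξ : Fin (n + 1) → ℂ)
    (hξ : ∀ j : Fin n, ξ j.castSucc = xm j) (hx : ∀ j, xp j * xm j = 1)
    (hz : ∀ j, zp j * zm j = 1) (a : Fin 2) :
    let C := chain n (fun j => Complex.I * lam + zp j.castSucc * xm j - xp j * zm j.succ) xm xp u
    let Z := chain n (fun j => -1 * (-Complex.I * lam - zp j.succ * ξ j.succ + xp j * zm j.succ))
      (fun j => zm j.succ) (fun j => zp j.succ) u
    let S : Matrix (Fin 2) (Fin 2) ℂ :=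
      !![u - lam + Complex.I * zp 0 * ξ 0, ξ 0; -zp 0, Complex.I]
    (u - lam) * C 0 a + ξ (Fin.last n) * (Complex.I * zp (Fin.last n) * C 0 a + C 1 a) =
      Z 0 0 * S 0 a + Z 0 1 * S 1 a ∧
    Complex.I * (Complex.I * zp (Fin.last n) * C 0 a + C 1 a) = Z 1 0 * S 0 a + Z 1 1 * S 1 a := by
  -- The two equations are the rows of M C = Z S, where M has the same form as S but at the last
  -- site. The induction step is the one-site relation between consecutive M. The last ξ is left
  -- free because the step needs it equal to e^{-x}, while the application sets it to 0.
  induction n with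
  | zero =>
    have hI := Complex.I_mul_I
    fin_cases a
    · simp [chain, Matrix.one_apply]
      constructor
      · ring
      · linear_combination zp 0 * hI
    · simp [chain, Matrix.one_apply]
  | succ n ih =>
    have IH := ih (fun j => xm j.castSucc) (fun j => xp j.castSucc) (fun j => zm j.castSucc)
      (fun j => zp j.castSucc) (fun j => ξ j.castSucc) (fun j => hξ _) (fun j => hx _)
      (fun j => hz _)
    intro C Z S
    simp only [Fin.castSucc_zero, hξ (Fin.last n), ← Fin.succ_castSucc] at IH
    set c := chain n (fun j => Complex.I * lam + zp j.castSucc.castSucc * xm j.castSucc -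
      xp j.castSucc * zm j.castSucc.succ) (fun j => xm j.castSucc) (fun j => xp j.castSucc) u
      with hc
    set w := chain n (fun j => -1 * (-Complex.I * lam - zp j.castSucc.succ * ξ j.castSucc.succ +
      xp j.castSucc * zm j.castSucc.succ)) (fun j => zm j.castSucc.succ)
      (fun j => zp j.castSucc.succ) u with hw
    obtain ⟨e1, e2⟩ := IH
    change (u - lam) * c 0 a + xm (Fin.last n) * (Complex.I * zp (Fin.last n).castSucc * c 0 a +
      c 1 a) = w 0 0 * S 0 a + w 0 1 * S 1 a at e1
    change Complex.I * (Complex.I * zp (Fin.last n).castSucc * c 0 a + c 1 a) =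
      w 1 0 * S 0 a + w 1 1 * S 1 a at e2
    have C0 : C 0 a = (u + Complex.I * (Complex.I * lam + zp (Fin.last n).castSucc *
        xm (Fin.last n) - xp (Fin.last n) * zm (Fin.last n).succ)) * c 0 a +
        xm (Fin.last n) * c 1 a := by
      simp only [C, chain_succ_zero]; rfl
    have C1 : C 1 a = -(xp (Fin.last n) * c 0 a) := by
      simp only [C, chain_succ_one]; rfl
    have Z0 : ∀ b, Z 0 b = (u + Complex.I * (-1 * (-Complex.I * lam - zp (Fin.last n).succ *
        ξ (Fin.last n).succ + xp (Fin.last n) * zm (Fin.last n).succ))) * w 0 b +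
        zm (Fin.last n).succ * w 1 b := fun b => by
      simp only [Z, chain_succ_zero]; rfl
    have Z1 : ∀ b, Z 1 b = -(zp (Fin.last n).succ * w 0 b) := fun b => by
      simp only [Z, chain_succ_one]; rfl
    rw [C0, C1, Z0, Z0, Z1, Z1]
    have hI := Complex.I_mul_I
    have hx1 := hx (Fin.last n)
    have hz1 := hz (Fin.last n).succ
    simp only [Fin.succ_last] at *
    generalize xp (Fin.last n) = X at *
    generalize xm (Fin.last n) = X' at *
    generalize zp (Fin.last (n + 1)) = Y at *
    generalize zm (Fin.last (n + 1)) = Y' at *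
    generalize ξ (Fin.last (n + 1)) = ξ₀ at *
    generalize zp (Fin.last n).castSucc = y at *
    generalize c 0 a = c0 at *
    generalize c 1 a = c1 at *
    generalize S 0 a = s0 at *
    generalize S 1 a = s1 at *
    generalize Complex.I = i at *
    have E : (u + i * (i * lam + y * X' - X * Y')) * c0 + X' * c1 =
        w 0 0 * s0 + w 0 1 * s1 - i * X * Y' * c0 := by
      linear_combination e1 + lam * c0 * hI
    have E2 : i * Y * ((u + i * (i * lam + y * X' - X * Y')) * c0 + X' * c1) + -(X * c0) =
        i * Y * (w 0 0 * s0 + w 0 1 * s1) := by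
      rw [E]
      linear_combination (-Y * X * Y' * c0) * hI + X * c0 * hz1
    constructor
    · rw [E2, E]
      linear_combination (-i * X * Y') * e1 + Y' * e2 -
        (lam * (w 0 0 * s0 + w 0 1 * s1)) * hI + i * Y' * (c1 + i * c0 * y) * hx1
    · rw [E2]
      linear_combination (Y * (w 0 0 * s0 + w 0 1 * s1)) * hI


/-! ## Intertwining at the level of operators -/

theorem siteChain_commute {n N : ℕ} (ι : Fin n → Fin N) (c u : ℂ) (r : DiffOp N)
    (hd : ∀ j, Commute r (pd (ι j))) (hm : ∀ s j, Commute r (expMul s (ι j))) (a b : Fin 2) :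
    Commute r (siteChain ι c u a b) :=
  chain_commute _ _ _ u r (fun j => (hd j).smul_right c) (fun j => hm _ j) (fun j => hm _ j) a b

theorem siteChain_commute_siteChain {n m N : ℕ} (ι : Fin n → Fin N) (κ : Fin m → Fin N)
    (h : ∀ i j, ι i ≠ κ j) (c u c' u' : ℂ) (a b a' b' : Fin 2) :
    Commute (siteChain ι c u a b) (siteChain κ c' u' a' b') :=
  siteChain_commute κ c' u' _
    (fun j => (siteChain_commute ι c u _ (fun _ => pd_commute _ _)
      (fun _ i => pd_commute_expMul (h i j).symm _) a b).symm)
    (fun _ j => (siteChain_commute ι c u _ (fun i => (pd_commute_expMul (h i j) _).symm)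
      (fun _ _ => expMul_commute _ _ _ _) a b).symm) a' b'

/-- The matrix of operators in the first variable of the longer chain that completes the
intertwining of chain matrices. -/
def bdMat {N : ℕ} (k : Fin N) (lam u : ℂ) : Matrix (Fin 2) (Fin 2) (DiffOp N) :=
  !![algebraMap ℂ (DiffOp N) u - Complex.I • pd k,
      -(Complex.I • (expMul (-1) k * (algebraMap ℂ (DiffOp N) lam - Complex.I • pd k)));
    -expMul 1 k, algebraMap ℂ (DiffOp N) Complex.I]

theorem commute_matrix_entries {R : Type*} [Ring R] [Algebra ℂ R] (r d em ep : R) (lam u : ℂ)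
    (hd : Commute r d) (hm : Commute r em) (hp : Commute r ep) (a b : Fin 2) :
    Commute r ((!![algebraMap ℂ R u - Complex.I • d,
      -(Complex.I • (em * (algebraMap ℂ R lam - Complex.I • d)));
      -ep, algebraMap ℂ R Complex.I] : Matrix (Fin 2) (Fin 2) R) a b) := by
  have h : ∀ c : ℂ, Commute r (algebraMap ℂ R c) := fun c => (Algebra.commutes c r).symm
  fin_cases a <;> fin_cases b
  · exact (h _).sub_right (hd.smul_right _)
  · exact ((hm.mul_right ((h _).sub_right (hd.smul_right _))).smul_right _).neg_right
  · exact hp.neg_right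
  · exact h _

theorem commute_bdMat {N : ℕ} (k : Fin N) (lam u : ℂ) (r : DiffOp N) (hd : Commute r (pd k))
    (hm : ∀ s, Commute r (expMul s k)) (a b : Fin 2) : Commute r (bdMat k lam u a b) :=
  commute_matrix_entries r (pd k) (expMul (-1) k) (expMul 1 k) lam u hd (hm _) (hm _) a b

theorem siteChain_commute_bdMat {n N : ℕ} (ι : Fin n → Fin N) (k : Fin N) (h : ∀ i, ι i ≠ k)
    (c u lam u' : ℂ) (a b a' b' : Fin 2) :
    Commute (siteChain ι c u a b) (bdMat k lam u' a' b') :=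
  commute_bdMat k lam u' _
    (siteChain_commute ι c u _ (fun _ => pd_commute _ _)
      (fun _ i => pd_commute_expMul (h i).symm _) a b).symm
    (fun _ => (siteChain_commute ι c u _ (fun i => (pd_commute_expMul (h i) _).symm)
      (fun _ _ => expMul_commute _ _ _ _) a b).symm) a' b'

/-! ### The Hamiltonians acting on the joint kernel Λ(x|z). -/

section Joint

variable (n : ℕ)

/-- Index of the variable `x_j`. -/
abbrev ixX : Fin (n + 1) → Fin (n + 1 + (n + 1 + 1)) := Fin.castAdd (n + 1 + 1)

/-- Index of the variable `z_{j+1}`. -/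
abbrev ixZ : Fin (n + 1) → Fin (n + 1 + (n + 1 + 1)) := fun j => Fin.natAdd (n + 1) j.succ

/-- Index of the variable `z_0`. -/
abbrev ixZ0 : Fin (n + 1 + (n + 1 + 1)) := Fin.natAdd (n + 1) 0

theorem ixX_injective : Function.Injective (ixX n) := Fin.castAdd_injective _ _

theorem ixZ_injective : Function.Injective (ixZ n) :=
  (Fin.natAdd_injective _ _).comp (Fin.succ_injective _)

theorem ixX_ne_natAdd (i : Fin (n + 1)) (j : Fin (n + 1 + 1)) : ixX n i ≠ Fin.natAdd (n + 1) j := by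
  intro h
  have := congrArg Fin.val h
  simp at this
  omega

theorem ixZ_ne_ixZ0 (i : Fin (n + 1)) : ixZ n i ≠ ixZ0 n := fun h =>
  Fin.succ_ne_zero i (Fin.natAdd_injective _ _ h)

/-- This is the first row of `chain_darboux` with last ξ equal to 0, the site x_{n+1} = +∞. The
matrix S there is the symbol of `bdMat` on Λ: replacing ∂_{z_0} Λ by its value leaves only
multiplications by e^{z_0} and e^{-x_0}, which commute with the chain in the other z variables. -/
theorem siteChain_lamS_x (lam u : ℂ) (a : Fin 2) :
    (u - lam) • siteChain (ixX n) 1 u 0 a (lamS (n + 1) lam) =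
      siteChain (ixZ n) (-1) u 0 0 (bdMat (ixZ0 n) lam u 0 a (lamS (n + 1) lam)) +
      siteChain (ixZ n) (-1) u 0 1 (bdMat (ixZ0 n) lam u 1 a (lamS (n + 1) lam)) := by
  set F := lamS (n + 1) lam with hF
  have hpd : pd (ixZ0 n) F = -(Complex.I * lam) • F -
      expMul 1 (ixZ0 n) (expMul (-1) (ixX n 0) F) := by
    ext p
    rw [pd_lamS_z_zero, ← Fin.castSucc_zero, expXi_castSucc]
    simp [expMul_apply]
    ring
  have hI := Complex.I_mul_I
  have b00 : bdMat (ixZ0 n) lam u 0 0 F = (u - lam) • F +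
      Complex.I • expMul 1 (ixZ0 n) (expMul (-1) (ixX n 0) F) := by
    ext p
    simp [bdMat, hpd, Module.algebraMap_end_apply]
    linear_combination (lam * F.1 p) * hI
  have b01 : bdMat (ixZ0 n) lam u 0 1 F = expMul (-1) (ixX n 0) F := by
    ext p
    have h1 : (Real.exp (-p (ixZ0 n)) : ℂ) * (Real.exp (p (ixZ0 n)) : ℂ) = 1 := by
      rw [← Complex.ofReal_mul, ← Real.exp_add]; simp
    simp only [bdMat, hpd, Module.algebraMap_end_apply, Matrix.of_apply, Matrix.cons_val',
      Matrix.cons_val_zero, Matrix.cons_val_one, Matrix.cons_val_fin_one, LinearMap.neg_apply,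
      LinearMap.smul_apply, Module.End.mul_apply, LinearMap.sub_apply, Submodule.coe_neg,
      Pi.neg_apply, Submodule.coe_smul, Pi.smul_apply, expMul_apply, Submodule.coe_sub,
      Pi.sub_apply, smul_eq_mul, neg_mul, one_mul]
    generalize (Real.exp (-p (ixX n 0)) : ℂ) = e at *
    linear_combination (-e * F.1 p * (Real.exp (-p (ixZ0 n)) : ℂ) * (Real.exp (p (ixZ0 n)) : ℂ) -
      (Real.exp (-p (ixZ0 n)) : ℂ) * lam * F.1 p * Complex.I) * hI + e * F.1 p * h1
  have b10 : bdMat (ixZ0 n) lam u 1 0 F = -expMul 1 (ixZ0 n) F := by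
    simp [bdMat]
  have b11 : bdMat (ixZ0 n) lam u 1 1 F = Complex.I • F := by
    simp [bdMat, Module.algebraMap_end_apply]
  have cz : ∀ c s, siteChain (ixZ n) (-1) u 0 c * expMul s (ixZ0 n) =
      expMul s (ixZ0 n) * siteChain (ixZ n) (-1) u 0 c := fun c s =>
    (siteChain_commute _ _ _ _ (fun j => (pd_commute_expMul (ixZ_ne_ixZ0 n j) s).symm)
      (fun _ _ => expMul_commute _ _ _ _) 0 c).eq.symm
  have cx : ∀ c s, siteChain (ixZ n) (-1) u 0 c * expMul s (ixX n 0) =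
      expMul s (ixX n 0) * siteChain (ixZ n) (-1) u 0 c := fun c s =>
    (siteChain_commute _ _ _ _ (fun j => (pd_commute_expMul (ixX_ne_natAdd n 0 j.succ).symm s).symm)
      (fun _ _ => expMul_commute _ _ _ _) 0 c).eq.symm
  have cz' : ∀ c s G, siteChain (ixZ n) (-1) u 0 c (expMul s (ixZ0 n) G) =
      expMul s (ixZ0 n) (siteChain (ixZ n) (-1) u 0 c G) := fun c s G =>
    LinearMap.congr_fun (cz c s) G
  have cx' : ∀ c s G, siteChain (ixZ n) (-1) u 0 c (expMul s (ixX n 0) G) =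
      expMul s (ixX n 0) (siteChain (ixZ n) (-1) u 0 c G) := fun c s G =>
    LinearMap.congr_fun (cx c s) G
  ext p
  have sx := siteChain_symbol (ixX n) (ixX_injective n) 1 F
    (fun j p => Complex.I * lam + (Real.exp (coordZ p j.castSucc) : ℂ) *
      (Real.exp (-coordX p j) : ℂ) - (Real.exp (coordX p j) : ℂ) *
      (Real.exp (-coordZ p j.succ) : ℂ)) (fun j p => pd_lamS_x lam j p)
    (fun i j hij p t => by
      have h1 := fun k => (ixX_ne_natAdd n j k).symm
      have h2 := (ixX_injective n).ne hij
      simp [coordX, coordZ, h1, hij]) u 0 a p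
  have sz := fun c => siteChain_symbol (ixZ n) (ixZ_injective n) (-1) F
    (fun j p => -Complex.I * lam - (Real.exp (coordZ p j.succ) : ℂ) * expXi (coordX p) j.succ +
        (Real.exp (coordX p j) : ℂ) * (Real.exp (-coordZ p j.succ) : ℂ))
    (fun j p => pd_lamS_z_succ lam j p)
    (fun i j hij p t => by
      have h1 := fun k => ixX_ne_natAdd n k j.succ
      have h2 : coordX (p + t • Pi.single (ixZ n j) (1 : ℝ)) = coordX p := by
        funext k; simp [coordX, h1]
      have h3 : coordZ (p + t • Pi.single (ixZ n j) (1 : ℝ)) i.succ = coordZ p i.succ := by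
        simp [coordZ, hij]
      have h4 := congrFun h2 i
      simp only [h2, h3]
      simp only [coordX] at h4 ⊢
      simp only [h4]) u 0 c p
  have key := (chain_darboux (n := n + 1) lam u (fun j => (Real.exp (-coordX p j) : ℂ))
    (fun j => (Real.exp (coordX p j) : ℂ)) (fun j => (Real.exp (-coordZ p j) : ℂ))
    (fun j => (Real.exp (coordZ p j) : ℂ)) (expXi (coordX p)) (fun j => by simp)
    (fun j => by rw [← Complex.ofReal_mul, ← Real.exp_add]; simp)
    (fun j => by rw [← Complex.ofReal_mul, ← Real.exp_add]; simp) a).1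
  simp only [expXi_last, zero_mul, add_zero] at key
  have hξ0 : expXi (coordX p) 0 = (Real.exp (-coordX p 0) : ℂ) := by
    rw [← Fin.castSucc_zero, expXi_castSucc]
  rw [hξ0] at key
  rw [Submodule.coe_smul, Pi.smul_apply, sx]
  simp only [one_mul, smul_eq_mul]
  rw [← mul_assoc, key]
  fin_cases a
  · simp only [Fin.zero_eta, b00, b10, map_add, map_smul, map_neg, cz', cx', Submodule.coe_add,
      Submodule.coe_smul, Submodule.coe_neg, Pi.add_apply, Pi.smul_apply, Pi.neg_apply,
      expMul_apply, smul_eq_mul, sz, Matrix.of_apply, Matrix.cons_val', Matrix.cons_val_zero,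
      Matrix.cons_val_one, Matrix.cons_val_fin_one, one_mul, neg_mul]
    ring
  · simp only [Fin.mk_one, b01, b11, map_smul, cx', Submodule.coe_add,
      Submodule.coe_smul, Pi.add_apply, Pi.smul_apply,
      expMul_apply, smul_eq_mul, sz, Matrix.of_apply, Matrix.cons_val', Matrix.cons_val_zero,
      Matrix.cons_val_one, Matrix.cons_val_fin_one, one_mul, neg_mul]
    ring

/-- The operator in the variables of the longer chain that corresponds to `𝔹_n(u)`: `ρ` and `ρ'`
are first rows of chains, `P` and `P'` the matrices `bdMat`, taken at `u` and `-u`. -/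
def zForm {R : Type*} [Ring R] [Algebra ℂ R] (α β : ℝ) (u : ℂ) (ρ ρ' : Fin 2 → R)
    (P P' : Matrix (Fin 2) (Fin 2) R) : R :=
  ∑ d, ∑ c, ρ' d * ρ c *
    ((u - Complex.I / 2) • (P' d 0 * P c 0 + (β : ℂ) ^ 2 • (P' d 1 * P c 1)) +
      (α : ℂ) • (P' d 1 * P c 0 - P' d 0 * P c 1))

/-- The operator `zForm` for a chain with indices `ι` and a further variable with index `k`. -/
def zOp {n N : ℕ} (ι : Fin n → Fin N) (k : Fin N) (α β : ℝ) (lam u : ℂ) : DiffOp N :=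
  zForm α β u (siteChain ι (-1) u 0) (siteChain ι (-1) (-u) 0) (bdMat k lam u) (bdMat k lam (-u))

/-- The row at -u is replaced first. The row at u then commutes past the resulting operators, which
act in z, reaches Λ and is replaced as well. What remains is to move the z_0 matrix at -u past the
row in z_1, z_2, …, which acts in other variables. -/
theorem bForm_lamS (α β : ℝ) (lam u : ℂ) :
    ((u - lam) * (-u - lam)) •
      bForm α β u (siteChain (ixX n) 1 u 0) (siteChain (ixX n) 1 (-u) 0) (lamS (n + 1) lam) =
    zOp (ixZ n) (ixZ0 n) α β lam u (lamS (n + 1) lam) := by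
  have h1 := siteChain_lamS_x n lam u
  have h2 := siteChain_lamS_x n lam (-u)
  set F := lamS (n + 1) lam
  set r := siteChain (ixX n) 1 u 0 with hr
  set r' := siteChain (ixX n) 1 (-u) 0
  set ρ := siteChain (ixZ n) (-1) u 0 with hρ
  set ρ' := siteChain (ixZ n) (-1) (-u) 0 with hρ'
  set P := bdMat (ixZ0 n) lam u with hP
  set P' := bdMat (ixZ0 n) lam (-u) with hP'
  have c1 : ∀ a d G, r a (ρ' d G) = ρ' d (r a G) := fun a d G => LinearMap.congr_fun
    (siteChain_commute_siteChain (ixX n) (ixZ n) (fun i j => ixX_ne_natAdd n i j.succ)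
      1 u (-1) (-u) 0 a 0 d).eq G
  have c2 : ∀ a d b G, r a (P' d b G) = P' d b (r a G) := fun a d b G => LinearMap.congr_fun
    (siteChain_commute_bdMat (ixX n) (ixZ0 n) (fun i => ixX_ne_natAdd n i 0)
      1 u lam (-u) 0 a d b).eq G
  have c3 : ∀ c d b G, P' d b (ρ c G) = ρ c (P' d b G) := fun c d b G => LinearMap.congr_fun
    (siteChain_commute_bdMat (ixZ n) (ixZ0 n) (ixZ_ne_ixZ0 n)
      (-1) u lam (-u) 0 c d b).eq.symm G
  have h3 : ∀ a b, ((u - lam) * (-u - lam)) • r a (r' b F) =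
      ∑ d, ∑ c, ρ' d (ρ c (P' d b (P c a F))) := fun a b => by
    rw [mul_smul, ← map_smul (r a), h2 b, map_add, smul_add]
    simp only [c1, c2, ← map_smul, h1 a, map_add, c3, Fin.sum_univ_two]
  simp only [bForm, zOp, zForm, LinearMap.add_apply, LinearMap.smul_apply, LinearMap.sub_apply,
    Module.End.mul_apply, smul_add, smul_sub, LinearMap.sum_apply, map_add, map_sub, map_smul]
  simp only [smul_comm ((u - lam) * (-u - lam)) _ (_ : Smooth _), h3]
  simp only [Fin.sum_univ_two, smul_add]
  abel

end Joint

/-! ## Slices of functions of two groups of variables -/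

theorem append_add_single_left {n m : ℕ} (x : Fin n → ℝ) (z : Fin m → ℝ) (j : Fin n) (t : ℝ) :
    Fin.append (x + t • Pi.single j (1 : ℝ)) z =
      Fin.append x z + t • Pi.single (Fin.castAdd m j) (1 : ℝ) := by
  funext i
  refine Fin.addCases (fun k => ?_) (fun k => ?_) i
  · simp [Pi.single_apply]
  · simp [Pi.single_apply, Fin.ext_iff]
    intro h; omega

theorem append_add_single_right {n m : ℕ} (x : Fin n → ℝ) (z : Fin m → ℝ) (j : Fin m) (t : ℝ) :
    Fin.append x (z + t • Pi.single j (1 : ℝ)) =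
      Fin.append x z + t • Pi.single (Fin.natAdd n j) (1 : ℝ) := by
  funext i
  refine Fin.addCases (fun k => ?_) (fun k => ?_) i
  · simp [Pi.single_apply, Fin.ext_iff]
    intro h; omega
  · simp [Pi.single_apply]

/-- Fixing the last variables. -/
def sliceLeft {n m : ℕ} (z : Fin m → ℝ) : Smooth (n + m) →ₗ[ℂ] Smooth n where
  toFun f := ⟨fun x => f.1 (Fin.append x z), by
    have hf : ContDiff ℝ ∞ f.1 := f.2
    refine hf.comp (contDiff_pi.2 fun i => ?_)
    refine Fin.addCases (fun k => ?_) (fun k => ?_) i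
    · simp only [Fin.append_left]; fun_prop
    · simp only [Fin.append_right]; fun_prop⟩
  map_add' f g := rfl
  map_smul' c f := rfl

/-- Fixing the first variables. -/
def sliceRight {n m : ℕ} (x : Fin n → ℝ) : Smooth (n + m) →ₗ[ℂ] Smooth m where
  toFun f := ⟨fun z => f.1 (Fin.append x z), by
    have hf : ContDiff ℝ ∞ f.1 := f.2
    refine hf.comp (contDiff_pi.2 fun i => ?_)
    refine Fin.addCases (fun k => ?_) (fun k => ?_) i
    · simp only [Fin.append_left]; fun_prop
    · simp only [Fin.append_right]; fun_prop⟩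
  map_add' f g := rfl
  map_smul' c f := rfl

@[simp] theorem sliceLeft_apply {n m : ℕ} (z : Fin m → ℝ) (f : Smooth (n + m)) (x : Fin n → ℝ) :
    (sliceLeft z f).1 x = f.1 (Fin.append x z) := rfl

@[simp] theorem sliceRight_apply {n m : ℕ} (x : Fin n → ℝ) (f : Smooth (n + m)) (z : Fin m → ℝ) :
    (sliceRight x f).1 z = f.1 (Fin.append x z) := rfl

theorem sliceLeft_pd {n m : ℕ} (z : Fin m → ℝ) (f : Smooth (n + m)) (j : Fin n) :
    pd j (sliceLeft z f) = sliceLeft z (pd (Fin.castAdd m j) f) := by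
  ext x
  apply pd_eq_of_hasDerivAt
  simp only [sliceLeft_apply, append_add_single_left]
  exact hasLineDerivAt_pd (Fin.castAdd m j) f (Fin.append x z)

theorem sliceRight_pd {n m : ℕ} (x : Fin n → ℝ) (f : Smooth (n + m)) (j : Fin m) :
    pd j (sliceRight x f) = sliceRight x (pd (Fin.natAdd n j) f) := by
  ext z
  apply pd_eq_of_hasDerivAt
  simp only [sliceRight_apply, append_add_single_right]
  exact hasLineDerivAt_pd (Fin.natAdd n j) f (Fin.append x z)

theorem sliceLeft_expMul {n m : ℕ} (z : Fin m → ℝ) (f : Smooth (n + m)) (s : ℝ) (j : Fin n) :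
    expMul s j (sliceLeft z f) = sliceLeft z (expMul s (Fin.castAdd m j) f) := by
  ext x
  simp [expMul_apply]

theorem sliceRight_expMul {n m : ℕ} (x : Fin n → ℝ) (f : Smooth (n + m)) (s : ℝ) (j : Fin m) :
    expMul s j (sliceRight x f) = sliceRight x (expMul s (Fin.natAdd n j) f) := by
  ext z
  simp [expMul_apply]

theorem sliceLeft_siteChain {n m k : ℕ} (z : Fin m → ℝ) (ι : Fin k → Fin n) (c u : ℂ) (a b : Fin 2)
    (f : Smooth (n + m)) : siteChain ι c u a b (sliceLeft z f) =
      sliceLeft z (siteChain (fun j => Fin.castAdd m (ι j)) c u a b f) := by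
  have h := chain_rel (LinearMap.graph (sliceLeft (n := n) z)) (fun j => c • pd (Fin.castAdd m (ι j)))
    (fun j => expMul (-1) (Fin.castAdd m (ι j))) (fun j => expMul 1 (Fin.castAdd m (ι j)))
    (fun j => c • pd (ι j)) (fun j => expMul (-1) (ι j)) (fun j => expMul 1 (ι j)) u
    (by rintro j ⟨g, g'⟩ hg
        simp only [LinearMap.mem_graph_iff] at hg ⊢
        simp [hg, sliceLeft_pd])
    (by rintro j ⟨g, g'⟩ hg
        simp only [LinearMap.mem_graph_iff] at hg ⊢
        simp [hg, sliceLeft_expMul])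
    (by rintro j ⟨g, g'⟩ hg
        simp only [LinearMap.mem_graph_iff] at hg ⊢
        simp [hg, sliceLeft_expMul]) a b (f, sliceLeft z f) (by simp)
  simpa [siteChain] using h

theorem sliceRight_siteChain {n m k : ℕ} (x : Fin n → ℝ) (ι : Fin k → Fin m) (c u : ℂ)
    (a b : Fin 2) (f : Smooth (n + m)) : siteChain ι c u a b (sliceRight x f) =
      sliceRight x (siteChain (fun j => Fin.natAdd n (ι j)) c u a b f) := by
  have h := chain_rel (LinearMap.graph (sliceRight (m := m) x))
    (fun j => c • pd (Fin.natAdd n (ι j)))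
    (fun j => expMul (-1) (Fin.natAdd n (ι j))) (fun j => expMul 1 (Fin.natAdd n (ι j)))
    (fun j => c • pd (ι j)) (fun j => expMul (-1) (ι j)) (fun j => expMul 1 (ι j)) u
    (by rintro j ⟨g, g'⟩ hg
        simp only [LinearMap.mem_graph_iff] at hg ⊢
        simp [hg, sliceRight_pd])
    (by rintro j ⟨g, g'⟩ hg
        simp only [LinearMap.mem_graph_iff] at hg ⊢
        simp [hg, sliceRight_expMul])
    (by rintro j ⟨g, g'⟩ hg
        simp only [LinearMap.mem_graph_iff] at hg ⊢
        simp [hg, sliceRight_expMul]) a b (f, sliceRight x f) (by simp)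
  simpa [siteChain] using h

theorem sliceRight_bdMat {n m : ℕ} (x : Fin n → ℝ) (k : Fin m) (lam u : ℂ)
    (a b : Fin 2) (f : Smooth (n + m)) : bdMat k lam u a b (sliceRight x f) =
      sliceRight x (bdMat (Fin.natAdd n k) lam u a b f) := by
  fin_cases a <;> fin_cases b <;> simp [bdMat, sliceRight_pd, Module.algebraMap_end_apply,
    ← sliceRight_expMul]

theorem zForm_map {M₁ M₂ : Type*} [AddCommGroup M₁] [Module ℂ M₁] [AddCommGroup M₂] [Module ℂ M₂]
    (T : M₁ →ₗ[ℂ] M₂) (α β : ℝ) (u : ℂ) (ρ₁ ρ₁' : Fin 2 → Module.End ℂ M₁)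
    (P₁ P₁' : Matrix (Fin 2) (Fin 2) (Module.End ℂ M₁)) (ρ₂ ρ₂' : Fin 2 → Module.End ℂ M₂)
    (P₂ P₂' : Matrix (Fin 2) (Fin 2) (Module.End ℂ M₂))
    (h₁ : ∀ a f, ρ₂ a (T f) = T (ρ₁ a f)) (h₂ : ∀ a f, ρ₂' a (T f) = T (ρ₁' a f))
    (h₃ : ∀ a b f, P₂ a b (T f) = T (P₁ a b f)) (h₄ : ∀ a b f, P₂' a b (T f) = T (P₁' a b f))
    (f : M₁) : zForm α β u ρ₂ ρ₂' P₂ P₂' (T f) = T (zForm α β u ρ₁ ρ₁' P₁ P₁' f) := by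
  simp only [zForm, Fin.sum_univ_two, LinearMap.add_apply, LinearMap.smul_apply,
    LinearMap.sub_apply, Module.End.mul_apply, map_add, map_sub, map_smul, h₁, h₂, h₃, h₄]

theorem sliceRight_zOp {n m k : ℕ} (x : Fin n → ℝ) (ι : Fin k → Fin m) (i : Fin m) (α β : ℝ)
    (lam u : ℂ) (f : Smooth (n + m)) : zOp ι i α β lam u (sliceRight x f) =
      sliceRight x (zOp (fun j => Fin.natAdd n (ι j)) (Fin.natAdd n i) α β lam u f) :=
  zForm_map (sliceRight x) α β u _ _ _ _ _ _ _ _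
    (fun a f => sliceRight_siteChain x ι (-1) u 0 a f)
    (fun a f => sliceRight_siteChain x ι (-1) (-u) 0 a f)
    (fun a b f => sliceRight_bdMat x i lam u a b f)
    (fun a b f => sliceRight_bdMat x i lam (-u) a b f) f


/-! ## Spans of exponentials times a fixed function -/

/-- The span of the functions `e^{m·x} F`, with `m` in an additive monoid of exponents. -/
def expSpan {N : ℕ} (F : Smooth N) (C : AddSubmonoid (Fin N → ℝ)) : Submodule ℂ (Smooth N) :=
  Submodule.span ℂ {f | ∃ m ∈ C, f = mulS (expS m) F}

theorem mulS_expS_mem_expSpan {N : ℕ} (F : Smooth N) (C : AddSubmonoid (Fin N → ℝ))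
    {m : Fin N → ℝ} (hm : m ∈ C) : mulS (expS m) F ∈ expSpan F C :=
  Submodule.subset_span ⟨m, hm, rfl⟩

theorem self_mem_expSpan {N : ℕ} (F : Smooth N) (C : AddSubmonoid (Fin N → ℝ)) :
    F ∈ expSpan F C := by
  have := mulS_expS_mem_expSpan F C C.zero_mem
  rwa [mulS_expS_zero] at this

theorem mulS_mem_expSpan {N : ℕ} {F : Smooth N} {C : AddSubmonoid (Fin N → ℝ)}
    {m : Fin N → ℝ} (hm : m ∈ C) {f : Smooth N} (hf : f ∈ expSpan F C) :
    mulS (expS m) f ∈ expSpan F C := by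
  induction hf using Submodule.span_induction with
  | mem f h =>
    obtain ⟨m', hm', rfl⟩ := h
    rw [mulS_expS_expS]
    exact mulS_expS_mem_expSpan F C (C.add_mem hm hm')
  | zero => rw [map_zero]; exact Submodule.zero_mem _
  | add f g _ _ hf hg => rw [map_add]; exact Submodule.add_mem _ hf hg
  | smul c f _ hf => rw [map_smul]; exact Submodule.smul_mem _ _ hf

theorem expMul_mem_expSpan {N : ℕ} {F : Smooth N} {C : AddSubmonoid (Fin N → ℝ)}
    {s : ℝ} {j : Fin N} (hm : Pi.single j s ∈ C) {f : Smooth N} (hf : f ∈ expSpan F C) :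
    expMul s j f ∈ expSpan F C := by
  rw [expMul_eq_mulS]
  exact mulS_mem_expSpan hm hf

/-- By the Leibniz rule ∂(e^{m·x} F) = m_i e^{m·x} F + e^{m·x} ∂F, so closure under ∂ has to be
checked on the generator F only. -/
theorem pd_mem_expSpan {N : ℕ} {F : Smooth N} {C : AddSubmonoid (Fin N → ℝ)} {i : Fin N}
    (hF : pd i F ∈ expSpan F C) {f : Smooth N} (hf : f ∈ expSpan F C) :
    pd i f ∈ expSpan F C := by
  induction hf using Submodule.span_induction with
  | mem f h =>
    obtain ⟨m, hm, rfl⟩ := h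
    have h1 : pd i (mulS (expS m) F) = (m i : ℂ) • mulS (expS m) F + mulS (expS m) (pd i F) := by
      rw [pd_mulS, pd_expS]
      congr 1
      ext x
      simp [mul_assoc]
    rw [h1]
    exact Submodule.add_mem _ (Submodule.smul_mem _ _ (mulS_expS_mem_expSpan F C hm))
      (mulS_mem_expSpan hm hF)
  | zero => rw [map_zero]; exact Submodule.zero_mem _
  | add f g _ _ hf hg => rw [map_add]; exact Submodule.add_mem _ hf hg
  | smul c f _ hf => rw [map_smul]; exact Submodule.smul_mem _ _ hf

/-- Admissible exponents of `e^{m·x + k·z}` in the joint variables. -/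
def jointCone (n : ℕ) : AddSubmonoid (Fin (n + 1 + (n + 1 + 1)) → ℝ) where
  carrier := {m | m (Fin.natAdd (n + 1) (Fin.last (n + 1))) ≤ 0 ∧
    m (Fin.castAdd (n + 1 + 1) (Fin.last n)) + m (Fin.natAdd (n + 1) (Fin.last (n + 1))) ≤ 0}
  zero_mem' := by simp
  add_mem' := by
    rintro a b ⟨h1, h2⟩ ⟨h3, h4⟩
    constructor
    · simp only [Pi.add_apply]; linarith
    · simp only [Pi.add_apply]; linarith

/-- Admissible exponents of `e^{k·z}`. -/
def lastCone (n : ℕ) : AddSubmonoid (Fin (n + 1) → ℝ) where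
  carrier := {m | m (Fin.last n) ≤ 0}
  zero_mem' := by simp
  add_mem' := by
    intro a b h1 h2
    simp only [Set.mem_ofPred_eq, Pi.add_apply] at *
    linarith

theorem mem_jointCone {n : ℕ} {m : Fin (n + 1 + (n + 1 + 1)) → ℝ} : m ∈ jointCone n ↔
    m (Fin.natAdd (n + 1) (Fin.last (n + 1))) ≤ 0 ∧
    m (Fin.castAdd (n + 1 + 1) (Fin.last n)) + m (Fin.natAdd (n + 1) (Fin.last (n + 1))) ≤ 0 :=
  Iff.rfl

theorem mem_lastCone {n : ℕ} {m : Fin (n + 1) → ℝ} : m ∈ lastCone n ↔ m (Fin.last n) ≤ 0 :=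
  Iff.rfl

/-- The functions of `(x, z)` obtained from `Λ(x|z)` by admissible operators. -/
abbrev jointSpan (n : ℕ) (lam : ℂ) : Submodule ℂ (Smooth (n + 1 + (n + 1 + 1))) :=
  expSpan (lamS (n + 1) lam) (jointCone n)

theorem castAdd_ne_natAdd {n m : ℕ} (i : Fin n) (j : Fin m) : Fin.castAdd m i ≠ Fin.natAdd n j := by
  intro h
  have := congrArg Fin.val h
  simp at this
  omega

theorem natAdd_ne_castAdd {n m : ℕ} (i : Fin n) (j : Fin m) : Fin.natAdd n j ≠ Fin.castAdd m i :=
  (castAdd_ne_natAdd i j).symm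

theorem sum_single_sub_single {N : ℕ} (i j : Fin N) (p : Fin N → ℝ) :
    ∑ k, (Pi.single i (1 : ℝ) - Pi.single j 1 : Fin N → ℝ) k * p k = p i - p j := by
  simp [sub_mul, Finset.sum_sub_distrib, Pi.single_apply]

theorem expS_single_sub_single {N : ℕ} (i j : Fin N) (p : Fin N → ℝ) :
    (expS (Pi.single i (1 : ℝ) - Pi.single j 1)).1 p =
      (Real.exp (p i) : ℂ) * (Real.exp (-p j) : ℂ) := by
  rw [expS_apply, sum_single_sub_single, sub_eq_add_neg, Real.exp_add, Complex.ofReal_mul]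

theorem natAdd_eq_natAdd {n m : ℕ} {i j : Fin m} : Fin.natAdd n i = Fin.natAdd n j ↔ i = j :=
  (Fin.natAdd_injective _ _).eq_iff

theorem castAdd_eq_castAdd {n m : ℕ} {i j : Fin n} : Fin.castAdd m i = Fin.castAdd m j ↔ i = j :=
  (Fin.castAdd_injective _ _).eq_iff

theorem single_z_sub_single_x_mem {n : ℕ} (j : Fin (n + 1)) :
    (Pi.single (Fin.natAdd (n + 1) j.castSucc) 1 - Pi.single (Fin.castAdd (n + 1 + 1) j) 1 :
      Fin (n + 1 + (n + 1 + 1)) → ℝ) ∈ jointCone n := by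
  rw [mem_jointCone]
  simp only [Pi.sub_apply, Pi.single_apply, natAdd_ne_castAdd, castAdd_ne_natAdd,
    natAdd_eq_natAdd, castAdd_eq_castAdd, (Fin.castSucc_lt_last j).ne', if_false]
  split_ifs <;> norm_num

theorem single_x_sub_single_z_mem {n : ℕ} (j : Fin (n + 1)) :
    (Pi.single (Fin.castAdd (n + 1 + 1) j) 1 - Pi.single (Fin.natAdd (n + 1) j.succ) 1 :
      Fin (n + 1 + (n + 1 + 1)) → ℝ) ∈ jointCone n := by
  rw [mem_jointCone]
  simp only [Pi.sub_apply, Pi.single_apply, natAdd_ne_castAdd, castAdd_ne_natAdd,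
    natAdd_eq_natAdd, castAdd_eq_castAdd, ← Fin.succ_last, Fin.succ_inj, if_false]
  split_ifs <;> norm_num

theorem pd_lamS_x_mem {n : ℕ} (lam : ℂ) (j : Fin (n + 1)) :
    pd (Fin.castAdd (n + 1 + 1) j) (lamS (n + 1) lam) ∈ jointSpan n lam := by
  have h : pd (Fin.castAdd (n + 1 + 1) j) (lamS (n + 1) lam) =
      (Complex.I * lam) • lamS (n + 1) lam +
      mulS (expS (Pi.single (Fin.natAdd (n + 1) j.castSucc) 1 -
        Pi.single (Fin.castAdd (n + 1 + 1) j) 1)) (lamS (n + 1) lam) -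
      mulS (expS (Pi.single (Fin.castAdd (n + 1 + 1) j) 1 -
        Pi.single (Fin.natAdd (n + 1) j.succ) 1)) (lamS (n + 1) lam) := by
    ext p
    rw [pd_lamS_x]
    rw [Submodule.coe_sub, Submodule.coe_add, Submodule.coe_smul, Pi.sub_apply,
      Pi.add_apply, Pi.smul_apply, mulS_apply, mulS_apply, expS_single_sub_single,
      expS_single_sub_single, smul_eq_mul]
    ring
  rw [h]
  refine Submodule.sub_mem _ (Submodule.add_mem _ (Submodule.smul_mem _ _ (self_mem_expSpan _ _))
    (mulS_expS_mem_expSpan _ _ (single_z_sub_single_x_mem j)))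
    (mulS_expS_mem_expSpan _ _ (single_x_sub_single_z_mem j))

theorem pd_lamS_z_mem {n : ℕ} (lam : ℂ) (j : Fin (n + 1 + 1)) :
    pd (Fin.natAdd (n + 1) j) (lamS (n + 1) lam) ∈ jointSpan n lam := by
  set F := lamS (n + 1) lam with hF
  -- For the last z this term is absent, since no x follows it. That is why the exponent of the last
  -- z never becomes positive.
  obtain ⟨G, hG, hG'⟩ : ∃ G ∈ jointSpan n lam, ∀ p, G.1 p =
      (Real.exp (coordZ p j) : ℂ) * expXi (coordX p) j * F.1 p := by
    refine Fin.lastCases ⟨0, Submodule.zero_mem _, fun p => by simp⟩ (fun k => ?_) j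
    refine ⟨mulS (expS (Pi.single (Fin.natAdd (n + 1) k.castSucc) 1 -
        Pi.single (Fin.castAdd (n + 1 + 1) k) 1)) F, mulS_expS_mem_expSpan _ _ (single_z_sub_single_x_mem k),
        fun p => ?_⟩
    rw [mulS_apply, expS_single_sub_single, expXi_castSucc]
  have h : pd (Fin.natAdd (n + 1) j) F = (-Complex.I * lam) • F - G +
      ∑ i : Fin (n + 1), if i.succ = j then
        mulS (expS (Pi.single (Fin.castAdd (n + 1 + 1) i) 1 -
        Pi.single (Fin.natAdd (n + 1) i.succ) 1)) F else 0 := by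
    ext p
    rw [pd_lamS_z]
    simp only [Submodule.coe_sub, Submodule.coe_add, Submodule.coe_smul, Pi.sub_apply,
      Pi.add_apply, Pi.smul_apply, smul_eq_mul, hG', Submodule.coe_sum, Finset.sum_apply]
    rw [add_mul, sub_mul, Finset.sum_mul]
    congr 1
    refine Finset.sum_congr rfl fun i _ => ?_
    split_ifs
    · rw [mulS_apply, expS_single_sub_single]
    · simp
  rw [h]
  refine Submodule.add_mem _ (Submodule.sub_mem _ (Submodule.smul_mem _ _ (self_mem_expSpan _ _))
    hG) (Submodule.sum_mem _ fun i _ => ?_)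
  split_ifs
  · exact mulS_expS_mem_expSpan _ _ (single_x_sub_single_z_mem i)
  · exact Submodule.zero_mem _

theorem pd_mem_jointSpan {n : ℕ} {lam : ℂ} (i : Fin (n + 1 + (n + 1 + 1)))
    {f : Smooth (n + 1 + (n + 1 + 1))} (hf : f ∈ jointSpan n lam) : pd i f ∈ jointSpan n lam := by
  refine pd_mem_expSpan ?_ hf
  exact Fin.addCases (fun j => pd_lamS_x_mem lam j) (fun j => pd_lamS_z_mem lam j) i

theorem expMul_x_mem_jointSpan {n : ℕ} {lam : ℂ} (s : ℝ) (j : Fin (n + 1))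
    (h : s ≤ 0 ∨ j ≠ Fin.last n) {f : Smooth (n + 1 + (n + 1 + 1))} (hf : f ∈ jointSpan n lam) :
    expMul s (Fin.castAdd (n + 1 + 1) j) f ∈ jointSpan n lam := by
  refine expMul_mem_expSpan ?_ hf
  rw [mem_jointCone]
  simp only [Pi.single_apply, natAdd_ne_castAdd, castAdd_eq_castAdd, if_false]
  rcases h with h | h
  · split_ifs <;> simp [h]
  · simp [h.symm]

/-! ### Restriction of the joint span to one group of variables. -/

/-- The functions of `z` obtained from `Λ(x|z)`, for fixed `x`, by admissible operators. -/
abbrev zSpan {n : ℕ} (lam : ℂ) (x : Fin (n + 1) → ℝ) : Submodule ℂ (Smooth (n + 1 + 1)) :=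
  expSpan (sliceRight x (lamS (n + 1) lam)) (lastCone (n + 1))

/-- The functions of `x` obtained from `Λ(x|z)`, for fixed `z`. -/
abbrev xSpan {n : ℕ} (lam : ℂ) (z : Fin (n + 1 + 1) → ℝ) : Submodule ℂ (Smooth (n + 1)) :=
  expSpan (sliceLeft z (lamS (n + 1) lam)) ⊤

theorem sliceRight_mulS_expS {n m : ℕ} (x : Fin n → ℝ) (k : Fin (n + m) → ℝ) (f : Smooth (n + m)) :
    sliceRight x (mulS (expS k) f) = (Real.exp (∑ i, k (Fin.castAdd m i) * x i) : ℂ) •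
      mulS (expS fun j => k (Fin.natAdd n j)) (sliceRight x f) := by
  ext z
  simp only [sliceRight_apply, mulS_apply, expS_apply, Fin.sum_univ_add, Fin.append_left,
    Fin.append_right, Real.exp_add, Submodule.coe_smul, Pi.smul_apply, smul_eq_mul]
  push_cast
  ring

theorem sliceLeft_mulS_expS {n m : ℕ} (z : Fin m → ℝ) (k : Fin (n + m) → ℝ) (f : Smooth (n + m)) :
    sliceLeft z (mulS (expS k) f) = (Real.exp (∑ i, k (Fin.natAdd n i) * z i) : ℂ) •
      mulS (expS fun j => k (Fin.castAdd m j)) (sliceLeft z f) := by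
  ext x
  simp only [sliceLeft_apply, mulS_apply, expS_apply, Fin.sum_univ_add, Fin.append_left,
    Fin.append_right, Real.exp_add, Submodule.coe_smul, Pi.smul_apply, smul_eq_mul]
  push_cast
  ring

/-- For fixed x the factor e^{m·x} is a constant, so of the two cone conditions only the one on the
last z survives. -/
theorem sliceRight_mem_zSpan {n : ℕ} {lam : ℂ} (x : Fin (n + 1) → ℝ)
    {f : Smooth (n + 1 + (n + 1 + 1))} (hf : f ∈ jointSpan n lam) :
    sliceRight x f ∈ zSpan lam x := by
  induction hf using Submodule.span_induction with
  | mem f h =>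
    obtain ⟨m, hm, rfl⟩ := h
    rw [sliceRight_mulS_expS]
    exact Submodule.smul_mem _ _ (mulS_expS_mem_expSpan _ _ hm.1)
  | zero => rw [map_zero]; exact Submodule.zero_mem _
  | add f g _ _ hf hg => rw [map_add]; exact Submodule.add_mem _ hf hg
  | smul c f _ hf => rw [map_smul]; exact Submodule.smul_mem _ _ hf

theorem sliceLeft_mem_xSpan {n : ℕ} {lam : ℂ} (z : Fin (n + 1 + 1) → ℝ)
    {f : Smooth (n + 1 + (n + 1 + 1))} (hf : f ∈ jointSpan n lam) :
    sliceLeft z f ∈ xSpan lam z := by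
  induction hf using Submodule.span_induction with
  | mem f h =>
    obtain ⟨m, hm, rfl⟩ := h
    rw [sliceLeft_mulS_expS]
    exact Submodule.smul_mem _ _ (mulS_expS_mem_expSpan _ _ (AddSubmonoid.mem_top _))
  | zero => rw [map_zero]; exact Submodule.zero_mem _
  | add f g _ _ hf hg => rw [map_add]; exact Submodule.add_mem _ hf hg
  | smul c f _ hf => rw [map_smul]; exact Submodule.smul_mem _ _ hf

theorem pd_mem_zSpan {n : ℕ} {lam : ℂ} {x : Fin (n + 1) → ℝ} (i : Fin (n + 1 + 1))
    {f : Smooth (n + 1 + 1)} (hf : f ∈ zSpan lam x) : pd i f ∈ zSpan lam x := by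
  refine pd_mem_expSpan ?_ hf
  rw [sliceRight_pd]
  exact sliceRight_mem_zSpan x (pd_lamS_z_mem lam i)

theorem pd_mem_xSpan {n : ℕ} {lam : ℂ} {z : Fin (n + 1 + 1) → ℝ} (i : Fin (n + 1))
    {f : Smooth (n + 1)} (hf : f ∈ xSpan lam z) : pd i f ∈ xSpan lam z := by
  refine pd_mem_expSpan ?_ hf
  rw [sliceLeft_pd]
  exact sliceLeft_mem_xSpan z (pd_lamS_x_mem lam i)

theorem expMul_mem_xSpan {n : ℕ} {lam : ℂ} {z : Fin (n + 1 + 1) → ℝ} (s : ℝ) (i : Fin (n + 1))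
    {f : Smooth (n + 1)} (hf : f ∈ xSpan lam z) : expMul s i f ∈ xSpan lam z :=
  expMul_mem_expSpan (AddSubmonoid.mem_top _) hf

theorem expMul_mem_zSpan {n : ℕ} {lam : ℂ} {x : Fin (n + 1) → ℝ} (s : ℝ) (j : Fin (n + 1 + 1))
    (h : s ≤ 0 ∨ j ≠ Fin.last (n + 1)) {f : Smooth (n + 1 + 1)} (hf : f ∈ zSpan lam x) :
    expMul s j f ∈ zSpan lam x := by
  refine expMul_mem_expSpan ?_ hf
  rw [mem_lastCone]
  rcases h with h | h
  · simp only [Pi.single_apply]; split_ifs <;> simp [h]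
  · simp [h.symm]


/-! ## Pointwise bounds -/

/-- For t ≥ 0 use e^t ≥ 1 + t + t²/2 together with 2Mt ≤ t² + M². In this form e^{-e^t} beats an
exponential of any rate M at the price of the constant M², and all decay estimates become linear
inequalities. -/
theorem mul_max_le_exp (M t : ℝ) : M * max t 0 ≤ Real.exp t + M ^ 2 := by
  rcases le_total 0 t with h | h
  · rw [max_eq_left h]
    have := Real.quadratic_le_exp_of_nonneg h
    nlinarith [sq_nonneg (t - M), sq_nonneg t, sq_nonneg M]
  · rw [max_eq_right h]
    have := Real.exp_pos t
    nlinarith [sq_nonneg M]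

theorem max_sub_ge_left (a b : ℝ) : max a 0 - |b| ≤ max (a - b) 0 := by
  rcases le_total 0 a with h | h
  · rw [max_eq_left h]; exact le_max_of_le_left (by linarith [le_abs_self b])
  · rw [max_eq_right h]; exact le_max_of_le_right (by linarith [abs_nonneg b])

theorem max_sub_ge_right (a b : ℝ) : max (-b) 0 - |a| ≤ max (a - b) 0 := by
  have := max_sub_ge_left (-b) (-a)
  rwa [abs_neg, show -b - -a = a - b by ring] at this

theorem neg_exp_sub_le_left {M : ℝ} (hM : 0 ≤ M) (a b : ℝ) :
    -Real.exp (a - b) ≤ M ^ 2 - M * max a 0 + M * |b| := by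
  have h1 := mul_max_le_exp M (a - b)
  have h2 := mul_le_mul_of_nonneg_left (max_sub_ge_left a b) hM
  linarith

theorem neg_exp_sub_le_right {M : ℝ} (hM : 0 ≤ M) (a b : ℝ) :
    -Real.exp (a - b) ≤ M ^ 2 - M * max (-b) 0 + M * |a| := by
  have h1 := mul_max_le_exp M (a - b)
  have h2 := mul_le_mul_of_nonneg_left (max_sub_ge_right a b) hM
  linarith

theorem max_add_max_neg (a : ℝ) : max a 0 + max (-a) 0 = |a| := by
  rcases le_total 0 a with h | h
  · rw [max_eq_left h, max_eq_right (by linarith), abs_of_nonneg h, add_zero]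
  · rw [max_eq_right h, max_eq_left (by linarith), abs_of_nonpos h, zero_add]

theorem norm_kerLam {n : ℕ} (lam : ℂ) (x : Fin n → ℝ) (z : Fin (n + 1) → ℝ) :
    ‖kerLam lam x z‖ = Real.exp (-lam.im * (∑ i, x i - ∑ i, z i) -
      ∑ j : Fin n, (Real.exp (z j.castSucc - x j) + Real.exp (x j - z j.succ))) := by
  rw [kerLam, Complex.norm_exp]
  congr 1
  rw [Complex.sub_re, Complex.re_mul_ofReal, Complex.ofReal_re]
  simp

theorem norm_mulS_expS_lamS {n : ℕ} (lam : ℂ) (m : Fin (n + (n + 1)) → ℝ) (x : Fin n → ℝ)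
    (z : Fin (n + 1) → ℝ) : ‖(mulS (expS m) (lamS n lam)).1 (Fin.append x z)‖ =
    Real.exp (∑ i, m (Fin.castAdd (n + 1) i) * x i + ∑ i, m (Fin.natAdd n i) * z i +
      -lam.im * (∑ i, x i - ∑ i, z i) -
      ∑ j : Fin n, (Real.exp (z j.castSucc - x j) + Real.exp (x j - z j.succ))) := by
  have hx : coordX (Fin.append x z) = x := by funext i; simp [coordX]
  have hz : coordZ (Fin.append x z) = z := by funext i; simp [coordZ]
  rw [mulS_apply, norm_mul, lamS_apply, hx, hz, norm_kerLam, expS_apply, Complex.norm_real,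
    Real.norm_of_nonneg (Real.exp_pos _).le, ← Real.exp_add]
  congr 1
  rw [Fin.sum_univ_add]
  simp only [Fin.append_left, Fin.append_right]
  ring

theorem abs_sum_le_sum_abs' {ι : Type*} [Fintype ι] (x : ι → ℝ) : |∑ i, x i| ≤ ∑ i, |x i| :=
  Finset.abs_sum_le_sum_abs _ _

/-- Decay of `e^{m·x + k·z} Λ(x|z)` in `z`, for `z_0` bounded below. -/
theorem norm_mulS_expS_lamS_le_z {n : ℕ} {lam : ℂ} (hs : 0 ≤ -lam.im) (ℓ A : ℝ) (hA : 0 ≤ A)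
    (m : Fin (n + 1 + (n + 1 + 1)) → ℝ) :
    ∃ L B : ℝ, 0 ≤ B ∧ ∀ (x : Fin (n + 1) → ℝ) (z : Fin (n + 1 + 1) → ℝ), ℓ ≤ z 0 →
      ‖(mulS (expS m) (lamS (n + 1) lam)).1 (Fin.append x z)‖ ≤
      Real.exp (L + B * ∑ i, |x i| - A * ∑ i : Fin (n + 1), |z i.castSucc| -
        A * max (-z (Fin.last _)) 0 +
        (m (Fin.natAdd _ (Fin.last _)) + lam.im) * z (Fin.last _)) := by
  set s := -lam.im
  set κ := ∑ i, |m i|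
  have hκ : 0 ≤ κ := Finset.sum_nonneg fun _ _ => abs_nonneg _
  -- The rate has to pay for the desired decay A, for the exponents m (bounded by κ) and for the
  -- factor e^{s(Σx - Σz)}.
  set M := A + κ + s
  have hM : 0 ≤ M := by positivity
  refine ⟨(n + 1) * (2 * M ^ 2) + M * |ℓ|, κ + s + 2 * M, by positivity, fun x z hz => ?_⟩
  rw [norm_mulS_expS_lamS, Real.exp_le_exp]
  have hlam : lam.im = -s := by simp [s]
  rw [hlam]
  have hmi : ∀ i, |m i| ≤ κ := fun i =>
    Finset.single_le_sum (f := fun i => |m i|) (fun _ _ => abs_nonneg _) (Finset.mem_univ i)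
  have h1 : ∑ i, m (Fin.castAdd (n + 1 + 1) i) * x i ≤ κ * ∑ i, |x i| := by
    rw [Finset.mul_sum]
    refine Finset.sum_le_sum fun i _ => (le_abs_self _).trans ?_
    rw [abs_mul]
    exact mul_le_mul_of_nonneg_right (hmi _) (abs_nonneg _)
  have h2 : ∑ i, m (Fin.natAdd (n + 1) i) * z i ≤ κ * ∑ i : Fin (n + 1), |z i.castSucc| +
      m (Fin.natAdd _ (Fin.last _)) * z (Fin.last _) := by
    rw [Fin.sum_univ_castSucc, Finset.mul_sum]
    refine add_le_add (Finset.sum_le_sum fun i _ => (le_abs_self _).trans ?_) le_rfl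
    rw [abs_mul]
    exact mul_le_mul_of_nonneg_right (hmi _) (abs_nonneg _)
  have h3 : s * (∑ i, x i - ∑ i, z i) ≤ s * ∑ i, |x i| + s * ∑ i : Fin (n + 1), |z i.castSucc| -
      s * z (Fin.last _) := by
    rw [Fin.sum_univ_castSucc (f := z)]
    have h4 := (le_abs_self _).trans (abs_sum_le_sum_abs' x)
    have h5 := (neg_le_abs _).trans (abs_sum_le_sum_abs' fun i : Fin (n + 1) => z i.castSucc)
    have := mul_le_mul_of_nonneg_left (add_le_add h4 h5) hs
    linarith
  -- The exponential e^{z_j - x_j} controls the positive part of z_j, and e^{x_j - z_{j+1}} the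
  -- negative part of z_{j+1}. Uncovered are the negative part of z_0, bounded below by means of ℓ,
  -- and the positive part of the last z, which stays in the bound.
  have h6 : -∑ j : Fin (n + 1), (Real.exp (z j.castSucc - x j) + Real.exp (x j - z j.succ)) ≤
      (n + 1) * (2 * M ^ 2) + 2 * M * ∑ i, |x i| - M * ∑ j : Fin (n + 1), max (z j.castSucc) 0 -
        M * ∑ j : Fin (n + 1), max (-z j.succ) 0 := by
    have : ((n + 1 : ℝ)) * (2 * M ^ 2) = ∑ _j : Fin (n + 1), 2 * M ^ 2 := by simp
    rw [this, Finset.mul_sum, Finset.mul_sum, Finset.mul_sum, ← Finset.sum_neg_distrib,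
      ← Finset.sum_add_distrib, ← Finset.sum_sub_distrib, ← Finset.sum_sub_distrib]
    refine Finset.sum_le_sum fun j _ => ?_
    have a1 := neg_exp_sub_le_left hM (z j.castSucc) (x j)
    have a2 := neg_exp_sub_le_right hM (x j) (z j.succ)
    linarith
  have h7 : max (-z 0) 0 ≤ |ℓ| := max_le (by linarith [neg_abs_le ℓ]) (abs_nonneg _)
  have h8 : ∑ j : Fin (n + 1), max (-z j.succ) 0 = ∑ j : Fin (n + 1), max (-z j.castSucc) 0 +
      max (-z (Fin.last _)) 0 - max (-z 0) 0 := by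
    have e1 := Fin.sum_univ_castSucc fun j => max (-z j) 0
    have e2 := Fin.sum_univ_succ fun j => max (-z j) 0
    linarith
  have h9 : ∑ j : Fin (n + 1), max (z j.castSucc) 0 + ∑ j : Fin (n + 1), max (-z j.castSucc) 0 =
      ∑ j : Fin (n + 1), |z j.castSucc| := by
    rw [← Finset.sum_add_distrib]
    exact Finset.sum_congr rfl fun j _ => max_add_max_neg _
  rw [h8] at h6
  have h10 : M * max (-z (Fin.last (n + 1))) 0 ≥ A * max (-z (Fin.last (n + 1))) 0 :=
    mul_le_mul_of_nonneg_right (by simp only [M]; linarith) (le_max_right _ _)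
  have h11 := mul_le_mul_of_nonneg_left h7 hM
  have h12 : M * ∑ j : Fin (n + 1), |z j.castSucc| = A * ∑ j : Fin (n + 1), |z j.castSucc| +
    κ * ∑ j : Fin (n + 1), |z j.castSucc| + s * ∑ j : Fin (n + 1), |z j.castSucc| := by
    simp only [M]; ring
  rw [← h9] at h12 ⊢
  rw [← h9] at h2 h3
  linarith

/-- Decay of `e^{m·y + k·z} Λ(y|z)` in `y`, for fixed `z`. -/
theorem norm_mulS_expS_lamS_le_y {n : ℕ} {lam : ℂ} (hs : 0 ≤ -lam.im) (A : ℝ) (hA : 0 ≤ A)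
    (m : Fin (n + (n + 1)) → ℝ) (z : Fin (n + 1) → ℝ) :
    ∃ L : ℝ, ∀ y : Fin n → ℝ, ‖(mulS (expS m) (lamS n lam)).1 (Fin.append y z)‖ ≤
      Real.exp (L - A * ∑ i, |y i|) := by
  set s := -lam.im
  set κ := ∑ i, |m i|
  have hκ : 0 ≤ κ := Finset.sum_nonneg fun _ _ => abs_nonneg _
  set M := A + κ + s
  have hM : 0 ≤ M := by positivity
  refine ⟨∑ i, m (Fin.natAdd n i) * z i - s * ∑ i, z i + n * (2 * M ^ 2) +
    M * ∑ j : Fin n, (|z j.castSucc| + |z j.succ|), fun x => ?_⟩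
  rw [norm_mulS_expS_lamS, Real.exp_le_exp]
  have hmi : ∀ i, |m i| ≤ κ := fun i =>
    Finset.single_le_sum (f := fun i => |m i|) (fun _ _ => abs_nonneg _) (Finset.mem_univ i)
  have h1 : ∑ i, m (Fin.castAdd (n + 1) i) * x i ≤ κ * ∑ i, |x i| := by
    rw [Finset.mul_sum]
    refine Finset.sum_le_sum fun i _ => (le_abs_self _).trans ?_
    rw [abs_mul]
    exact mul_le_mul_of_nonneg_right (hmi _) (abs_nonneg _)
  have h3 : s * (∑ i, x i - ∑ i, z i) ≤ s * ∑ i, |x i| - s * ∑ i, z i := by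
    have := mul_le_mul_of_nonneg_left ((le_abs_self _).trans (abs_sum_le_sum_abs' x)) hs
    linarith
  -- For fixed z each variable of the shorter chain has a double exponential on both sides, so no
  -- direction is left uncovered.
  have h6 : -∑ j : Fin n, (Real.exp (z j.castSucc - x j) + Real.exp (x j - z j.succ)) ≤
      n * (2 * M ^ 2) + M * ∑ j : Fin n, (|z j.castSucc| + |z j.succ|) - M * ∑ i, |x i| := by
    have : (n : ℝ) * (2 * M ^ 2) = ∑ _j : Fin n, 2 * M ^ 2 := by simp
    rw [this, Finset.mul_sum, Finset.mul_sum, ← Finset.sum_neg_distrib,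
      ← Finset.sum_add_distrib, ← Finset.sum_sub_distrib]
    refine Finset.sum_le_sum fun j _ => ?_
    have a1 := neg_exp_sub_le_right hM (z j.castSucc) (x j)
    have a2 := neg_exp_sub_le_left hM (x j) (z j.succ)
    have a3 := max_add_max_neg (x j)
    rw [← a3]
    linarith
  have h12 : M * ∑ j, |x j| = A * ∑ j, |x j| + κ * ∑ j, |x j| + s * ∑ j, |x j| := by
    simp only [M]; ring
  linarith

/-- Growth admissible as the last variable tends to `+∞`, in exponential form. -/
def LastBound {n : ℕ} (L b δ : ℝ) (y : Fin (n + 1) → ℝ) : ℝ :=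
  Real.exp (L + b * ∑ i : Fin n, |y i.castSucc| + δ * max (y (Fin.last n)) 0 +
    b * max (-y (Fin.last n)) 0)

set_option maxHeartbeats 1000000 in
/-- Joint decay of `e^{m·y + k·z} Λ(y|z) φ(y)`. -/
theorem norm_mulS_expS_lamS_mul_le {n : ℕ} {lam : ℂ} (hs : 0 ≤ -lam.im) {δ : ℝ} (hδ : 0 ≤ δ)
    {b L₀ : ℝ} (hb : 0 ≤ b) {m : Fin (n + 1 + (n + 1 + 1)) → ℝ} (hm : m ∈ jointCone n) :
    ∃ L b' : ℝ, 0 ≤ b' ∧ ∀ (y : Fin (n + 1) → ℝ) (z : Fin (n + 1 + 1) → ℝ),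
      ‖(mulS (expS m) (lamS (n + 1) lam)).1 (Fin.append y z)‖ * LastBound L₀ b δ y ≤
      LastBound L b' (2 * δ) z * Real.exp (-δ * ∑ i, |y i|) := by
  set s := -lam.im
  set κ := ∑ i, |m i|
  have hκ : 0 ≤ κ := Finset.sum_nonneg fun _ _ => abs_nonneg _
  set M := κ + s + b + δ
  have hM : 0 ≤ M := by positivity
  set c := -m (Fin.natAdd (n + 1) (Fin.last (n + 1)))
  set a := m (Fin.castAdd (n + 1 + 1) (Fin.last n))
  have hc : 0 ≤ c := by simpa [c] using hm.1
  have hac : a ≤ c := by have := hm.2; simp only [a, c]; linarith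
  -- The last exponential e^{y_l - z_l} is kept whole, to be used at this rate. It pays for c + s
  -- from the prefactors and for 2δ: one δ from the growth in the last y and one for the new decay
  -- e^{-δ|y_l|}.
  set K := c + s + 2 * δ
  have hK : 0 ≤ K := by positivity
  refine ⟨L₀ + n * (2 * M ^ 2) + M ^ 2 + K ^ 2, κ + s + 2 * M + (c + s), by positivity,
    fun y z => ?_⟩
  rw [norm_mulS_expS_lamS, LastBound, LastBound, ← Real.exp_add, ← Real.exp_add, Real.exp_le_exp]
  have hmi : ∀ i, |m i| ≤ κ := fun i =>
    Finset.single_le_sum (f := fun i => |m i|) (fun _ _ => abs_nonneg _) (Finset.mem_univ i)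
  have hmy : ∀ i t, m i * t ≤ κ * |t| := fun i t => by
    refine (le_abs_self _).trans ?_
    rw [abs_mul]
    exact mul_le_mul_of_nonneg_right (hmi _) (abs_nonneg _)
  set yl := y (Fin.last n)
  set zl := z (Fin.last (n + 1))
  have h1 : ∑ i, m (Fin.castAdd (n + 1 + 1) i) * y i ≤ κ * ∑ i : Fin n, |y i.castSucc| + a * yl := by
    rw [Fin.sum_univ_castSucc, Finset.mul_sum]
    exact add_le_add (Finset.sum_le_sum fun i _ => hmy _ _) le_rfl
  have h2 : ∑ i, m (Fin.natAdd (n + 1) i) * z i ≤ κ * ∑ i : Fin (n + 1), |z i.castSucc| - c * zl := by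
    rw [Fin.sum_univ_castSucc, Finset.mul_sum, sub_eq_add_neg, ← neg_mul]
    simp only [c, neg_neg]
    exact add_le_add (Finset.sum_le_sum fun i _ => hmy _ _) le_rfl
  have h3 : s * (∑ i, y i - ∑ i, z i) ≤ s * ∑ i : Fin n, |y i.castSucc| + s * yl +
      s * ∑ i : Fin (n + 1), |z i.castSucc| - s * zl := by
    rw [Fin.sum_univ_castSucc, Fin.sum_univ_castSucc (f := z)]
    have h4 := (le_abs_self _).trans (abs_sum_le_sum_abs' fun i : Fin n => y i.castSucc)
    have h5 := (neg_le_abs _).trans (abs_sum_le_sum_abs' fun i : Fin (n + 1) => z i.castSucc)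
    have := mul_le_mul_of_nonneg_left (add_le_add h4 h5) hs
    linarith
  set Zs := ∑ i : Fin (n + 1), |z i.castSucc|
  have hZ : ∀ i : Fin (n + 1), |z i.castSucc| ≤ Zs := fun i =>
    Finset.single_le_sum (f := fun i : Fin (n + 1) => |z i.castSucc|) (fun _ _ => abs_nonneg _)
      (Finset.mem_univ i)
  have h6 : -∑ j : Fin (n + 1), (Real.exp (z j.castSucc - y j) + Real.exp (y j - z j.succ)) ≤
      n * (2 * M ^ 2) + 2 * M * Zs - M * ∑ j : Fin n, |y j.castSucc| +
      (M ^ 2 - M * max (-yl) 0 - Real.exp (yl - zl)) := by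
    rw [Fin.sum_univ_castSucc]
    have e1 : -∑ j : Fin n, (Real.exp (z j.castSucc.castSucc - y j.castSucc) +
        Real.exp (y j.castSucc - z j.castSucc.succ)) ≤ ∑ j : Fin n, (2 * M ^ 2) +
        M * (∑ j : Fin n, |z j.castSucc.castSucc| + ∑ j : Fin n, |z j.succ.castSucc|) -
        M * ∑ j : Fin n, |y j.castSucc| := by
      rw [mul_add, Finset.mul_sum, Finset.mul_sum, Finset.mul_sum, ← Finset.sum_neg_distrib,
        ← Finset.sum_add_distrib, ← Finset.sum_add_distrib, ← Finset.sum_sub_distrib]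
      refine Finset.sum_le_sum fun j _ => ?_
      have a1 := neg_exp_sub_le_right hM (z j.castSucc.castSucc) (y j.castSucc)
      have a2 := neg_exp_sub_le_left hM (y j.castSucc) (z j.succ.castSucc)
      have a3 := max_add_max_neg (y j.castSucc)
      rw [← Fin.succ_castSucc] at a2
      rw [← a3, ← Fin.succ_castSucc]
      linarith
    have e2 := neg_exp_sub_le_right hM (z (Fin.last n).castSucc) yl
    have e3 : Zs = ∑ j : Fin n, |z j.castSucc.castSucc| + |z (Fin.last n).castSucc| :=
      Fin.sum_univ_castSucc _
    have e4 : Zs = |z (Fin.castSucc 0)| + ∑ j : Fin n, |z j.succ.castSucc| :=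
      Fin.sum_univ_succ fun j : Fin (n + 1) => |z j.castSucc|
    have e5 : M * (∑ j : Fin n, |z j.castSucc.castSucc| + ∑ j : Fin n, |z j.succ.castSucc|) +
        M * |z (Fin.last n).castSucc| ≤ 2 * M * Zs := by
      have := abs_nonneg (z (Fin.castSucc 0))
      have : ∑ j : Fin n, |z j.castSucc.castSucc| + ∑ j : Fin n, |z j.succ.castSucc| +
        |z (Fin.last n).castSucc| ≤ 2 * Zs := by linarith
      nlinarith
    have e6 : ∑ j : Fin n, (2 * M ^ 2) = n * (2 * M ^ 2) := by simp
    rw [Fin.succ_last]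
    linarith
  -- For y_l ≥ 0 the cone condition a ≤ c leaves growth only in the difference y_l - z_l, and the
  -- excess 2δ y_l is traded for 2δ max(z_l, 0). For y_l ≤ 0 the exponential linking y_l to the
  -- preceding z, already spent on -M max(-y_l, 0), is sufficient.
  have h7 : a * yl + s * yl - (c + s) * zl + δ * max yl 0 + b * max (-yl) 0 - M * max (-yl) 0 -
      Real.exp (yl - zl) ≤ K ^ 2 + 2 * δ * max zl 0 + (c + s) * max (-zl) 0 - δ * |yl| := by
    have k1 := mul_max_le_exp K (yl - zl)
    have k2 : 0 ≤ max zl 0 := le_max_right _ _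
    have k3 : zl ≤ max zl 0 := le_max_left _ _
    have k4 : 0 ≤ max (-zl) 0 := le_max_right _ _
    have k5 : -zl ≤ max (-zl) 0 := le_max_left _ _
    have k6 : yl - zl ≤ max (yl - zl) 0 := le_max_left _ _
    have k7 : 0 ≤ max (yl - zl) 0 := le_max_right _ _
    rcases le_total 0 yl with h | h
    · rw [max_eq_left h, max_eq_right (by linarith : -yl ≤ 0), abs_of_nonneg h]
      have l1 : a * yl ≤ c * yl := mul_le_mul_of_nonneg_right hac h
      have l2 : (c + s) * (yl - zl) ≤ (c + s) * max (yl - zl) 0 :=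
        mul_le_mul_of_nonneg_left k6 (by positivity)
      have l3 : 2 * δ * yl - 2 * δ * max zl 0 ≤ 2 * δ * max (yl - zl) 0 := by
        rw [← mul_sub]
        exact mul_le_mul_of_nonneg_left (by linarith) (by positivity)
      have l4 : 0 ≤ (c + s) * max (-zl) 0 := by positivity
      have l5 : K * max (yl - zl) 0 = (c + s) * max (yl - zl) 0 + 2 * δ * max (yl - zl) 0 := by
        simp only [K]; ring
      linarith
    · rw [max_eq_right h, max_eq_left (by linarith : 0 ≤ -yl), abs_of_nonpos h]
      have l1 : a * yl ≤ κ * (-yl) := by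
        have := hmy (Fin.castAdd (n + 1 + 1) (Fin.last n)) yl
        rwa [abs_of_nonpos h] at this
      have l2 : -((c + s) * zl) ≤ (c + s) * max (-zl) 0 := by
        have := mul_le_mul_of_nonneg_left k5 (by positivity : 0 ≤ c + s)
        linarith
      have l3 : 0 ≤ 2 * δ * max zl 0 := by positivity
      have l4 := Real.exp_pos (yl - zl)
      have l5 : M * (-yl) = κ * (-yl) + s * (-yl) + b * (-yl) + δ * (-yl) := by simp only [M]; ring
      have l6 : s * yl ≤ s * (-yl) := mul_le_mul_of_nonneg_left (by linarith) hs
      have l7 := sq_nonneg K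
      linarith
  rw [Fin.sum_univ_castSucc (f := fun i => |y i|)]
  have h8 : M * ∑ j : Fin n, |y j.castSucc| = κ * ∑ j : Fin n, |y j.castSucc| +
      s * ∑ j : Fin n, |y j.castSucc| + b * ∑ j : Fin n, |y j.castSucc| +
      δ * ∑ j : Fin n, |y j.castSucc| := by simp only [M]; ring
  have h9 : 0 ≤ (c + s) * Zs := by positivity
  have h10 : 0 ≤ (κ + s + 2 * M) * max (-zl) 0 := by positivity
  linarith


/-! ## The space of functions with polynomial growth in one direction -/

/-- Growth as in the definition of `temperedPoly`, with powers instead of polynomials. -/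
def PolyGrowth {n : ℕ} (j : Fin n) (f : (Fin n → ℝ) → ℂ) : Prop :=
  ∃ (a b : ℝ) (N : ℕ), 0 ≤ a ∧ 0 ≤ b ∧ ∀ x : Fin n → ℝ,
    ‖f x‖ ≤ a * Real.exp (b * ∑ i ∈ Finset.univ.erase j, |x i|) *
      (if 0 ≤ x j then (1 + x j) ^ N else Real.exp (b * |x j|))

theorem abs_eval_le_pow (P : Polynomial ℝ) {t : ℝ} (ht : 0 ≤ t) :
    |P.eval t| ≤ (∑ i ∈ Finset.range (P.natDegree + 1), |P.coeff i|) * (1 + t) ^ P.natDegree := by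
  rw [Polynomial.eval_eq_sum_range, Finset.sum_mul]
  refine (Finset.abs_sum_le_sum_abs _ _).trans (Finset.sum_le_sum fun i hi => ?_)
  rw [abs_mul, abs_of_nonneg (pow_nonneg ht i)]
  refine mul_le_mul_of_nonneg_left ?_ (abs_nonneg _)
  calc t ^ i ≤ (1 + t) ^ i := pow_le_pow_left₀ ht (by linarith) i
    _ ≤ (1 + t) ^ P.natDegree :=
      pow_le_pow_right₀ (by linarith) (by have := Finset.mem_range.1 hi; omega)

theorem polyGrowth_iff {n : ℕ} (j : Fin n) (f : (Fin n → ℝ) → ℂ) : PolyGrowth j f ↔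
    ∃ (a b : ℝ) (P : Polynomial ℝ), 0 ≤ a ∧ 0 ≤ b ∧ ∀ x : Fin n → ℝ,
      ‖f x‖ ≤ a * Real.exp (b * ∑ i ∈ Finset.univ.erase j, |x i|) *
        (if 0 ≤ x j then P.eval (x j) else Real.exp (b * |x j|)) := by
  constructor
  · rintro ⟨a, b, N, ha, hb, h⟩
    exact ⟨a, b, (1 + Polynomial.X) ^ N, ha, hb, fun x => by simpa using h x⟩
  · rintro ⟨a, b, P, ha, hb, h⟩
    set S := ∑ i ∈ Finset.range (P.natDegree + 1), |P.coeff i|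
    have hS : 0 ≤ S := Finset.sum_nonneg fun _ _ => abs_nonneg _
    -- The summand 1 is for the half-space x_j < 0, where the constant must not drop below a.
    refine ⟨a * (S + 1), b, P.natDegree, by positivity, hb, fun x => (h x).trans ?_⟩
    have h1 : a * (S + 1) * Real.exp (b * ∑ i ∈ Finset.univ.erase j, |x i|) *
        (if 0 ≤ x j then (1 + x j) ^ P.natDegree else Real.exp (b * |x j|)) =
        a * Real.exp (b * ∑ i ∈ Finset.univ.erase j, |x i|) * ((S + 1) *
        (if 0 ≤ x j then (1 + x j) ^ P.natDegree else Real.exp (b * |x j|))) := by ring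
    rw [h1]
    refine mul_le_mul_of_nonneg_left ?_ (by positivity)
    split_ifs with hx
    · have h2 := (le_abs_self _).trans (abs_eval_le_pow P hx)
      have h3 : 0 ≤ (1 + x j) ^ P.natDegree := by positivity
      linarith
    · have := Real.exp_pos (b * |x j|)
      nlinarith

theorem PolyGrowth.add {n : ℕ} {j : Fin n} {f g : (Fin n → ℝ) → ℂ} (hf : PolyGrowth j f)
    (hg : PolyGrowth j g) : PolyGrowth j (f + g) := by
  obtain ⟨a, b, N, ha, hb, h⟩ := hf
  obtain ⟨a', b', N', ha', hb', h'⟩ := hg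
  have mono : ∀ (A c c' : ℝ) (M M' : ℕ), 0 ≤ A → c ≤ c' → M ≤ M' → ∀ x : Fin n → ℝ,
      A * Real.exp (c * ∑ i ∈ Finset.univ.erase j, |x i|) *
        (if 0 ≤ x j then (1 + x j) ^ M else Real.exp (c * |x j|)) ≤
      A * Real.exp (c' * ∑ i ∈ Finset.univ.erase j, |x i|) *
        (if 0 ≤ x j then (1 + x j) ^ M' else Real.exp (c' * |x j|)) := by
    intro A c c' M M' hA hc hM x
    have h0 : 0 ≤ ∑ i ∈ Finset.univ.erase j, |x i| := Finset.sum_nonneg fun _ _ => abs_nonneg _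
    split_ifs with hx
    · have : (1 : ℝ) ≤ 1 + x j := by linarith
      gcongr
    · gcongr
  refine ⟨a + a', max b b', max N N', by positivity, le_max_of_le_left hb, fun x => ?_⟩
  refine (norm_add_le _ _).trans ?_
  rw [add_mul, add_mul]
  exact add_le_add
    ((h x).trans (mono _ _ _ _ _ ha (le_max_left _ _) (le_max_left _ _) x))
    ((h' x).trans (mono _ _ _ _ _ ha' (le_max_right _ _) (le_max_right _ _) x))

theorem PolyGrowth.smul {n : ℕ} {j : Fin n} {f : (Fin n → ℝ) → ℂ} (hf : PolyGrowth j f) (c : ℂ) :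
    PolyGrowth j (c • f) := by
  obtain ⟨a, b, N, ha, hb, h⟩ := hf
  refine ⟨‖c‖ * a, b, N, by positivity, hb, fun x => ?_⟩
  rw [Pi.smul_apply, norm_smul, mul_assoc, mul_assoc, ← mul_assoc a]
  exact mul_le_mul_of_nonneg_left (h x) (norm_nonneg c)

theorem PolyGrowth.exp_mul {n : ℕ} {j : Fin n} {f : (Fin n → ℝ) → ℂ} (hf : PolyGrowth j f)
    {s : ℝ} {i : Fin n} (hs : s ≤ 0 ∨ i ≠ j) :
    PolyGrowth j fun x => (Real.exp (s * x i) : ℂ) * f x := by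
  obtain ⟨a, b, N, ha, hb, h⟩ := hf
  refine ⟨a, b + |s|, N, ha, by positivity, fun x => ?_⟩
  rw [norm_mul, Complex.norm_real, Real.norm_of_nonneg (Real.exp_pos _).le]
  refine (mul_le_mul_of_nonneg_left (h x) (Real.exp_pos _).le).trans ?_
  set S := ∑ i ∈ Finset.univ.erase j, |x i| with hS
  have h0 : 0 ≤ S := Finset.sum_nonneg fun _ _ => abs_nonneg _
  have h1 : s * x i ≤ |s| * |x i| := by rw [← abs_mul]; exact le_abs_self _
  have hexp : Real.exp (b * S) ≤ Real.exp ((b + |s|) * S) := by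
    gcongr; linarith [abs_nonneg s]
  by_cases hij : i = j
  · subst hij
    have hs' : s ≤ 0 := by tauto
    split_ifs with hx
    · have : Real.exp (s * x i) ≤ 1 := by
        rw [Real.exp_le_one_iff]; exact mul_nonpos_of_nonpos_of_nonneg hs' hx
      calc Real.exp (s * x i) * (a * Real.exp (b * S) * (1 + x i) ^ N)
          ≤ 1 * (a * Real.exp (b * S) * (1 + x i) ^ N) := by gcongr
        _ ≤ _ := by rw [one_mul]; gcongr
    · have : Real.exp (s * x i) * Real.exp (b * |x i|) ≤ Real.exp ((b + |s|) * |x i|) := by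
        rw [← Real.exp_add, Real.exp_le_exp]; linarith
      calc Real.exp (s * x i) * (a * Real.exp (b * S) * Real.exp (b * |x i|))
          = a * Real.exp (b * S) * (Real.exp (s * x i) * Real.exp (b * |x i|)) := by ring
        _ ≤ _ := by gcongr
  · have h2 : |x i| ≤ S := Finset.single_le_sum (f := fun i => |x i|) (fun _ _ => abs_nonneg _)
      (Finset.mem_erase.2 ⟨hij, Finset.mem_univ _⟩)
    have h3 : Real.exp (s * x i) * Real.exp (b * S) ≤ Real.exp ((b + |s|) * S) := by
      rw [← Real.exp_add, Real.exp_le_exp]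
      have := mul_le_mul_of_nonneg_left h2 (abs_nonneg s)
      linarith
    calc Real.exp (s * x i) * (a * Real.exp (b * S) *
          (if 0 ≤ x j then (1 + x j) ^ N else Real.exp (b * |x j|)))
        = a * (Real.exp (s * x i) * Real.exp (b * S)) *
          (if 0 ≤ x j then (1 + x j) ^ N else Real.exp (b * |x j|)) := by ring
      _ ≤ _ := by
        split_ifs with hx
        · gcongr
        · gcongr
          linarith [abs_nonneg s]

/-- The smooth functions all whose iterated partial derivatives satisfy `PolyGrowth`. -/
def polyClass {n : ℕ} (j : Fin n) : Submodule ℂ (Smooth n) where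
  carrier := {f | ∀ l : List (Fin n), PolyGrowth j ((l.map pd).prod f).1}
  add_mem' := by
    intro f g hf hg l
    rw [map_add]
    exact (hf l).add (hg l)
  zero_mem' := by
    intro l
    rw [map_zero]
    exact ⟨0, 0, 0, le_rfl, le_rfl, fun x => by simp⟩
  smul_mem' := by
    intro c f hf l
    rw [map_smul]
    exact (hf l).smul c

theorem pd_mem_polyClass {n : ℕ} {j : Fin n} (i : Fin n) {f : Smooth n} (hf : f ∈ polyClass j) :
    pd i f ∈ polyClass j := by
  intro l
  have := hf (l ++ [i])
  simpa using this

/-- The innermost derivative is taken first: ∂_k(e^{s x_i} f) is again e^{s x_i} times a function of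
the class. The induction therefore peels words from the right, with f arbitrary. -/
theorem expMul_mem_polyClass {n : ℕ} {j : Fin n} {s : ℝ} {i : Fin n} (hs : s ≤ 0 ∨ i ≠ j)
    {f : Smooth n} (hf : f ∈ polyClass j) : expMul s i f ∈ polyClass j := by
  intro l
  induction l using List.reverseRecOn generalizing f with
  | nil => exact (hf []).exp_mul hs
  | append_singleton l k ih =>
    have h : pd k (expMul s i f) = expMul s i ((if k = i then (s : ℂ) else 0) • f + pd k f) := by
      ext x
      rw [pd_expMul_apply, expMul_apply]
      rfl
    rw [List.map_append, List.prod_append, Module.End.mul_apply, List.map_singleton,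
      List.prod_singleton, h]
    exact ih ((polyClass j).add_mem ((polyClass j).smul_mem _ hf) (pd_mem_polyClass k hf))

theorem mul_ofFn_pow_prod {R : Type*} [Monoid R] {n : ℕ} (a : Fin n → R)
    (h : ∀ i j, Commute (a i) (a j)) (k : Fin n → ℕ) (i : Fin n) :
    a i * (List.ofFn fun j => a j ^ k j).prod =
      (List.ofFn fun j => a j ^ (Function.update k i (k i + 1)) j).prod := by
  induction n with
  | zero => exact i.elim0
  | succ n ih =>
    rw [List.ofFn_succ, List.ofFn_succ, List.prod_cons, List.prod_cons]
    refine Fin.cases ?_ (fun i => ?_) i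
    · simp [Fin.succ_ne_zero, pow_succ', mul_assoc]
    · have := ih (fun j => a j.succ) (fun _ _ => h _ _) (fun j => k j.succ) i
      rw [← mul_assoc, ((h i.succ 0).pow_right _).eq, mul_assoc, this]
      simp [Function.update_apply, (Fin.succ_ne_zero _).symm]

/-- Partial derivatives commute, so a word in them can be sorted into a monomial. `polyClass` uses
words because its closure under `pd` is then immediate; this lemma brings it back to multi-indices.
-/
theorem list_pd_prod_eq_multiPd {n : ℕ} (l : List (Fin n)) :
    ∃ k : Fin n → ℕ, (l.map pd).prod = multiPd k := by
  induction l with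
  | nil => exact ⟨0, by simp [multiPd]⟩
  | cons i l ih =>
    obtain ⟨k, hk⟩ := ih
    refine ⟨Function.update k i (k i + 1), ?_⟩
    rw [List.map_cons, List.prod_cons, hk]
    exact mul_ofFn_pow_prod pd pd_commute k i

theorem multiPd_induction {n : ℕ} {p : Smooth n → Prop} (hp : ∀ i f, p f → p (pd i f))
    (k : Fin n → ℕ) {f : Smooth n} (hf : p f) : p (multiPd k f) := by
  have key : ∀ l : List (DiffOp n), (∀ r ∈ l, ∀ g, p g → p (r g)) → p (l.prod f) := by
    intro l
    induction l with
    | nil => intro _; simpa using hf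
    | cons r l ih =>
      intro h
      rw [List.prod_cons, Module.End.mul_apply]
      exact h r (by simp) _ (ih fun r' hr' => h r' (by simp [hr']))
  refine key _ fun r hr => ?_
  obtain ⟨i, rfl⟩ := List.mem_ofFn.1 hr
  intro g hg
  induction k i with
  | zero => simpa using hg
  | succ m ih => rw [pow_succ', Module.End.mul_apply]; exact hp _ _ ih

theorem mem_temperedPoly_iff {n : ℕ} (j : Fin n) (f : Smooth n) :
    f ∈ temperedPoly j ↔ f ∈ polyClass j := by
  constructor
  · intro h l
    obtain ⟨k, hk⟩ := list_pd_prod_eq_multiPd l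
    rw [hk, polyGrowth_iff]
    exact h k
  · intro h k
    rw [← polyGrowth_iff]
    exact multiPd_induction (p := fun f => f ∈ polyClass j) (fun i f => pd_mem_polyClass i) k h []

/-- The only generator that would destroy polynomial growth in the last direction is e^{x} of the
last site, and the first row does not contain it. -/
theorem siteChain_mem_polyClass {n : ℕ} (u : ℂ) (b : Fin 2) {f : Smooth (n + 1)}
    (hf : f ∈ polyClass (Fin.last n)) :
    siteChain (id : Fin (n + 1) → Fin (n + 1)) 1 u 0 b f ∈ polyClass (Fin.last n) := by
  let S : Submodule ℂ (Smooth (n + 1)) := polyClass (Fin.last n)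
  let d : Fin (n + 1) → DiffOp (n + 1) := fun j => (1 : ℂ) • (pd j : DiffOp (n + 1))
  let em : Fin (n + 1) → DiffOp (n + 1) := fun j => expMul (-1) j
  let ep : Fin (n + 1) → DiffOp (n + 1) := fun j => expMul 1 j
  have h := chain_rel_zero (S.prod S) d em ep d em ep u
    (fun j g hg => ⟨S.smul_mem _ (pd_mem_polyClass j hg.1),
      S.smul_mem _ (pd_mem_polyClass j hg.2)⟩)
    (fun j g hg => ⟨expMul_mem_polyClass (Or.inl (by norm_num)) hg.1,
      expMul_mem_polyClass (Or.inl (by norm_num)) hg.2⟩)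
    (fun j g hg => ⟨expMul_mem_polyClass (Or.inr (Fin.castSucc_lt_last j).ne) hg.1,
      expMul_mem_polyClass (Or.inr (Fin.castSucc_lt_last j).ne) hg.2⟩) b (f, f) ⟨hf, hf⟩
  exact h.1

theorem opB_mem_polyClass {n : ℕ} (α β : ℝ) (u : ℂ) {f : Smooth (n + 1)}
    (hf : f ∈ polyClass (Fin.last n)) : opB α β (n + 1) u f ∈ polyClass (Fin.last n) := by
  rw [opB_eq_bForm]
  let S : Submodule ℂ (Smooth (n + 1)) := polyClass (Fin.last n)
  have hS : ∀ (v : ℂ) (a : Fin 2), ∀ g ∈ S.prod S,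
      (siteChain (id : Fin (n + 1) → Fin (n + 1)) 1 v 0 a g.1,
        siteChain (id : Fin (n + 1) → Fin (n + 1)) 1 v 0 a g.2) ∈ S.prod S :=
    fun v a g hg => ⟨siteChain_mem_polyClass v a hg.1, siteChain_mem_polyClass v a hg.2⟩
  exact (bForm_rel (S.prod S) α β u _ _ _ _ (hS u) (hS (-u)) (f, f) ⟨hf, hf⟩).1

theorem one_add_pow_le_exp {δ : ℝ} (hδ : 0 < δ) (N : ℕ) :
    ∃ C : ℝ, ∀ t : ℝ, 0 ≤ t → (1 + t) ^ N ≤ Real.exp (C + δ * t) := by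
  refine ⟨(N.factorial : ℝ) / δ ^ N + δ, fun t ht => ?_⟩
  have h := Real.pow_div_factorial_le_exp (x := δ * (1 + t)) (by positivity) N
  have h1 : (1 + t) ^ N = ((N.factorial : ℝ) / δ ^ N) * ((δ * (1 + t)) ^ N / N.factorial) := by
    rw [mul_pow]; field_simp
  have h2 : (N.factorial : ℝ) / δ ^ N ≤ Real.exp ((N.factorial : ℝ) / δ ^ N) := by
    linarith [Real.add_one_le_exp ((N.factorial : ℝ) / δ ^ N)]
  calc (1 + t) ^ N ≤ Real.exp ((N.factorial : ℝ) / δ ^ N) * Real.exp (δ * (1 + t)) := by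
        rw [h1]; gcongr
    _ = _ := by rw [← Real.exp_add]; ring_nf

/-- A polynomial is below e^{δt} up to a constant for every δ > 0. The freedom in δ is what matters:
it can be taken as small a part of s as the estimates require. -/
theorem PolyGrowth.lastBound {n : ℕ} {f : (Fin (n + 1) → ℝ) → ℂ} (hf : PolyGrowth (Fin.last n) f)
    {δ : ℝ} (hδ : 0 < δ) : ∃ L b : ℝ, 0 ≤ b ∧ ∀ y, ‖f y‖ ≤ LastBound L b δ y := by
  obtain ⟨a, b, N, ha, hb, h⟩ := hf
  obtain ⟨C, hC⟩ := one_add_pow_le_exp hδ N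
  refine ⟨a + |C|, b, hb, fun y => (h y).trans ?_⟩
  have h1 : ∑ i ∈ Finset.univ.erase (Fin.last n), |y i| = ∑ i : Fin n, |y i.castSucc| := by
    have e1 := Finset.sum_erase_add Finset.univ (fun i => |y i|) (Finset.mem_univ (Fin.last n))
    have e2 := Fin.sum_univ_castSucc fun i => |y i|
    linarith
  rw [h1, LastBound]
  have h2 : a ≤ Real.exp a := by linarith [Real.add_one_le_exp a]
  have h3 : (if 0 ≤ y (Fin.last n) then (1 + y (Fin.last n)) ^ N
      else Real.exp (b * |y (Fin.last n)|)) ≤ Real.exp (|C| + δ * max (y (Fin.last n)) 0 +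
        b * max (-y (Fin.last n)) 0) := by
    split_ifs with hy
    · refine (hC _ hy).trans (Real.exp_le_exp.2 ?_)
      rw [max_eq_left hy, max_eq_right (by linarith)]
      linarith [le_abs_self C]
    · push Not at hy
      rw [Real.exp_le_exp, max_eq_right hy.le, max_eq_left (by linarith), abs_of_neg hy]
      linarith [abs_nonneg C]
  have h4 : 0 ≤ (if 0 ≤ y (Fin.last n) then (1 + y (Fin.last n)) ^ N
      else Real.exp (b * |y (Fin.last n)|)) := by
    split_ifs <;> positivity
  calc _ ≤ Real.exp a * Real.exp (b * ∑ i : Fin n, |y i.castSucc|) *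
        Real.exp (|C| + δ * max (y (Fin.last n)) 0 + b * max (-y (Fin.last n)) 0) := by gcongr
    _ = _ := by rw [← Real.exp_add, ← Real.exp_add]; ring_nf


/-! ## The weight of the boundary variable -/

/-- The weight in the variable `z_0`. -/
def wt (α β : ℝ) (lam : ℂ) (t : ℝ) : ℂ :=
  ((1 + β * Real.exp (-t) : ℝ) : ℂ) ^ (-Complex.I * lam - g α β) *
    ((1 - β * Real.exp (-t) : ℝ) : ℂ) ^ (-Complex.I * lam + g α β - 1) *
    (heaviside (t - Real.log β) : ℂ)

theorem measurable_heaviside : Measurable heaviside :=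
  Measurable.ite measurableSet_Ici measurable_const measurable_const

theorem measurable_wt (α β : ℝ) (lam : ℂ) : Measurable (wt α β lam) := by
  unfold wt
  have h1 : Measurable fun t : ℝ => (heaviside (t - Real.log β) : ℂ) :=
    Complex.measurable_ofReal.comp (measurable_heaviside.comp (by fun_prop))
  have h2 : Measurable fun t : ℝ => ((1 + β * Real.exp (-t) : ℝ) : ℂ) := by fun_prop
  have h3 : Measurable fun t : ℝ => ((1 - β * Real.exp (-t) : ℝ) : ℂ) := by fun_prop
  exact ((h2.pow_const _).mul (h3.pow_const _)).mul h1

theorem wt_of_lt {α β : ℝ} {lam : ℂ} {t : ℝ} (ht : t < Real.log β) : wt α β lam t = 0 := by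
  have : ¬ 0 ≤ t - Real.log β := by linarith
  simp [wt, heaviside, this]

theorem mul_exp_neg_lt_one {β t : ℝ} (hβ : 0 < β) (ht : Real.log β < t) :
    β * Real.exp (-t) < 1 := by
  have : β < Real.exp t := by rwa [← Real.log_lt_iff_lt_exp hβ]
  rw [Real.exp_neg, ← div_eq_mul_inv, div_lt_one (Real.exp_pos t)]
  exact this

/-- The first factor has base at least 1 and an exponent with real part Im λ - g ≤ 0, so it can be
dropped. The second factor carries the possible singularity at log β. -/
theorem norm_wt_le {α β : ℝ} {lam : ℂ} (hβ : 0 < β) (hg : 0 < g α β) (hs : 0 ≤ -lam.im) {t : ℝ}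
    (ht : Real.log β < t) :
    ‖wt α β lam t‖ ≤ (1 - β * Real.exp (-t)) ^ (lam.im + g α β - 1) := by
  have h0 := mul_exp_neg_lt_one hβ ht
  have h1 : 0 < β * Real.exp (-t) := by positivity
  have h2 : heaviside (t - Real.log β) = 1 := by simp [heaviside, ht.le]
  rw [wt, h2, norm_mul, norm_mul, Complex.norm_cpow_eq_rpow_re_of_pos (by linarith),
    Complex.norm_cpow_eq_rpow_re_of_pos (by linarith)]
  have e1 : (-Complex.I * lam - (g α β : ℂ)).re = lam.im - g α β := by simp
  have e2 : (-Complex.I * lam + (g α β : ℂ) - 1).re = lam.im + g α β - 1 := by simp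
  rw [e1, e2]
  have h3 : (1 + β * Real.exp (-t)) ^ (lam.im - g α β) ≤ 1 :=
    Real.rpow_le_one_of_one_le_of_nonpos (by linarith) (by linarith)
  have h4 : 0 ≤ (1 - β * Real.exp (-t)) ^ (lam.im + g α β - 1) :=
    Real.rpow_nonneg (by linarith) _
  simpa using mul_le_mul_of_nonneg_right h3 h4

/-- With a = g + Im λ > 0, the function (1 - β e^{-t})^a increases on (log β, ∞) to a finite limit,
so its derivative β a e^{-t} (1 - β e^{-t})^{a-1} is integrable. Up to the constant βa this
dominates the weight times e^{-|t|}. -/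
theorem integrable_wt_mul_exp {α β : ℝ} {lam : ℂ} (hβ : 0 < β) (hg : 0 < g α β)
    (hs : 0 ≤ -lam.im) (hsg : -lam.im < g α β) :
    Integrable fun t : ℝ => ‖wt α β lam t‖ * Real.exp (-|t|) := by
  set a := lam.im + g α β with ha
  have ha0 : 0 < a := by linarith
  have hder : ∀ t ∈ Set.Ioi (Real.log β), HasDerivAt (fun t => (1 - β * Real.exp (-t)) ^ a)
      (β * Real.exp (-t) * a * (1 - β * Real.exp (-t)) ^ (a - 1)) t := by
    intro t ht
    have h0 := mul_exp_neg_lt_one hβ ht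
    have h1 : HasDerivAt (fun t => 1 - β * Real.exp (-t)) (β * Real.exp (-t)) t := by
      have := (((hasDerivAt_neg t).exp).const_mul β).const_sub 1
      simpa using this
    exact h1.rpow_const (Or.inl (by linarith))
  have hcont : ContinuousWithinAt (fun t => (1 - β * Real.exp (-t)) ^ a) (Set.Ici (Real.log β))
      (Real.log β) := by
    refine Continuous.continuousWithinAt ?_
    refine Continuous.rpow_const (by fun_prop) fun _ => Or.inr ha0.le
  have hlim : Tendsto (fun t => (1 - β * Real.exp (-t)) ^ a) atTop (𝓝 1) := by
    have h1 : Tendsto (fun t : ℝ => 1 - β * Real.exp (-t)) atTop (𝓝 (1 - β * 0)) :=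
      (Real.tendsto_exp_neg_atTop_nhds_zero.const_mul β).const_sub 1
    have h2 := h1.rpow_const (p := a) (Or.inl (by norm_num))
    simpa using h2
  have hint := integrableOn_Ioi_deriv_of_nonneg hcont hder (fun t ht => by
    have h0 := mul_exp_neg_lt_one hβ ht
    have : 0 ≤ (1 - β * Real.exp (-t)) ^ (a - 1) := Real.rpow_nonneg (by linarith) _
    positivity) hlim
  have hint2 := hint.const_mul (1 / (β * a))
  have hmeas : Measurable fun t : ℝ => ‖wt α β lam t‖ * Real.exp (-|t|) :=
    (measurable_wt α β lam).norm.mul (by fun_prop)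
  have h3 : IntegrableOn (fun t : ℝ => ‖wt α β lam t‖ * Real.exp (-|t|))
      (Set.Ioi (Real.log β)) := by
    refine hint2.mono' hmeas.aestronglyMeasurable ?_
    refine (ae_restrict_mem measurableSet_Ioi).mono fun t ht => ?_
    rw [Real.norm_of_nonneg (by positivity)]
    have h0 := mul_exp_neg_lt_one hβ ht
    have e : 1 / (β * a) * (β * Real.exp (-t) * a * (1 - β * Real.exp (-t)) ^ (a - 1)) =
        (1 - β * Real.exp (-t)) ^ (a - 1) * Real.exp (-t) := by
      field_simp
    rw [e]
    have := Real.rpow_nonneg (by linarith : 0 ≤ 1 - β * Real.exp (-t)) (a - 1)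
    exact mul_le_mul (norm_wt_le hβ hg hs ht) (Real.exp_le_exp.2 (by linarith [le_abs_self t]))
      (Real.exp_pos _).le this
  have h4 : IntegrableOn (fun t : ℝ => ‖wt α β lam t‖ * Real.exp (-|t|))
      (Set.Iic (Real.log β)) := by
    rw [integrableOn_Iic_iff_integrableOn_Iio]
    refine IntegrableOn.congr_fun integrableOn_zero (fun t ht => ?_) measurableSet_Iio
    simp [wt_of_lt ht]
  have := h4.union h3
  rwa [Set.Iic_union_Ioi, integrableOn_univ] at this

/-! ## Integrability of the kernels -/

/-- The majorant in the variables `z`, without the weight. -/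
def decayZ {n : ℕ} (δ : ℝ) (z : Fin (n + 1) → ℝ) : ℝ :=
  Real.exp (-|z 0| - δ * ∑ j : Fin n, |z j.succ|)

theorem integrable_exp_neg_mul_abs {δ : ℝ} (hδ : 0 < δ) :
    Integrable fun t : ℝ => Real.exp (-δ * |t|) := by
  have h1 : IntegrableOn (fun t : ℝ => Real.exp (-δ * |t|)) (Set.Ioi 0) :=
    (integrableOn_exp_mul_Ioi (by linarith : -δ < 0) 0).congr_fun
      (fun t ht => by simp only [abs_of_pos (Set.mem_Ioi.1 ht)]) measurableSet_Ioi
  have h2 : IntegrableOn (fun t : ℝ => Real.exp (-δ * |t|)) (Set.Iic 0) :=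
    (integrableOn_exp_mul_Iic hδ 0).congr_fun
      (fun t ht => by simp only [abs_of_nonpos (Set.mem_Iic.1 ht)]; ring_nf) measurableSet_Iic
  have := h2.union h1
  rwa [Set.Iic_union_Ioi, integrableOn_univ] at this

theorem integrable_exp_neg_sum {n : ℕ} {δ : ℝ} (hδ : 0 < δ) :
    Integrable fun y : Fin n → ℝ => Real.exp (-δ * ∑ i, |y i|) := by
  have := Integrable.fintype_prod (μ := fun _ : Fin n => (volume : Measure ℝ))
    (f := fun _ : Fin n => fun t : ℝ => Real.exp (-δ * |t|))
    (fun _ => integrable_exp_neg_mul_abs hδ)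
  refine this.congr (Eventually.of_forall fun y => ?_)
  simp only [Finset.mul_sum, Real.exp_sum]

theorem integrable_wt_decayZ {α β : ℝ} {lam : ℂ} (hβ : 0 < β) (hg : 0 < g α β)
    (hs : 0 ≤ -lam.im) (hsg : -lam.im < g α β) {n : ℕ} {δ : ℝ} (hδ : 0 < δ) :
    Integrable fun z : Fin (n + 1) → ℝ => ‖wt α β lam (z 0)‖ * decayZ δ z := by
  have := Integrable.fintype_prod (μ := fun _ : Fin (n + 1) => (volume : Measure ℝ))
    (f := Fin.cons (fun t : ℝ => ‖wt α β lam t‖ * Real.exp (-|t|))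
      (fun _ : Fin n => fun t : ℝ => Real.exp (-δ * |t|)))
    (fun i => Fin.cases (integrable_wt_mul_exp hβ hg hs hsg)
      (fun _ => integrable_exp_neg_mul_abs hδ) i)
  refine this.congr (Eventually.of_forall fun z => ?_)
  simp only [decayZ, Fin.prod_univ_succ, Fin.cons_zero, Fin.cons_succ, sub_eq_add_neg, Real.exp_add,
    neg_mul, Finset.mul_sum, ← Finset.sum_neg_distrib, Real.exp_sum]
  ring

theorem one_le_lastBound {n : ℕ} {b δ : ℝ} (hb : 0 ≤ b) (hδ : 0 ≤ δ) (y : Fin (n + 1) → ℝ) :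
    1 ≤ LastBound 0 b δ y := by
  refine Real.one_le_exp ?_
  have h1 : 0 ≤ ∑ i : Fin n, |y i.castSucc| := Finset.sum_nonneg fun _ _ => abs_nonneg _
  have h2 : 0 ≤ max (y (Fin.last n)) 0 := le_max_right _ _
  have h3 : 0 ≤ max (-y (Fin.last n)) 0 := le_max_right _ _
  positivity

theorem lastBound_eq {n : ℕ} (L b δ : ℝ) (y : Fin (n + 1) → ℝ) :
    LastBound L b δ y = Real.exp L * LastBound 0 b δ y := by
  rw [LastBound, LastBound, ← Real.exp_add]; ring_nf

theorem lastBound_pos {n : ℕ} (L b δ : ℝ) (y : Fin (n + 1) → ℝ) : 0 < LastBound L b δ y :=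
  Real.exp_pos _

theorem lastBound_mono {n : ℕ} {L b b' δ : ℝ} (h : b ≤ b') (y : Fin (n + 1) → ℝ) :
    LastBound L b δ y ≤ LastBound L b' δ y := by
  refine Real.exp_le_exp.2 ?_
  have h1 : 0 ≤ ∑ i : Fin n, |y i.castSucc| := Finset.sum_nonneg fun _ _ => abs_nonneg _
  have h3 : 0 ≤ max (-y (Fin.last n)) 0 := le_max_right _ _
  gcongr

/-- The factor e^{-s z} in the last variable, with s ≥ 3δ, absorbs the admissible growth e^{2δz} and
still leaves e^{-δz}. In the other directions the decay rate can be chosen at will. -/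
theorem norm_mulS_expS_lamS_mul_lastBound_le {n : ℕ} {lam : ℂ} {δ : ℝ} (hδ : 0 ≤ δ)
    (hs : 3 * δ ≤ -lam.im) (ℓ : ℝ) {b : ℝ} (hb : 0 ≤ b)
    {m : Fin (n + 1 + (n + 1 + 1)) → ℝ} (hm : m ∈ jointCone n) :
    ∃ L B : ℝ, 0 ≤ B ∧ ∀ (x : Fin (n + 1) → ℝ) (z : Fin (n + 1 + 1) → ℝ), ℓ ≤ z 0 →
      ‖(mulS (expS m) (lamS (n + 1) lam)).1 (Fin.append x z)‖ * LastBound 0 b (2 * δ) z ≤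
      Real.exp (L + B * ∑ i, |x i|) * decayZ δ z := by
  have hs0 : 0 ≤ -lam.im := by linarith
  set c := -m (Fin.natAdd (n + 1) (Fin.last (n + 1)))
  have hc : 0 ≤ c := by simpa [c] using hm.1
  -- Here b cancels the growth to be absorbed, and 1 and δ are the rates in `decayZ`. The rest is
  -- needed for the last z tending to -∞, where the linear term left by `norm_mulS_expS_lamS_le_z`
  -- grows with rate c + s.
  set A := b + 1 + δ + c + -lam.im with hA
  obtain ⟨L, B, hB, h⟩ := norm_mulS_expS_lamS_le_z hs0 ℓ A (by positivity) m
  refine ⟨L, B, hB, fun x z hz => ?_⟩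
  refine (mul_le_mul_of_nonneg_right (h x z hz) (lastBound_pos _ _ _ _).le).trans ?_
  rw [LastBound, decayZ, ← Real.exp_add, ← Real.exp_add, Real.exp_le_exp]
  set Z := ∑ i : Fin (n + 1), |z i.castSucc| with hZ
  have h0 : |z 0| ≤ Z := Finset.single_le_sum (f := fun i : Fin (n + 1) => |z i.castSucc|)
    (fun _ _ => abs_nonneg _) (Finset.mem_univ 0)
  have h1 : ∑ j : Fin (n + 1), |z j.succ| ≤ Z + |z (Fin.last (n + 1))| := by
    have e1 := Fin.sum_univ_castSucc fun j => |z j|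
    have e2 := Fin.sum_univ_succ fun j => |z j|
    have := abs_nonneg (z 0)
    linarith
  have h1' := mul_le_mul_of_nonneg_left h1 hδ
  have hZ0 : 0 ≤ Z := (abs_nonneg _).trans h0
  set zl := z (Fin.last (n + 1))
  have hmc : m (Fin.natAdd (n + 1) (Fin.last (n + 1))) = -c := by simp [c]
  rw [hmc]
  have h2 : A * Z = b * Z + Z + δ * Z + c * Z + -lam.im * Z := by rw [hA]; ring
  have h3 : 0 ≤ c * Z := by positivity
  have h4 : 0 ≤ -lam.im * Z := by positivity
  have h5 : -A * max (-zl) 0 + (-c + lam.im) * zl + 2 * δ * max zl 0 + b * max (-zl) 0 ≤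
      -δ * |zl| := by
    rcases le_total 0 zl with h | h
    · rw [max_eq_right (by linarith : -zl ≤ 0), max_eq_left h, abs_of_nonneg h]
      have := mul_nonneg hc h
      have := mul_nonneg (by linarith : 0 ≤ -lam.im - 3 * δ) h
      linarith
    · rw [max_eq_left (by linarith : 0 ≤ -zl), max_eq_right h, abs_of_nonpos h, hA]
      have : 0 ≤ -zl := by linarith
      linarith
  linarith

theorem jointSpan_bound_z {n : ℕ} {lam : ℂ} {δ : ℝ} (hδ : 0 ≤ δ)
    (hs : 3 * δ ≤ -lam.im) (ℓ : ℝ) {b : ℝ} (hb : 0 ≤ b)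
    {F : Smooth (n + 1 + (n + 1 + 1))} (hF : F ∈ jointSpan n lam) :
    ∃ C B : ℝ, 0 ≤ C ∧ 0 ≤ B ∧ ∀ (x : Fin (n + 1) → ℝ) (z : Fin (n + 1 + 1) → ℝ), ℓ ≤ z 0 →
      ‖F.1 (Fin.append x z)‖ * LastBound 0 b (2 * δ) z ≤
      C * Real.exp (B * ∑ i, |x i|) * decayZ δ z := by
  induction hF using Submodule.span_induction with
  | mem f h =>
    obtain ⟨m, hm, rfl⟩ := h
    obtain ⟨L, B, hB, h⟩ := norm_mulS_expS_lamS_mul_lastBound_le hδ hs ℓ hb hm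
    refine ⟨Real.exp L, B, (Real.exp_pos _).le, hB, fun x z hz => (h x z hz).trans ?_⟩
    rw [Real.exp_add]
  | zero => exact ⟨0, 0, le_rfl, le_rfl, fun x z _ => by simp⟩
  | add f g _ _ hf hg =>
    obtain ⟨C, B, hC, hB, h⟩ := hf
    obtain ⟨C', B', hC', hB', h'⟩ := hg
    refine ⟨C + C', max B B', by positivity, le_max_of_le_left hB, fun x z hz => ?_⟩
    have h1 := h x z hz
    have h2 := h' x z hz
    have h0 : 0 ≤ ∑ i, |x i| := Finset.sum_nonneg fun _ _ => abs_nonneg _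
    have hd : 0 ≤ decayZ δ z := (Real.exp_pos _).le
    calc _ ≤ (‖f.1 (Fin.append x z)‖ + ‖g.1 (Fin.append x z)‖) * LastBound 0 b (2 * δ) z :=
          mul_le_mul_of_nonneg_right (norm_add_le _ _) (lastBound_pos _ _ _ _).le
      _ ≤ C * Real.exp (B * ∑ i, |x i|) * decayZ δ z +
          C' * Real.exp (B' * ∑ i, |x i|) * decayZ δ z := by linarith
      _ ≤ C * Real.exp (max B B' * ∑ i, |x i|) * decayZ δ z +
          C' * Real.exp (max B B' * ∑ i, |x i|) * decayZ δ z := by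
          gcongr
          · exact le_max_left _ _
          · exact le_max_right _ _
      _ = _ := by ring
  | smul c f _ hf =>
    obtain ⟨C, B, hC, hB, h⟩ := hf
    refine ⟨‖c‖ * C, B, by positivity, hB, fun x z hz => ?_⟩
    have := mul_le_mul_of_nonneg_left (h x z hz) (norm_nonneg c)
    rw [Submodule.coe_smul, Pi.smul_apply, norm_smul]
    linarith

theorem jointSpan_bound_yz {n : ℕ} {lam : ℂ} (hs : 0 ≤ -lam.im) {δ : ℝ} (hδ : 0 ≤ δ)
    {b L₀ : ℝ} (hb : 0 ≤ b) {F : Smooth (n + 1 + (n + 1 + 1))} (hF : F ∈ jointSpan n lam) :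
    ∃ C b' : ℝ, 0 ≤ C ∧ 0 ≤ b' ∧ ∀ (y : Fin (n + 1) → ℝ) (z : Fin (n + 1 + 1) → ℝ),
      ‖F.1 (Fin.append y z)‖ * LastBound L₀ b δ y ≤
      C * LastBound 0 b' (2 * δ) z * Real.exp (-δ * ∑ i, |y i|) := by
  induction hF using Submodule.span_induction with
  | mem f h =>
    obtain ⟨m, hm, rfl⟩ := h
    obtain ⟨L, B, hB, h⟩ := norm_mulS_expS_lamS_mul_le (L₀ := L₀) hs hδ hb hm
    refine ⟨Real.exp L, B, (Real.exp_pos _).le, hB, fun x z => (h x z).trans ?_⟩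
    rw [lastBound_eq]
  | zero => exact ⟨0, 0, le_rfl, le_rfl, fun x z => by simp⟩
  | add f g _ _ hf hg =>
    obtain ⟨C, B, hC, hB, h⟩ := hf
    obtain ⟨C', B', hC', hB', h'⟩ := hg
    refine ⟨C + C', max B B', by positivity, le_max_of_le_left hB, fun x z => ?_⟩
    have h1 := h x z
    have h2 := h' x z
    calc _ ≤ (‖f.1 (Fin.append x z)‖ + ‖g.1 (Fin.append x z)‖) * LastBound L₀ b δ x :=
          mul_le_mul_of_nonneg_right (norm_add_le _ _) (lastBound_pos _ _ _ _).le
      _ ≤ C * LastBound 0 B (2 * δ) z * Real.exp (-δ * ∑ i, |x i|) +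
          C' * LastBound 0 B' (2 * δ) z * Real.exp (-δ * ∑ i, |x i|) := by linarith
      _ ≤ C * LastBound 0 (max B B') (2 * δ) z * Real.exp (-δ * ∑ i, |x i|) +
          C' * LastBound 0 (max B B') (2 * δ) z * Real.exp (-δ * ∑ i, |x i|) := by
          gcongr
          · exact lastBound_mono (le_max_left _ _) z
          · exact lastBound_mono (le_max_right _ _) z
      _ = _ := by ring
  | smul c f _ hf =>
    obtain ⟨C, B, hC, hB, h⟩ := hf
    refine ⟨‖c‖ * C, B, by positivity, hB, fun x z => ?_⟩
    have := mul_le_mul_of_nonneg_left (h x z) (norm_nonneg c)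
    rw [Submodule.coe_smul, Pi.smul_apply, norm_smul]
    linarith

/-- At fixed z the kernel decays in y faster than any exponential, in all directions. No cone of
exponents is needed here, which is why `xSpan` admits all of them. -/
theorem xSpan_bound {n : ℕ} {lam : ℂ} (hs : 0 ≤ -lam.im) {A : ℝ} (hA : 0 ≤ A)
    (z : Fin (n + 1 + 1) → ℝ) {f : Smooth (n + 1)} (hf : f ∈ xSpan lam z) :
    ∃ C : ℝ, 0 ≤ C ∧ ∀ y, ‖f.1 y‖ ≤ C * Real.exp (-A * ∑ i, |y i|) := by
  induction hf using Submodule.span_induction with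
  | mem f h =>
    obtain ⟨m, -, rfl⟩ := h
    obtain ⟨L, h⟩ := norm_mulS_expS_lamS_le_y (n := n + 1) hs A hA (Fin.append m 0) z
    refine ⟨Real.exp L, (Real.exp_pos _).le, fun y => ?_⟩
    have e : mulS (expS m) (sliceLeft z (lamS (n + 1) lam)) =
        sliceLeft z (mulS (expS (Fin.append m 0)) (lamS (n + 1) lam)) := by
      rw [sliceLeft_mulS_expS]; simp
    rw [e, sliceLeft_apply, ← Real.exp_add, neg_mul, ← sub_eq_add_neg]
    exact h y
  | zero => exact ⟨0, le_rfl, fun y => by simp⟩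
  | add f g _ _ hf hg =>
    obtain ⟨C, hC, h⟩ := hf
    obtain ⟨C', hC', h'⟩ := hg
    refine ⟨C + C', by positivity, fun y => (norm_add_le _ _).trans ?_⟩
    rw [add_mul]
    exact add_le_add (h y) (h' y)
  | smul c f _ hf =>
    obtain ⟨C, hC, h⟩ := hf
    refine ⟨‖c‖ * C, by positivity, fun y => ?_⟩
    rw [Submodule.coe_smul, Pi.smul_apply, norm_smul, mul_assoc]
    exact mul_le_mul_of_nonneg_left (h y) (norm_nonneg c)

/-- An exponent m in z lifts to (0, m), for which both cone conditions reduce to the one on the last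
entry. The joint estimates thus apply at fixed x. -/
theorem exists_jointSpan_of_mem_zSpan {n : ℕ} {lam : ℂ} {x : Fin (n + 1) → ℝ}
    {f : Smooth (n + 1 + 1)} (hf : f ∈ zSpan lam x) :
    ∃ F ∈ jointSpan n lam, sliceRight x F = f := by
  induction hf using Submodule.span_induction with
  | mem f h =>
    obtain ⟨m, hm, rfl⟩ := h
    refine ⟨mulS (expS (Fin.append 0 m)) (lamS (n + 1) lam), mulS_expS_mem_expSpan _ _ ?_, ?_⟩
    · rw [mem_jointCone, Fin.append_left, Fin.append_right, Pi.zero_apply, zero_add]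
      exact ⟨hm, hm⟩
    · rw [sliceRight_mulS_expS]; simp
  | zero => exact ⟨0, Submodule.zero_mem _, map_zero _⟩
  | add f g _ _ hf hg =>
    obtain ⟨F, hF, rfl⟩ := hf
    obtain ⟨G, hG, rfl⟩ := hg
    exact ⟨F + G, Submodule.add_mem _ hF hG, map_add _ _ _⟩
  | smul c f _ hf =>
    obtain ⟨F, hF, rfl⟩ := hf
    exact ⟨c • F, Submodule.smul_mem _ _ hF, map_smul _ _ _⟩


/-- The standing assumptions on the parameters. -/
structure Admissible (α β : ℝ) (lam : ℂ) : Prop where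
  pos : 0 < β
  g_pos : 0 < g α β
  im_neg : lam.im < 0
  lt_g : -lam.im < g α β

/-- The decay rate of the kernels. -/
def rate (lam : ℂ) : ℝ := -lam.im / 3

theorem Admissible.rate_pos {α β : ℝ} {lam : ℂ} (h : Admissible α β lam) : 0 < rate lam := by
  have := h.im_neg
  unfold rate; linarith

theorem Admissible.three_rate {α β : ℝ} {lam : ℂ} (_ : Admissible α β lam) :
    3 * rate lam ≤ -lam.im := by
  unfold rate; linarith

theorem Admissible.im_nonneg {α β : ℝ} {lam : ℂ} (h : Admissible α β lam) : 0 ≤ -lam.im := by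
  linarith [h.im_neg]

theorem Admissible.integrable_wt_decayZ {α β : ℝ} {lam : ℂ} (h : Admissible α β lam) {n : ℕ} :
    Integrable fun z : Fin (n + 1) → ℝ => ‖wt α β lam (z 0)‖ * decayZ (rate lam) z :=
  BCToda.integrable_wt_decayZ h.pos h.g_pos h.im_nonneg h.lt_g h.rate_pos

theorem continuous_smooth {n : ℕ} (f : Smooth n) : Continuous f.1 :=
  ContDiff.continuous (n := ∞) f.2

theorem continuous_append {n m : ℕ} :
    Continuous fun p : (Fin n → ℝ) × (Fin m → ℝ) => (Fin.append p.1 p.2 : Fin (n + m) → ℝ) := by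
  refine continuous_pi fun i => ?_
  refine Fin.addCases (fun k => ?_) (fun k => ?_) i
  · simp only [Fin.append_left]; fun_prop
  · simp only [Fin.append_right]; fun_prop

/-! ### Integrability of weighted products of kernel functions. -/

section

variable {α β : ℝ} {lam : ℂ} {n : ℕ}

theorem norm_wt_mul_le {z : Fin (n + 1) → ℝ} {a : ℂ} {b : ℝ}
    (h : Real.log β ≤ z 0 → ‖a‖ ≤ b) : ‖wt α β lam (z 0) * a‖ ≤ ‖wt α β lam (z 0)‖ * b := by
  rw [norm_mul]
  rcases le_or_gt (Real.log β) (z 0) with hz | hz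
  · exact mul_le_mul_of_nonneg_left (h hz) (norm_nonneg _)
  · simp [wt_of_lt hz]

theorem measurable_wt_zero : Measurable fun z : Fin (n + 1) → ℝ => wt α β lam (z 0) :=
  (measurable_wt α β lam).comp (measurable_pi_apply 0)

theorem zSpan_bound (h : Admissible α β lam) {x : Fin (n + 1) → ℝ} {f : Smooth (n + 1 + 1)}
    (hf : f ∈ zSpan lam x) {b : ℝ} (hb : 0 ≤ b) :
    ∃ C : ℝ, 0 ≤ C ∧ ∀ z, Real.log β ≤ z 0 →
      ‖f.1 z‖ * LastBound 0 b (2 * rate lam) z ≤ C * decayZ (rate lam) z := by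
  obtain ⟨F, hF, rfl⟩ := exists_jointSpan_of_mem_zSpan hf
  obtain ⟨C, B, hC, -, hb⟩ := jointSpan_bound_z h.rate_pos.le h.three_rate (Real.log β) hb hF
  exact ⟨C * Real.exp (B * ∑ i, |x i|), by positivity, fun z hz => hb x z hz⟩

theorem zSpan_bounded (h : Admissible α β lam) {x : Fin (n + 1) → ℝ} {f : Smooth (n + 1 + 1)}
    (hf : f ∈ zSpan lam x) : ∃ C : ℝ, 0 ≤ C ∧ ∀ z, Real.log β ≤ z 0 →
      ‖f.1 z‖ ≤ C * decayZ (rate lam) z := by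
  obtain ⟨C, hC, hb⟩ := zSpan_bound h hf le_rfl
  refine ⟨C, hC, fun z hz => le_trans ?_ (hb z hz)⟩
  exact le_mul_of_one_le_right (norm_nonneg _) (one_le_lastBound le_rfl
    (mul_nonneg zero_le_two h.rate_pos.le) z)

theorem decayZ_le_one {δ : ℝ} (hδ : 0 ≤ δ) (z : Fin (n + 1) → ℝ) : decayZ δ z ≤ 1 := by
  rw [decayZ, Real.exp_le_one_iff]
  have h0 := abs_nonneg (z 0)
  have h1 : 0 ≤ δ * ∑ j : Fin n, |z j.succ| :=
    mul_nonneg hδ (Finset.sum_nonneg fun _ _ => abs_nonneg _)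
  linarith

/-- Integrability of the weight times a function of the first kernel times a function of
admissible growth. -/
theorem integrable_wt_mul_growth (h : Admissible α β lam) {x : Fin (n + 1) → ℝ}
    {f : Smooth (n + 1 + 1)} (hf : f ∈ zSpan lam x) {G : (Fin (n + 1 + 1) → ℝ) → ℂ}
    (hG : AEStronglyMeasurable G) {K b : ℝ} (hb : 0 ≤ b)
    (hGb : ∀ z, Real.log β ≤ z 0 → ‖G z‖ ≤ K * LastBound 0 b (2 * rate lam) z) :
    Integrable fun z => wt α β lam (z 0) * (f.1 z * G z) := by
  obtain ⟨C, hC, hfb⟩ := zSpan_bound h hf hb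
  refine Integrable.mono' (h.integrable_wt_decayZ.const_mul (K * C)) ?_ ?_
  · exact measurable_wt_zero.aestronglyMeasurable.mul
      ((continuous_smooth f).aestronglyMeasurable.mul hG)
  · refine Eventually.of_forall fun z => ?_
    have hK : Real.log β ≤ z 0 → 0 ≤ K := fun hz => by
      have := (norm_nonneg _).trans (hGb z hz)
      exact nonneg_of_mul_nonneg_left this (lastBound_pos _ _ _ _)
    refine (norm_wt_mul_le (b := K * C * decayZ (rate lam) z) fun hz => ?_).trans (le_of_eq (by ring))
    rw [norm_mul]
    calc ‖f.1 z‖ * ‖G z‖ ≤ ‖f.1 z‖ * (K * LastBound 0 b (2 * rate lam) z) :=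
          mul_le_mul_of_nonneg_left (hGb z hz) (norm_nonneg _)
      _ = K * (‖f.1 z‖ * LastBound 0 b (2 * rate lam) z) := by ring
      _ ≤ K * (C * decayZ (rate lam) z) := mul_le_mul_of_nonneg_left (hfb z hz) (hK hz)
      _ = _ := by ring

theorem integrable_wt_mul_mul (h : Admissible α β lam) {x y : Fin (n + 1) → ℝ}
    {f f' : Smooth (n + 1 + 1)} (hf : f ∈ zSpan lam x) (hf' : f' ∈ zSpan lam y) :
    Integrable fun z => wt α β lam (z 0) * (f.1 z * f'.1 z) := by
  obtain ⟨K, hK, hb⟩ := zSpan_bounded h hf'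
  refine integrable_wt_mul_growth h hf (continuous_smooth f').aestronglyMeasurable (K := K) le_rfl
    fun z hz => (hb z hz).trans (mul_le_mul_of_nonneg_left ?_ hK)
  exact (decayZ_le_one h.rate_pos.le z).trans
    (one_le_lastBound le_rfl (mul_nonneg zero_le_two h.rate_pos.le) z)

theorem lamS_append {N : ℕ} (lam : ℂ) (x : Fin N → ℝ) (z : Fin (N + 1) → ℝ) :
    (lamS N lam).1 (Fin.append x z) = kerLam lam x z := by
  rw [lamS_apply]
  have hx : coordX (Fin.append x z) = x := by funext i; simp [coordX]
  have hz : coordZ (Fin.append x z) = z := by funext i; simp [coordZ]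
  rw [hx, hz]

/-- The term -2Σz in the exponent is shared equally by the two kernels, so the integrand separates
into an x-part, a y-part and the weight. -/
theorem kernelIntegrand_eq (x y : Fin (n + 1) → ℝ) (z : Fin (n + 1 + 1) → ℝ) :
    kernelIntegrand α β lam x y z = wt α β lam (z 0) *
      ((sliceRight x (lamS (n + 1) lam)).1 z * (sliceRight y (lamS (n + 1) lam)).1 z) := by
  rw [sliceRight_apply, sliceRight_apply, lamS_append, lamS_append]
  rw [kerLam, kerLam, ← Complex.exp_add, kernelIntegrand, wt]
  have e2 : Complex.I * lam * ((∑ i, x i + ∑ i, y i - 2 * ∑ i, z i : ℝ) : ℂ)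
      - ((∑ j : Fin (n + 1), (Real.exp (z j.castSucc - x j) + Real.exp (z j.castSucc - y j)
          + Real.exp (x j - z j.succ) + Real.exp (y j - z j.succ)) : ℝ) : ℂ) =
      Complex.I * lam * ((∑ i, x i - ∑ i, z i : ℝ) : ℂ)
    - ((∑ j : Fin (n + 1), (Real.exp (z j.castSucc - x j) + Real.exp (x j - z j.succ)) : ℝ) : ℂ) +
    (Complex.I * lam * ((∑ i, y i - ∑ i, z i : ℝ) : ℂ)
    - ((∑ j : Fin (n + 1), (Real.exp (z j.castSucc - y j) + Real.exp (y j - z j.succ)) : ℝ) : ℂ)) := by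
    simp only [Finset.sum_add_distrib]
    push_cast
    ring
  rw [e2]
  ring

theorem integrable_kernelIntegrand (h : Admissible α β lam) (x y : Fin (n + 1) → ℝ) :
    Integrable fun z => kernelIntegrand α β lam x y z := by
  simp only [kernelIntegrand_eq]
  exact integrable_wt_mul_mul h (self_mem_expSpan _ _) (self_mem_expSpan _ _)

/-- Bound of `F(y, z) φ(y)`. -/
theorem norm_jointSpan_mul_le (h : Admissible α β lam) {F : Smooth (n + 1 + (n + 1 + 1))}
    (hF : F ∈ jointSpan n lam) {φ : Smooth (n + 1)} (hφ : φ ∈ polyClass (Fin.last n)) :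
    ∃ C b : ℝ, 0 ≤ C ∧ 0 ≤ b ∧ ∀ y z, ‖F.1 (Fin.append y z) * φ.1 y‖ ≤
      C * LastBound 0 b (2 * rate lam) z * Real.exp (-rate lam * ∑ i, |y i|) := by
  obtain ⟨L, b, hb, hφb⟩ := (hφ []).lastBound h.rate_pos
  obtain ⟨C, b', hC, hb', hFb⟩ := jointSpan_bound_yz (L₀ := L) h.im_nonneg h.rate_pos.le hb hF
  refine ⟨C, b', hC, hb', fun y z => ?_⟩
  rw [norm_mul]
  exact (mul_le_mul_of_nonneg_left (hφb y) (norm_nonneg _)).trans (hFb y z)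

theorem continuous_jointSpan_mul (F : Smooth (n + 1 + (n + 1 + 1))) (φ : Smooth (n + 1)) :
    Continuous fun p : (Fin (n + 1 + 1) → ℝ) × (Fin (n + 1) → ℝ) =>
      F.1 (Fin.append p.2 p.1) * φ.1 p.2 :=
  ((continuous_smooth F).comp (continuous_append.comp continuous_swap)).mul
    ((continuous_smooth φ).comp continuous_snd)

/-- The integral of a function of the second kernel against `φ`. -/
def pairInt (F : Smooth (n + 1 + (n + 1 + 1))) (φ : Smooth (n + 1)) (z : Fin (n + 1 + 1) → ℝ) : ℂ :=
  ∫ y : Fin (n + 1) → ℝ, F.1 (Fin.append y z) * φ.1 y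

theorem aestronglyMeasurable_pairInt (F : Smooth (n + 1 + (n + 1 + 1))) (φ : Smooth (n + 1)) :
    AEStronglyMeasurable (pairInt F φ) :=
  ((continuous_jointSpan_mul F φ).stronglyMeasurable.integral_prod_right').aestronglyMeasurable

theorem pairInt_bound (h : Admissible α β lam) {F : Smooth (n + 1 + (n + 1 + 1))}
    (hF : F ∈ jointSpan n lam) {φ : Smooth (n + 1)} (hφ : φ ∈ polyClass (Fin.last n)) :
    ∃ K b : ℝ, 0 ≤ b ∧ ∀ z, ‖pairInt F φ z‖ ≤ K * LastBound 0 b (2 * rate lam) z := by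
  obtain ⟨C, b, hC, hb, hbd⟩ := norm_jointSpan_mul_le h hF hφ
  refine ⟨C * ∫ y : Fin (n + 1) → ℝ, Real.exp (-rate lam * ∑ i, |y i|), b, hb, fun z => ?_⟩
  have h1 := norm_integral_le_of_norm_le ((integrable_exp_neg_sum h.rate_pos).const_mul
    (C * LastBound 0 b (2 * rate lam) z)) (Eventually.of_forall fun y => hbd y z)
  rw [integral_const_mul] at h1
  refine h1.trans (le_of_eq ?_)
  ring

theorem integrable_jointSpan_mul (h : Admissible α β lam) {F : Smooth (n + 1 + (n + 1 + 1))}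
    (hF : F ∈ jointSpan n lam) {φ : Smooth (n + 1)} (hφ : φ ∈ polyClass (Fin.last n))
    (z : Fin (n + 1 + 1) → ℝ) : Integrable fun y => F.1 (Fin.append y z) * φ.1 y := by
  obtain ⟨C, b, hC, hb, hbd⟩ := norm_jointSpan_mul_le h hF hφ
  exact Integrable.mono' ((integrable_exp_neg_sum h.rate_pos).const_mul
    (C * LastBound 0 b (2 * rate lam) z))
    ((continuous_jointSpan_mul F φ).comp (Continuous.prodMk_right z)).aestronglyMeasurable
    (Eventually.of_forall fun y => hbd y z)

/-- Joint integrability, the basis of all exchanges of integrals. -/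
theorem integrable_prod_wt (h : Admissible α β lam) {x : Fin (n + 1) → ℝ}
    {f : Smooth (n + 1 + 1)} (hf : f ∈ zSpan lam x) {F : Smooth (n + 1 + (n + 1 + 1))}
    (hF : F ∈ jointSpan n lam) {φ : Smooth (n + 1)} (hφ : φ ∈ polyClass (Fin.last n)) :
    Integrable (fun p : (Fin (n + 1 + 1) → ℝ) × (Fin (n + 1) → ℝ) =>
      wt α β lam (p.1 0) * (f.1 p.1 * (F.1 (Fin.append p.2 p.1) * φ.1 p.2)))
      (volume.prod volume) := by
  obtain ⟨C, b, hC, hb, hbd⟩ := norm_jointSpan_mul_le h hF hφ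
  obtain ⟨K, hK, hfb⟩ := zSpan_bound h hf hb
  refine Integrable.mono' ((h.integrable_wt_decayZ.const_mul (C * K)).mul_prod
    (integrable_exp_neg_sum h.rate_pos)) ?_ ?_
  · exact (measurable_wt_zero.comp measurable_fst).aestronglyMeasurable.mul
      (((continuous_smooth f).comp continuous_fst).aestronglyMeasurable.mul
        (continuous_jointSpan_mul F φ).aestronglyMeasurable)
  · refine Eventually.of_forall fun p => ?_
    refine (norm_wt_mul_le (b := C * K * decayZ (rate lam) p.1 *
      Real.exp (-rate lam * ∑ i, |p.2 i|)) fun hz => ?_).trans (le_of_eq (by ring))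
    rw [norm_mul]
    calc ‖f.1 p.1‖ * ‖F.1 (Fin.append p.2 p.1) * φ.1 p.2‖
        ≤ ‖f.1 p.1‖ * (C * LastBound 0 b (2 * rate lam) p.1 *
          Real.exp (-rate lam * ∑ i, |p.2 i|)) :=
          mul_le_mul_of_nonneg_left (hbd _ _) (norm_nonneg _)
      _ = C * Real.exp (-rate lam * ∑ i, |p.2 i|) *
          (‖f.1 p.1‖ * LastBound 0 b (2 * rate lam) p.1) := by ring
      _ ≤ C * Real.exp (-rate lam * ∑ i, |p.2 i|) * (K * decayZ (rate lam) p.1) :=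
          mul_le_mul_of_nonneg_left (hfb _ hz) (by positivity)
      _ = _ := by ring

/-- Decay of the functions of the kernel in `y` against functions of admissible growth. -/
theorem integrable_xSpan_mul (h : Admissible α β lam) {z : Fin (n + 1 + 1) → ℝ}
    {f : Smooth (n + 1)} (hf : f ∈ xSpan lam z) {φ : Smooth (n + 1)}
    (hφ : φ ∈ polyClass (Fin.last n)) : Integrable fun y => f.1 y * φ.1 y := by
  obtain ⟨L, b, hb, hφb⟩ := (hφ []).lastBound h.rate_pos
  have hδ := h.rate_pos
  obtain ⟨C, hC, hfb⟩ := xSpan_bound h.im_nonneg (A := b + 2 * rate lam) (by positivity) z hf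
  refine Integrable.mono' ((integrable_exp_neg_sum hδ).const_mul (C * Real.exp L))
    ((continuous_smooth f).mul (continuous_smooth φ)).aestronglyMeasurable
    (Eventually.of_forall fun y => ?_)
  rw [norm_mul]
  have h1 : LastBound L b (rate lam) y ≤ Real.exp (L + (b + rate lam) * ∑ i, |y i|) := by
    refine Real.exp_le_exp.2 ?_
    rw [Fin.sum_univ_castSucc]
    have h1 := max_add_max_neg (y (Fin.last n))
    have h2 : 0 ≤ max (y (Fin.last n)) 0 := le_max_right _ _
    have h3 : 0 ≤ max (-y (Fin.last n)) 0 := le_max_right _ _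
    have h4 : 0 ≤ ∑ i : Fin n, |y i.castSucc| := Finset.sum_nonneg fun _ _ => abs_nonneg _
    rw [← h1]
    have := mul_nonneg hb h2
    have := mul_nonneg hδ.le h3
    have := mul_nonneg hδ.le h4
    linarith
  calc ‖f.1 y‖ * ‖φ.1 y‖ ≤ (C * Real.exp (-(b + 2 * rate lam) * ∑ i, |y i|)) *
        Real.exp (L + (b + rate lam) * ∑ i, |y i|) :=
        mul_le_mul (hfb y) ((hφb y).trans h1) (norm_nonneg _) (by positivity)
    _ = C * Real.exp L * Real.exp (-rate lam * ∑ i, |y i|) := by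
        rw [mul_assoc, mul_assoc, ← Real.exp_add, ← Real.exp_add]; ring_nf

end


/-! ## Separation of the first variable -/

theorem measurePreserving_cons (n : ℕ) :
    MeasurePreserving (fun p : ℝ × (Fin n → ℝ) => (Fin.cons p.1 p.2 : Fin (n + 1) → ℝ))
      (volume.prod volume) volume := by
  have h := (volume_preserving_piFinSuccAbove (fun _ : Fin (n + 1) => ℝ) 0).symm
  convert! h using 1
  funext p
  simp [MeasurableEquiv.piFinSuccAbove, Fin.insertNthEquiv]

theorem measurableEmbedding_cons (n : ℕ) :
    MeasurableEmbedding (fun p : ℝ × (Fin n → ℝ) => (Fin.cons p.1 p.2 : Fin (n + 1) → ℝ)) := by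
  have h := (MeasurableEquiv.piFinSuccAbove (fun _ : Fin (n + 1) => ℝ) 0).symm.measurableEmbedding
  convert! h using 1
  funext p
  simp [MeasurableEquiv.piFinSuccAbove, Fin.insertNthEquiv]

theorem integrable_comp_cons {n : ℕ} {Φ : (Fin (n + 1) → ℝ) → ℂ} (h : Integrable Φ) :
    Integrable (fun p : ℝ × (Fin n → ℝ) => Φ (Fin.cons p.1 p.2)) (volume.prod volume) :=
  ((measurePreserving_cons n).integrable_comp_emb (measurableEmbedding_cons n)).2 h

theorem integral_comp_cons {n : ℕ} (Φ : (Fin (n + 1) → ℝ) → ℂ) :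
    ∫ p : ℝ × (Fin n → ℝ), Φ (Fin.cons p.1 p.2) ∂(volume.prod volume) = ∫ z, Φ z :=
  (measurePreserving_cons n).integral_comp (measurableEmbedding_cons n) Φ

theorem hasDerivAt_cons {n : ℕ} (f : Smooth (n + 1)) (w : Fin n → ℝ) (t : ℝ) :
    HasDerivAt (fun t : ℝ => f.1 (Fin.cons t w)) ((pd 0 f).1 (Fin.cons t w)) t := by
  have h : HasDerivAt (fun t : ℝ => (Fin.cons t w : Fin (n + 1) → ℝ)) (Pi.single 0 (1 : ℝ)) t := by
    rw [hasDerivAt_pi]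
    refine Fin.cases ?_ fun i => ?_
    · simpa using! hasDerivAt_id t
    · simpa [Fin.succ_ne_zero] using hasDerivAt_const t (w i)
  exact (smooth_differentiable f _).hasFDerivAt.comp_hasDerivAt t h

/-! ## The boundary term in the first variable -/

section

variable {α β : ℝ} {lam : ℂ} {n : ℕ}

/-- The function `p = (1 - β² e^{-2t}) wt`, whose derivative is `wtLog * wt`. -/
def wtPrim (α β : ℝ) (lam : ℂ) (t : ℝ) : ℂ :=
  ((1 + β * Real.exp (-t) : ℝ) : ℂ) ^ (-Complex.I * lam - g α β + 1) *
    ((1 - β * Real.exp (-t) : ℝ) : ℂ) ^ (-Complex.I * lam + g α β - 1 + 1)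

/-- The function `wtPrim' / wt`. -/
def wtLog (α β : ℝ) (lam : ℂ) (t : ℝ) : ℂ :=
  2 * α * (Real.exp (-t) : ℂ) +
    (β : ℂ) ^ 2 * (Real.exp (-t) : ℂ) ^ 2 * (1 - 2 * Complex.I * lam)

theorem wt_of_gt {t : ℝ} (ht : Real.log β < t) : wt α β lam t =
    ((1 + β * Real.exp (-t) : ℝ) : ℂ) ^ (-Complex.I * lam - g α β) *
    ((1 - β * Real.exp (-t) : ℝ) : ℂ) ^ (-Complex.I * lam + g α β - 1) := by
  have h2 : heaviside (t - Real.log β) = 1 := by simp [heaviside, ht.le]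
  rw [wt, h2]; simp

theorem wtPrim_eq (hβ : 0 < β) {t : ℝ} (ht : Real.log β < t) : wtPrim α β lam t =
    wt α β lam t * (1 - (β : ℂ) ^ 2 * (Real.exp (-t) : ℂ) ^ 2) := by
  have h0 := mul_exp_neg_lt_one hβ ht
  have h1 : 0 < β * Real.exp (-t) := by positivity
  rw [wtPrim, wt_of_gt ht, Complex.cpow_add _ _ (by exact_mod_cast (by linarith : (0:ℝ) < _).ne'),
    Complex.cpow_add _ _ (by exact_mod_cast (by linarith : (0:ℝ) < _).ne'), Complex.cpow_one,
    Complex.cpow_one]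
  push_cast
  ring

theorem hasDerivAt_ofReal_cpow_add_one {r : ℝ → ℝ} {r' t : ℝ} (h : HasDerivAt r r' t)
    (ht : 0 < r t) (c : ℂ) :
    HasDerivAt (fun t => (r t : ℂ) ^ (c + 1)) ((c + 1) * (r t : ℂ) ^ c * (r' : ℂ)) t := by
  have h1 : HasDerivAt (fun w : ℂ => w ^ (c + 1)) ((c + 1) * (r t : ℂ) ^ c) (r t : ℂ) := by
    simpa using (hasDerivAt_id' (r t : ℂ)).cpow_const (c := c + 1)
      (Complex.ofReal_mem_slitPlane.2 ht)
  exact h1.comp t h.ofReal_comp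

theorem hasDerivAt_wtPrim (hβ : 0 < β) {t : ℝ} (ht : Real.log β < t) :
    HasDerivAt (wtPrim α β lam) (wt α β lam t * wtLog α β lam t) t := by
  have h0 := mul_exp_neg_lt_one hβ ht
  have h1 : 0 < β * Real.exp (-t) := by positivity
  have hp : HasDerivAt (fun t : ℝ => 1 + β * Real.exp (-t)) (-(β * Real.exp (-t))) t := by
    simpa using (((hasDerivAt_neg t).exp).const_mul β).const_add 1
  have hm : HasDerivAt (fun t : ℝ => 1 - β * Real.exp (-t)) (β * Real.exp (-t)) t := by
    simpa using (((hasDerivAt_neg t).exp).const_mul β).const_sub 1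
  have hp0 : 0 < 1 + β * Real.exp (-t) := by linarith
  have hm0 : 0 < 1 - β * Real.exp (-t) := by linarith
  have := (hasDerivAt_ofReal_cpow_add_one hp hp0 (-Complex.I * lam - g α β)).mul
    (hasDerivAt_ofReal_cpow_add_one hm hm0 (-Complex.I * lam + g α β - 1))
  convert! this using 1
  rw [wt_of_gt ht, wtLog, Complex.cpow_add _ _ (Complex.ofReal_ne_zero.2 hp0.ne'),
    Complex.cpow_add _ _ (Complex.ofReal_ne_zero.2 hm0.ne'), Complex.cpow_one, Complex.cpow_one]
  -- The definition of g solved for α. With it the derivatives of the two powers combine into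
  -- `wtLog`, in which g no longer appears.
  have hα : (α : ℂ) = β * (g α β - 1 / 2) := by
    have : (β : ℂ) ≠ 0 := by exact_mod_cast hβ.ne'
    rw [g]; push_cast; field_simp; ring
  generalize ((1 + β * Real.exp (-t) : ℝ) : ℂ) ^ (-Complex.I * lam - g α β) = X
  generalize ((1 - β * Real.exp (-t) : ℝ) : ℂ) ^ (-Complex.I * lam + g α β - 1) = Y
  rw [hα]
  push_cast
  ring

/-- The base 1 - β e^{-t} vanishes and its exponent has real part g + Im λ > 0. This is why the
integration by parts in z_0 leaves no boundary term. -/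
theorem wtPrim_log (hβ : 0 < β) (hsg : -lam.im < g α β) : wtPrim α β lam (Real.log β) = 0 := by
  have e : (1 - β * Real.exp (-Real.log β) : ℝ) = 0 := by
    rw [Real.exp_neg, Real.exp_log hβ, mul_inv_cancel₀ hβ.ne', sub_self]
  rw [wtPrim, e, Complex.ofReal_zero, Complex.zero_cpow, mul_zero]
  intro h
  have := congrArg Complex.re h
  simp at this
  linarith

theorem continuousAt_wtPrim (hβ : 0 < β) (hsg : -lam.im < g α β) :
    ContinuousAt (wtPrim α β lam) (Real.log β) := by
  unfold wtPrim
  refine ContinuousAt.mul ?_ ?_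
  · refine ContinuousAt.comp (f := fun t : ℝ => 1 + β * Real.exp (-t))
      (g := fun r : ℝ => (r : ℂ) ^ (-Complex.I * lam - g α β + 1))
      (Complex.continuousAt_ofReal_cpow_const _ _ (Or.inr ?_)) (by fun_prop)
    have : 0 < β * Real.exp (-Real.log β) := by positivity
    linarith
  · refine ContinuousAt.comp (f := fun t : ℝ => 1 - β * Real.exp (-t))
      (g := fun r : ℝ => (r : ℂ) ^ (-Complex.I * lam + g α β - 1 + 1))
      (Complex.continuousAt_ofReal_cpow_const _ _ (Or.inl ?_)) (by fun_prop)
    simp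
    linarith

theorem tendsto_wtPrim : Tendsto (wtPrim α β lam) atTop (𝓝 1) := by
  have hc : ContinuousAt (fun r : ℝ => ((1 + β * r : ℝ) : ℂ) ^ (-Complex.I * lam - g α β + 1) *
      ((1 - β * r : ℝ) : ℂ) ^ (-Complex.I * lam + g α β - 1 + 1)) 0 := by
    refine ContinuousAt.mul ?_ ?_
    · refine ContinuousAt.comp (f := fun t : ℝ => 1 + β * t)
        (g := fun r : ℝ => (r : ℂ) ^ (-Complex.I * lam - g α β + 1))
        (Complex.continuousAt_ofReal_cpow_const _ _ (Or.inr (by simp))) (by fun_prop)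
    · refine ContinuousAt.comp (f := fun t : ℝ => 1 - β * t)
        (g := fun r : ℝ => (r : ℂ) ^ (-Complex.I * lam + g α β - 1 + 1))
        (Complex.continuousAt_ofReal_cpow_const _ _ (Or.inr (by simp))) (by fun_prop)
  have h : Tendsto (wtPrim α β lam) atTop (𝓝 _) :=
    hc.tendsto.comp Real.tendsto_exp_neg_atTop_nhds_zero
  convert h using 2
  simp

/-- The divergence in the first variable of `wtPrim * f * f'`, divided by the weight. -/
def bdTerm (α β : ℝ) (lam : ℂ) (f f' : Smooth (n + 1 + 1)) (z : Fin (n + 1 + 1) → ℝ) : ℂ :=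
  (1 - (β : ℂ) ^ 2 * (Real.exp (-z 0) : ℂ) ^ 2) *
    ((pd 0 f).1 z * f'.1 z + f.1 z * (pd 0 f').1 z) + wtLog α β lam (z 0) * (f.1 z * f'.1 z)

theorem expMul_zero_mem_zSpan {x : Fin (n + 1) → ℝ} (s : ℝ) {f : Smooth (n + 1 + 1)}
    (hf : f ∈ zSpan lam x) : expMul s 0 f ∈ zSpan lam x :=
  expMul_mem_zSpan s 0 (Or.inr (Fin.last_pos).ne) hf

theorem integrable_bdTerm (h : Admissible α β lam) {x y : Fin (n + 1) → ℝ}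
    {f f' : Smooth (n + 1 + 1)} (hf : f ∈ zSpan lam x) (hf' : f' ∈ zSpan lam y) :
    Integrable fun z => wt α β lam (z 0) * bdTerm α β lam f f' z := by
  have hpf := pd_mem_zSpan 0 hf
  have hpf' := pd_mem_zSpan 0 hf'
  have i1 := integrable_wt_mul_mul h hpf hf'
  have i2 := integrable_wt_mul_mul h hf hpf'
  have i3 := (integrable_wt_mul_mul h (expMul_zero_mem_zSpan (-2) hpf) hf').const_mul (-(β : ℂ) ^ 2)
  have i4 := (integrable_wt_mul_mul h (expMul_zero_mem_zSpan (-2) hf) hpf').const_mul (-(β : ℂ) ^ 2)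
  have i5 := (integrable_wt_mul_mul h (expMul_zero_mem_zSpan (-1) hf) hf').const_mul (2 * α : ℂ)
  have i6 := (integrable_wt_mul_mul h (expMul_zero_mem_zSpan (-2) hf) hf').const_mul
    ((β : ℂ) ^ 2 * (1 - 2 * Complex.I * lam))
  refine (((((i1.add i2).add i3).add i4).add i5).add i6).congr (Eventually.of_forall fun z => ?_)
  have e2 : (Real.exp (-2 * z 0) : ℂ) = (Real.exp (-z 0) : ℂ) ^ 2 := by
    rw [← Complex.ofReal_pow, ← Real.exp_nat_mul]; congr 2; push_cast; ring
  simp only [Pi.add_apply, expMul_apply, e2, bdTerm, wtLog, neg_one_mul]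
  ring

/-- The integrand is the z_0-derivative of `wtPrim` · f · f' on (log β, ∞), so z_0 is integrated
first. The primitive vanishes at log β by `wtPrim_log` and at +∞ by the decay of f in z_0. -/
theorem integral_bdTerm (h : Admissible α β lam) {x y : Fin (n + 1) → ℝ}
    {f f' : Smooth (n + 1 + 1)} (hf : f ∈ zSpan lam x) (hf' : f' ∈ zSpan lam y) :
    ∫ z, wt α β lam (z 0) * bdTerm α β lam f f' z = 0 := by
  have hint := integrable_comp_cons (integrable_bdTerm h hf hf')
  rw [← integral_comp_cons, integral_prod_symm _ hint]
  refine integral_eq_zero_of_ae ?_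
  filter_upwards [hint.prod_left_ae] with w hw
  simp only [Fin.cons_zero] at hw
  simp only [Fin.cons_zero, Pi.zero_apply]
  -- Since `heaviside` is 1 at 0, the weight is not known to vanish at the endpoint itself; that
  -- single point is a null set.
  have hne : ∀ᵐ t : ℝ, t ≠ Real.log β := by simp [ae_iff]
  rw [← setIntegral_eq_integral_of_ae_compl_eq_zero (s := Set.Ioi (Real.log β))]
  swap
  · filter_upwards [hne] with t ht ht'
    rw [wt_of_lt (lt_of_le_of_ne (not_lt.1 ht') ht), zero_mul]
  have hder : ∀ t ∈ Set.Ioi (Real.log β), HasDerivAt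
      (fun t => wtPrim α β lam t * (f.1 (Fin.cons t w) * f'.1 (Fin.cons t w)))
      (wt α β lam t * bdTerm α β lam f f' (Fin.cons t w)) t := by
    intro t ht
    have := (hasDerivAt_wtPrim (α := α) (lam := lam) h.pos ht).mul
      ((hasDerivAt_cons f w t).mul (hasDerivAt_cons f' w t))
    convert! this using 1
    rw [Pi.mul_apply, wtPrim_eq h.pos ht, bdTerm, Fin.cons_zero]
    ring
  have hcont : ContinuousWithinAt
      (fun t => wtPrim α β lam t * (f.1 (Fin.cons t w) * f'.1 (Fin.cons t w)))
      (Set.Ici (Real.log β)) (Real.log β) :=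
    ((continuousAt_wtPrim h.pos h.lt_g).mul ((hasDerivAt_cons f w _).continuousAt.mul
      (hasDerivAt_cons f' w _).continuousAt)).continuousWithinAt
  have hlim : Tendsto (fun t => wtPrim α β lam t * (f.1 (Fin.cons t w) * f'.1 (Fin.cons t w)))
      atTop (𝓝 (1 * 0)) := by
    refine tendsto_wtPrim.mul ?_
    obtain ⟨C, hC, hb⟩ := zSpan_bounded h hf
    obtain ⟨C', hC', hb'⟩ := zSpan_bounded h hf'
    have h1 : Tendsto (fun t : ℝ => C * C' * Real.exp (-t)) atTop (𝓝 0) := by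
      simpa using Real.tendsto_exp_neg_atTop_nhds_zero.const_mul (C * C')
    refine squeeze_zero_norm' ?_ h1
    filter_upwards [eventually_ge_atTop (Real.log β)] with t ht
    have hz : Real.log β ≤ (Fin.cons t w : Fin (n + 1 + 1) → ℝ) 0 := ht
    have h2 := hb _ hz
    have h3 := hb' _ hz
    have h4 : decayZ (rate lam) (Fin.cons t w : Fin (n + 1 + 1) → ℝ) ≤ Real.exp (-t) := by
      refine Real.exp_le_exp.2 ?_
      have : 0 ≤ rate lam * ∑ j : Fin (n + 1), |(Fin.cons t w : Fin (n + 1 + 1) → ℝ) j.succ| :=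
        mul_nonneg h.rate_pos.le (Finset.sum_nonneg fun _ _ => abs_nonneg _)
      have h5 := le_abs_self t
      rw [Fin.cons_zero]
      linarith
    have h6 := decayZ_le_one h.rate_pos.le (Fin.cons t w : Fin (n + 1 + 1) → ℝ)
    rw [norm_mul]
    calc _ ≤ (C * Real.exp (-t)) * (C' * 1) := by
          refine mul_le_mul (h2.trans ?_) (h3.trans ?_) (norm_nonneg _) (by positivity) <;> gcongr
      _ = _ := by ring
  rw [integral_Ioi_of_hasDerivAt_of_tendsto hcont hder hw.integrableOn hlim,
    wtPrim_log h.pos h.lt_g]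
  ring

end


/-! ## Symmetry of the boundary operator -/

section

variable {α β : ℝ} {lam : ℂ} {n : ℕ}

/-- The bilinear pairing of functions of `z`. -/
def pairZ (α β : ℝ) (lam : ℂ) (f f' : Smooth (n + 1 + 1)) : ℂ :=
  ∫ z, wt α β lam (z 0) * (f.1 z * f'.1 z)

theorem pairZ_add_left (h : Admissible α β lam) {x y : Fin (n + 1) → ℝ}
    {f₁ f₂ f' : Smooth (n + 1 + 1)} (h₁ : f₁ ∈ zSpan lam x) (h₂ : f₂ ∈ zSpan lam x)
    (hf' : f' ∈ zSpan lam y) :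
    pairZ α β lam (f₁ + f₂) f' = pairZ α β lam f₁ f' + pairZ α β lam f₂ f' := by
  rw [pairZ, pairZ, pairZ, ← integral_add (integrable_wt_mul_mul h h₁ hf')
    (integrable_wt_mul_mul h h₂ hf')]
  refine integral_congr_ae (Eventually.of_forall fun z => ?_)
  simp only [Submodule.coe_add, Pi.add_apply]
  ring

theorem pairZ_comm (f f' : Smooth (n + 1 + 1)) : pairZ α β lam f f' = pairZ α β lam f' f := by
  simp only [pairZ, mul_comm (f.1 _)]

theorem pairZ_smul_left (c : ℂ) (f f' : Smooth (n + 1 + 1)) :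
    pairZ α β lam (c • f) f' = c * pairZ α β lam f f' := by
  rw [pairZ, pairZ, ← integral_const_mul]
  refine integral_congr_ae (Eventually.of_forall fun z => ?_)
  simp only [Submodule.coe_smul, Pi.smul_apply, smul_eq_mul]
  ring

theorem pairZ_add_right (h : Admissible α β lam) {x y : Fin (n + 1) → ℝ}
    {f f₁ f₂ : Smooth (n + 1 + 1)} (hf : f ∈ zSpan lam x) (h₁ : f₁ ∈ zSpan lam y)
    (h₂ : f₂ ∈ zSpan lam y) :
    pairZ α β lam f (f₁ + f₂) = pairZ α β lam f f₁ + pairZ α β lam f f₂ := by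
  rw [pairZ_comm, pairZ_add_left h h₁ h₂ hf, pairZ_comm f₁, pairZ_comm f₂]

theorem pairZ_smul_right (c : ℂ) (f f' : Smooth (n + 1 + 1)) :
    pairZ α β lam f (c • f') = c * pairZ α β lam f f' := by
  rw [pairZ_comm, pairZ_smul_left, pairZ_comm]

theorem pairZ_expMul (s : ℝ) (j : Fin (n + 1 + 1)) (f f' : Smooth (n + 1 + 1)) :
    pairZ α β lam (expMul s j f) f' = pairZ α β lam f (expMul s j f') := by
  simp only [pairZ, expMul_apply]
  refine integral_congr_ae (Eventually.of_forall fun z => ?_)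
  ring

/-- The weight depends on z_0 only, hence is constant along the other axes and passes through the
integration by parts. -/
theorem pairZ_pd_succ (h : Admissible α β lam) {x y : Fin (n + 1) → ℝ}
    {f f' : Smooth (n + 1 + 1)} (hf : f ∈ zSpan lam x) (hf' : f' ∈ zSpan lam y)
    (j : Fin (n + 1)) : pairZ α β lam (pd j.succ f) f' = -pairZ α β lam f (pd j.succ f') := by
  have key := integral_bilinear_hasLineDerivAt_right_eq_neg_left_of_integrable
    (μ := (volume : Measure (Fin (n + 1 + 1) → ℝ)))
    (f := fun z => wt α β lam (z 0) * f.1 z) (f' := fun z => wt α β lam (z 0) * (pd j.succ f).1 z)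
    (g := f'.1) (g' := (pd j.succ f').1) (v := Pi.single j.succ (1 : ℝ))
    (B := ContinuousLinearMap.mul ℝ ℂ) ?_ ?_ ?_ ?_ ?_
  · simp only [ContinuousLinearMap.mul_apply', mul_assoc] at key
    rw [pairZ, pairZ, key, neg_neg]
  · simpa only [ContinuousLinearMap.mul_apply', mul_assoc] using
      integrable_wt_mul_mul h (pd_mem_zSpan _ hf) hf'
  · simpa only [ContinuousLinearMap.mul_apply', mul_assoc] using
      integrable_wt_mul_mul h hf (pd_mem_zSpan _ hf')
  · simpa only [ContinuousLinearMap.mul_apply', mul_assoc] using integrable_wt_mul_mul h hf hf'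
  · intro z _
    have := HasDerivAt.const_mul (wt α β lam (z 0)) (hasLineDerivAt_pd j.succ f z)
    refine HasDerivAt.congr_of_eventuallyEq this (Eventually.of_forall fun t => ?_)
    simp [(Fin.succ_ne_zero j).symm]
  · intro z _
    exact hasLineDerivAt_pd _ _ _

/-- The second-order operators in the variable `k` of which `zOp` is composed. -/
def bdOp {N : ℕ} (k : Fin N) (α β : ℝ) (lam u : ℂ) (d c : Fin 2) : DiffOp N :=
  (u - Complex.I / 2) • (bdMat k lam (-u) d 0 * bdMat k lam u c 0 +
    (β : ℂ) ^ 2 • (bdMat k lam (-u) d 1 * bdMat k lam u c 1)) +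
  (α : ℂ) • (bdMat k lam (-u) d 1 * bdMat k lam u c 0 - bdMat k lam (-u) d 0 * bdMat k lam u c 1)

theorem bdMat_apply {N : ℕ} (k : Fin N) (lam u : ℂ) (f : Smooth N) :
    bdMat k lam u 0 0 f = u • f - Complex.I • pd k f ∧
    bdMat k lam u 0 1 f = -(Complex.I • expMul (-1) k (lam • f - Complex.I • pd k f)) ∧
    bdMat k lam u 1 0 f = -expMul 1 k f ∧ bdMat k lam u 1 1 f = Complex.I • f := by
  refine ⟨?_, ?_, ?_, ?_⟩ <;> simp [bdMat, Module.algebraMap_end_apply]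

theorem bdMat_mem_zSpan {x : Fin (n + 1) → ℝ} (u : ℂ) (a b : Fin 2) {f : Smooth (n + 1 + 1)}
    (hf : f ∈ zSpan lam x) : bdMat 0 lam u a b f ∈ zSpan lam x := by
  obtain ⟨h1, h2, h3, h4⟩ := bdMat_apply 0 lam u f
  have hd := pd_mem_zSpan 0 hf
  have hs : ∀ c : ℂ, c • f - Complex.I • pd 0 f ∈ zSpan lam x := fun c =>
    Submodule.sub_mem _ (Submodule.smul_mem _ _ hf) (Submodule.smul_mem _ _ hd)
  fin_cases a <;> fin_cases b <;> simp only [Fin.zero_eta, Fin.mk_one]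
  · rw [h1]; exact hs u
  · rw [h2]
    exact Submodule.neg_mem _ (Submodule.smul_mem _ _ (expMul_zero_mem_zSpan _ (hs lam)))
  · rw [h3]; exact Submodule.neg_mem _ (expMul_zero_mem_zSpan _ hf)
  · rw [h4]; exact Submodule.smul_mem _ _ hf

theorem bdOp_mem_zSpan {x : Fin (n + 1) → ℝ} (u : ℂ) (d c : Fin 2) {f : Smooth (n + 1 + 1)}
    (hf : f ∈ zSpan lam x) : bdOp 0 α β lam u d c f ∈ zSpan lam x := by
  have hm : ∀ a b a' b', bdMat 0 lam (-u) a b (bdMat 0 lam u a' b' f) ∈ zSpan lam x :=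
    fun a b a' b' => bdMat_mem_zSpan _ _ _ (bdMat_mem_zSpan _ _ _ hf)
  exact Submodule.add_mem _ (Submodule.smul_mem _ _ (Submodule.add_mem _ (hm _ _ _ _)
    (Submodule.smul_mem _ _ (hm _ _ _ _)))) (Submodule.smul_mem _ _
    (Submodule.sub_mem _ (hm _ _ _ _) (hm _ _ _ _)))

theorem bdOp_apply {N : ℕ} (k : Fin N) (α β : ℝ) (lam u : ℂ) (f : Smooth N) (z : Fin N → ℝ) :
    (bdOp k α β lam u 0 0 f).1 z = (u - Complex.I / 2) *
      (-(pd k (pd k f)).1 z - u ^ 2 * f.1 z - (β : ℂ) ^ 2 * (Real.exp (-z k) : ℂ) ^ 2 *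
        (lam * (lam + Complex.I) * f.1 z - Complex.I * (2 * lam + Complex.I) * (pd k f).1 z
          - (pd k (pd k f)).1 z) -
        2 * Complex.I * α * (Real.exp (-z k) : ℂ) * (lam * f.1 z - Complex.I * (pd k f).1 z)) ∧
    (bdOp k α β lam u 0 1 f).1 z = (u - Complex.I / 2) * (u * (Real.exp (z k) : ℂ) * f.1 z -
        (Real.exp (z k) : ℂ) * (-Complex.I * (pd k f).1 z - Complex.I * f.1 z) +
        (β : ℂ) ^ 2 * (Real.exp (-z k) : ℂ) * (lam * f.1 z - Complex.I * (pd k f).1 z)) +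
      Complex.I * α * (lam + u - Complex.I) * f.1 z ∧
    (bdOp k α β lam u 1 0 f).1 z = (u - Complex.I / 2) * (-u * (Real.exp (z k) : ℂ) * f.1 z +
        (Real.exp (z k) : ℂ) * (Complex.I * (pd k f).1 z) +
        (β : ℂ) ^ 2 * (Real.exp (-z k) : ℂ) * (lam * f.1 z - Complex.I * (pd k f).1 z)) +
      Complex.I * α * (u - lam) * f.1 z ∧
    (bdOp k α β lam u 1 1 f).1 z = (u - Complex.I / 2) *
      ((Real.exp (z k) : ℂ) ^ 2 - (β : ℂ) ^ 2) * f.1 z := by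
  have he : (Real.exp (z k) : ℂ) * (Real.exp (-z k) : ℂ) = 1 := by
    rw [← Complex.ofReal_mul, ← Real.exp_add]; simp
  have hI : Complex.I ^ 2 = -1 := Complex.I_sq
  have hI3 : Complex.I ^ 3 = -Complex.I := by rw [pow_succ, hI]; ring
  have hI4 : Complex.I ^ 4 = 1 := Complex.I_pow_four
  have hI5 : Complex.I ^ 5 = Complex.I := by rw [pow_succ, hI4, one_mul]
  refine ⟨?_, ?_, ?_, ?_⟩ <;>
  simp only [bdOp, LinearMap.add_apply, LinearMap.smul_apply, LinearMap.sub_apply,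
    Module.End.mul_apply, (bdMat_apply _ _ _ _).1, (bdMat_apply _ _ _ _).2.1,
    (bdMat_apply _ _ _ _).2.2.1, (bdMat_apply _ _ _ _).2.2.2, map_neg, map_sub, map_smul,
    Submodule.coe_add, Submodule.coe_sub, Submodule.coe_smul, Submodule.coe_neg, Pi.add_apply,
    Pi.sub_apply, Pi.smul_apply, Pi.neg_apply, smul_eq_mul, expMul_apply, pd_expMul_apply, if_true,
    neg_one_mul, one_mul] <;>
  generalize (Real.exp (z k) : ℂ) = e at * <;>
  generalize (Real.exp (-z k) : ℂ) = e' at * <;>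
  push_cast
  · ring_nf
    simp only [hI, hI3, hI4, hI5]
    ring
  · linear_combination (norm := skip)
      α * Complex.I * (lam * f.1 z - Complex.I * f.1 z - Complex.I * (pd k f).1 z) * he
    ring_nf
    simp only [hI, hI3, hI4]
    ring
  · linear_combination (norm := skip)
      -(α * Complex.I * (lam * f.1 z - Complex.I * (pd k f).1 z)) * he
    ring_nf
    simp only [hI, hI3, hI4]
    ring
  · ring_nf
    simp only [hI, hI3]
    ring

theorem pairZ_bdOp_one_one (u : ℂ) (f f' : Smooth (n + 1 + 1)) :
    pairZ α β lam (bdOp 0 α β lam u 1 1 f) f' = pairZ α β lam f (bdOp 0 α β lam u 1 1 f') := by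
  simp only [pairZ, (bdOp_apply _ _ _ _ _ _ _).2.2.2]
  refine integral_congr_ae (Eventually.of_forall fun z => ?_)
  ring

/-- The difference of the two integrands is -(u - i/2) times the divergence for the pair (∂f, f')
minus the one for (f, ∂f'), where ∂ is the derivative in z_0. Both integrate to zero. -/
theorem pairZ_bdOp_zero_zero (h : Admissible α β lam) {x y : Fin (n + 1) → ℝ}
    {f f' : Smooth (n + 1 + 1)} (hf : f ∈ zSpan lam x) (hf' : f' ∈ zSpan lam y) (u : ℂ) :
    pairZ α β lam (bdOp 0 α β lam u 0 0 f) f' = pairZ α β lam f (bdOp 0 α β lam u 0 0 f') := by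
  rw [← sub_eq_zero, pairZ, pairZ, ← integral_sub
    (integrable_wt_mul_mul h (bdOp_mem_zSpan u 0 0 hf) hf')
    (integrable_wt_mul_mul h hf (bdOp_mem_zSpan u 0 0 hf'))]
  have hd := pd_mem_zSpan 0 hf
  have hd' := pd_mem_zSpan 0 hf'
  have key : ∫ z, -(u - Complex.I / 2) * (wt α β lam (z 0) * bdTerm α β lam (pd 0 f) f' z -
      wt α β lam (z 0) * bdTerm α β lam f (pd 0 f') z) = 0 := by
    rw [integral_const_mul, integral_sub (integrable_bdTerm h hd hf') (integrable_bdTerm h hf hd'),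
      integral_bdTerm h hd hf', integral_bdTerm h hf hd']
    simp
  rw [← key]
  refine integral_congr_ae (Eventually.of_forall fun z => ?_)
  simp only [(bdOp_apply _ _ _ _ _ _ _).1, bdTerm, wtLog]
  ring_nf
  have h3 : Complex.I ^ 3 = -Complex.I := by rw [pow_succ, Complex.I_sq]; ring
  simp only [Complex.I_sq, h3]
  ring

/-- The sum of the two integrands is i(u - i/2) times the divergence for the pair (e^{z_0} f, f').
-/
theorem pairZ_bdOp_zero_one (h : Admissible α β lam) {x y : Fin (n + 1) → ℝ}
    {f f' : Smooth (n + 1 + 1)} (hf : f ∈ zSpan lam x) (hf' : f' ∈ zSpan lam y) (u : ℂ) :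
    pairZ α β lam (bdOp 0 α β lam u 0 1 f) f' = -pairZ α β lam f (bdOp 0 α β lam u 1 0 f') := by
  rw [← sub_eq_zero, sub_neg_eq_add, pairZ, pairZ, ← integral_add
    (integrable_wt_mul_mul h (bdOp_mem_zSpan u 0 1 hf) hf')
    (integrable_wt_mul_mul h hf (bdOp_mem_zSpan u 1 0 hf'))]
  have he := expMul_zero_mem_zSpan 1 hf
  have key : ∫ z, (u - Complex.I / 2) * Complex.I *
      (wt α β lam (z 0) * bdTerm α β lam (expMul 1 0 f) f' z) = 0 := by
    rw [integral_const_mul, integral_bdTerm h he hf', mul_zero]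
  rw [← key]
  refine integral_congr_ae (Eventually.of_forall fun z => ?_)
  have he : (Real.exp (z 0) : ℂ) * (Real.exp (-z 0) : ℂ) = 1 := by
    rw [← Complex.ofReal_mul, ← Real.exp_add]; simp
  have he2 : (Real.exp (z 0) : ℂ) * (Real.exp (-z 0) : ℂ) ^ 2 = (Real.exp (-z 0) : ℂ) := by
    rw [pow_two, ← mul_assoc, he, one_mul]
  simp only [(bdOp_apply _ _ _ _ _ _ _).2.1, (bdOp_apply _ _ _ _ _ _ _).2.2.1, bdTerm, wtLog,
    expMul_apply, pd_expMul_apply, if_true, one_mul]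
  generalize (Real.exp (z 0) : ℂ) = e at *
  generalize (Real.exp (-z 0) : ℂ) = e' at *
  set a := f.1 z
  set b := f'.1 z
  set a' := (pd 0 f).1 z
  set b' := (pd 0 f').1 z
  set v := u - Complex.I / 2 with hv
  have hu : u = v + Complex.I / 2 := by rw [hv]; ring
  rw [hu]
  have h3 : Complex.I ^ 2 = -1 := Complex.I_sq
  push_cast
  linear_combination (norm := skip) (v * Complex.I * wt α β lam (z 0)) *
    (((β : ℂ) ^ 2 * (a * b + a' * b + a * b') - (β : ℂ) ^ 2 * (1 - 2 * Complex.I * lam) * a * b) * he2 -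
      2 * α * a * b * he)
  ring_nf
  simp only [h3]
  ring

/-- The product of signs is 1 for d = c and -1 otherwise. It is written through `chainSign` so that
it cancels against the signs produced by transposing the rows of the chain. -/
theorem pairZ_bdOp (h : Admissible α β lam) {x y : Fin (n + 1) → ℝ}
    {f f' : Smooth (n + 1 + 1)} (hf : f ∈ zSpan lam x) (hf' : f' ∈ zSpan lam y) (u : ℂ)
    (d c : Fin 2) : pairZ α β lam (bdOp 0 α β lam u d c f) f' =
      chainSign (n + 1) d * chainSign (n + 1) c *
        pairZ α β lam f (bdOp 0 α β lam u c d f') := by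
  have hsq : ((-1 : ℂ) ^ (n + 1)) * (-1) ^ (n + 1) = 1 := by rw [← mul_pow]; simp
  fin_cases d <;> fin_cases c <;> simp only [Fin.zero_eta, Fin.mk_one, chainSign, if_true,
    one_ne_zero, if_false]
  · rw [pairZ_bdOp_zero_zero h hf hf']; linear_combination -_ * hsq
  · rw [pairZ_bdOp_zero_one h hf hf']
    linear_combination pairZ α β lam f (bdOp 0 α β lam u 1 0 f') * hsq
  · rw [pairZ_comm f, pairZ_bdOp_zero_one h hf' hf, pairZ_comm f']
    linear_combination -pairZ α β lam (bdOp 0 α β lam u 1 0 f) f' * hsq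
  · rw [pairZ_bdOp_one_one]
    linear_combination -pairZ α β lam f (bdOp 0 α β lam u 1 1 f') * hsq

theorem siteChain_succ_mem_zSpan {x : Fin (n + 1) → ℝ} (u : ℂ) (b : Fin 2)
    {f : Smooth (n + 1 + 1)} (hf : f ∈ zSpan lam x) :
    siteChain (Fin.succ : Fin (n + 1) → Fin (n + 1 + 1)) (-1) u 0 b f ∈ zSpan lam x := by
  let S : Submodule ℂ (Smooth (n + 1 + 1)) := zSpan lam x
  let d : Fin (n + 1) → DiffOp (n + 1 + 1) := fun j => (-1 : ℂ) • (pd j.succ : DiffOp (n + 1 + 1))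
  let em : Fin (n + 1) → DiffOp (n + 1 + 1) := fun j => expMul (-1) j.succ
  let ep : Fin (n + 1) → DiffOp (n + 1 + 1) := fun j => expMul 1 j.succ
  have hne : ∀ j : Fin n, (j.castSucc.succ : Fin (n + 1 + 1)) ≠ Fin.last (n + 1) := fun j => by
    rw [Fin.succ_castSucc]; exact (Fin.castSucc_lt_last _).ne
  have h := chain_rel_zero (S.prod S) d em ep d em ep u
    (fun j g hg => ⟨S.smul_mem _ (pd_mem_zSpan j.succ hg.1),
      S.smul_mem _ (pd_mem_zSpan j.succ hg.2)⟩)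
    (fun j g hg => ⟨expMul_mem_zSpan _ _ (Or.inl (by norm_num)) hg.1,
      expMul_mem_zSpan _ _ (Or.inl (by norm_num)) hg.2⟩)
    (fun j g hg => ⟨expMul_mem_zSpan _ _ (Or.inr (hne j)) hg.1,
      expMul_mem_zSpan _ _ (Or.inr (hne j)) hg.2⟩) b (f, f) ⟨hf, hf⟩
  exact h.1

theorem pairZ_siteChain (h : Admissible α β lam) {x y : Fin (n + 1) → ℝ}
    {f f' : Smooth (n + 1 + 1)} (hf : f ∈ zSpan lam x) (hf' : f' ∈ zSpan lam y) (u : ℂ)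
    (b : Fin 2) :
    pairZ α β lam (siteChain (Fin.succ : Fin (n + 1) → Fin (n + 1 + 1)) (-1) u 0 b f) f' =
      chainSign (n + 1) b * pairZ α β lam f
        (siteChain (Fin.succ : Fin (n + 1) → Fin (n + 1 + 1)) (-1) (-u) 0 b f') := by
  have hne : ∀ j : Fin n, (j.castSucc.succ : Fin (n + 1 + 1)) ≠ Fin.last (n + 1) := fun j => by
    rw [Fin.succ_castSucc]; exact (Fin.castSucc_lt_last _).ne
  let d : Fin (n + 1) → DiffOp (n + 1 + 1) := fun j => (-1 : ℂ) • (pd j.succ : DiffOp (n + 1 + 1))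
  let em : Fin (n + 1) → DiffOp (n + 1 + 1) := fun j => expMul (-1) j.succ
  let ep : Fin (n + 1) → DiffOp (n + 1 + 1) := fun j => expMul 1 j.succ
  exact chain_adjoint_zero (zSpan lam x) (zSpan lam y) (pairZ α β lam)
    (fun f hf f' hf' g hg => pairZ_add_left h hf hf' hg)
    (fun c f _ g _ => pairZ_smul_left c f g)
    (fun f hf g hg g' hg' => pairZ_add_right h hf hg hg')
    (fun c f _ g _ => pairZ_smul_right c f g) d em ep d em ep u
    (fun j f hf => Submodule.smul_mem _ _ (pd_mem_zSpan j.succ hf))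
    (fun j f hf => expMul_mem_zSpan _ _ (Or.inl (by norm_num)) hf)
    (fun j f hf => expMul_mem_zSpan _ _ (Or.inr (hne j)) hf)
    (fun j f hf => Submodule.smul_mem _ _ (pd_mem_zSpan j.succ hf))
    (fun j f hf => expMul_mem_zSpan _ _ (Or.inl (by norm_num)) hf)
    (fun j f hf => expMul_mem_zSpan _ _ (Or.inr (hne j)) hf)
    (fun j f hf g hg => by
      change pairZ α β lam ((-1 : ℂ) • pd j.succ f) g = -pairZ α β lam f ((-1 : ℂ) • pd j.succ g)
      rw [pairZ_smul_left, pairZ_smul_right, pairZ_pd_succ h hf hg]; ring)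
    (fun j f _ g _ => pairZ_expMul _ _ f g) (fun j f _ g _ => pairZ_expMul _ _ f g)
    (site_commute Fin.succ (Fin.succ_injective _) (-1)) b f hf f' hf'

end


/-! ## Continuous families of vectors -/

section

variable {M : Type*} [AddCommGroup M] [Module ℂ M]

/-- Families of vectors of `V` that depend continuously on a parameter after applying any linear
functional of `V`. -/
def WeakCont (V : Submodule ℂ M) (F : ℂ → M) : Prop :=
  ∃ h : ∀ u, F u ∈ V, ∀ l : V →ₗ[ℂ] ℂ, Continuous fun u => l ⟨F u, h u⟩

theorem WeakCont.const {V : Submodule ℂ M} {f : M} (hf : f ∈ V) : WeakCont V fun _ => f :=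
  ⟨fun _ => hf, fun _ => continuous_const⟩

theorem WeakCont.add {V : Submodule ℂ M} {F G : ℂ → M} (hF : WeakCont V F) (hG : WeakCont V G) :
    WeakCont V fun u => F u + G u :=
  ⟨fun u => V.add_mem (hF.1 u) (hG.1 u), fun l =>
    ((hF.2 l).add (hG.2 l)).congr fun u => (map_add l ⟨F u, hF.1 u⟩ ⟨G u, hG.1 u⟩).symm⟩

theorem WeakCont.smul {V : Submodule ℂ M} {F : ℂ → M} (hF : WeakCont V F) {c : ℂ → ℂ}
    (hc : Continuous c) : WeakCont V fun u => c u • F u :=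
  ⟨fun u => V.smul_mem _ (hF.1 u), fun l =>
    (hc.mul (hF.2 l)).congr fun u => (map_smul l (c u) ⟨F u, hF.1 u⟩).symm⟩

/-- A functional composed with T is again a functional on V. No topology on V and no continuity of T
enters. -/
theorem WeakCont.map {V : Submodule ℂ M} {F : ℂ → M} (hF : WeakCont V F) (T : Module.End ℂ M)
    (hT : ∀ f ∈ V, T f ∈ V) : WeakCont V fun u => T (F u) :=
  ⟨fun u => hT _ (hF.1 u), fun l => hF.2 (l ∘ₗ T.restrict hT)⟩

theorem WeakCont.sub {V : Submodule ℂ M} {F G : ℂ → M} (hF : WeakCont V F) (hG : WeakCont V G) :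
    WeakCont V fun u => F u - G u := by
  have := hF.add (hG.smul (continuous_const (y := (-1 : ℂ))))
  simpa [sub_eq_add_neg] using this

theorem WeakCont.chain {V : Submodule ℂ M} {n : ℕ} (d em ep : Fin n → Module.End ℂ M)
    (hd : ∀ j, ∀ f ∈ V, d j f ∈ V) (hm : ∀ j, ∀ f ∈ V, em j f ∈ V) (hp : ∀ j, ∀ f ∈ V, ep j f ∈ V)
    {c : ℂ → ℂ} (hc : Continuous c) {F : ℂ → M} (hF : WeakCont V F) (a b : Fin 2) :
    WeakCont V fun u => BCToda.chain n d em ep (c u) a b (F u) := by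
  induction n generalizing a with
  | zero =>
    by_cases hab : a = b
    · subst hab
      simpa [BCToda.chain] using hF
    · simpa [BCToda.chain, hab, Matrix.one_apply] using WeakCont.const V.zero_mem
  | succ n ih =>
    have IH := ih (fun j => d j.castSucc) (fun j => em j.castSucc) (fun j => ep j.castSucc)
      (fun j => hd _) (fun j => hm _) (fun j => hp _)
    fin_cases a
    · have := (((IH 0).smul hc).add (((IH 0).map _ (hd (Fin.last n))).smul
        (continuous_const (y := Complex.I)))).add ((IH 1).map _ (hm (Fin.last n)))
      simpa [chain_succ_zero, Module.algebraMap_end_apply] using this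
    · have := ((IH 0).map _ (hp (Fin.last n))).smul (continuous_const (y := (-1 : ℂ)))
      simpa [chain_succ_one] using this

theorem WeakCont.chain_zero {V : Submodule ℂ M} {n : ℕ} (d em ep : Fin (n + 1) → Module.End ℂ M)
    (hd : ∀ j, ∀ f ∈ V, d j f ∈ V) (hm : ∀ j, ∀ f ∈ V, em j f ∈ V)
    (hp : ∀ j : Fin n, ∀ f ∈ V, ep j.castSucc f ∈ V)
    {c : ℂ → ℂ} (hc : Continuous c) {F : ℂ → M} (hF : WeakCont V F) (b : Fin 2) :
    WeakCont V fun u => BCToda.chain (n + 1) d em ep (c u) 0 b (F u) := by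
  have IH := fun a => WeakCont.chain (fun j => d j.castSucc) (fun j => em j.castSucc)
    (fun j => ep j.castSucc) (fun j => hd _) (fun j => hm _) hp hc hF a b
  have := (((IH 0).smul hc).add (((IH 0).map _ (hd (Fin.last n))).smul
    (continuous_const (y := Complex.I)))).add ((IH 1).map _ (hm (Fin.last n)))
  simpa [chain_succ_zero, Module.algebraMap_end_apply] using this

theorem bForm_apply (α β : ℝ) (u : ℂ) (r r' : Fin 2 → Module.End ℂ M) (f : M) :
    bForm α β u r r' f = (u - Complex.I / 2) • (r 0 (r' 0 f) + (β : ℂ) ^ 2 • r 1 (r' 1 f)) +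
      (α : ℂ) • (r 0 (r' 1 f) - r 1 (r' 0 f)) := rfl

theorem bForm_map {M' : Type*} [AddCommGroup M'] [Module ℂ M'] (T : M →ₗ[ℂ] M') (α β : ℝ) (u : ℂ)
    (r r' : Fin 2 → Module.End ℂ M) (ρ ρ' : Fin 2 → Module.End ℂ M')
    (h : ∀ a f, ρ a (T f) = T (r a f)) (h' : ∀ a f, ρ' a (T f) = T (r' a f)) (f : M) :
    bForm α β u ρ ρ' (T f) = T (bForm α β u r r' f) := by
  simp only [bForm_apply, map_add, map_sub, map_smul, h, h']

end

section

variable {α β : ℝ} {lam : ℂ} {n : ℕ}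

/-! ## The kernel identity -/

theorem commute_combination {R : Type*} [Ring R] [Algebra ℂ R] {r a b c d : R} (p q v : ℂ)
    (ha : Commute r a) (hb : Commute r b) (hc : Commute r c) (hd : Commute r d) :
    Commute r (p • (a + q • b) + v • (c - d)) :=
  ((ha.add_right (hb.smul_right q)).smul_right p).add_right ((hc.sub_right hd).smul_right v)

theorem commute_bdOp {N : ℕ} (k : Fin N) (u : ℂ) (d c : Fin 2) (r : DiffOp N)
    (h : ∀ v a b, Commute r (bdMat k lam v a b)) : Commute r (bdOp k α β lam u d c) := by
  have hm : ∀ a b a' b', Commute r (bdMat k lam (-u) a b * bdMat k lam u a' b') :=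
    fun a b a' b' => (h (-u) a b).mul_right (h u a' b')
  exact commute_combination (R := DiffOp N) (u - Complex.I / 2) ((β : ℂ) ^ 2) (α : ℂ)
    (hm d 0 c 0) (hm d 1 c 1) (hm d 1 c 0) (hm d 0 c 1)

/-! ### Symmetry of `zOp` and the resulting identity for the kernels. -/

/-- The row of the chain in the variables `z_1, …, z_n`. -/
abbrev zRow (n : ℕ) (u : ℂ) (b : Fin 2) : DiffOp (n + 1 + 1) :=
  siteChain (Fin.succ : Fin (n + 1) → Fin (n + 1 + 1)) (-1) u 0 b

/-- Transposition turns ρ_d(-u) into ρ_d(u) and ρ_c(u) into ρ_c(-u), and exchanges d and c in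
`bdOp`. Each sign occurs twice and cancels. The summand (d, c) of `zOp` thus goes over into the
summand (c, d), so the sum is symmetric although its terms are not. -/
theorem pairZ_term (h : Admissible α β lam) {x y : Fin (n + 1) → ℝ}
    {f f' : Smooth (n + 1 + 1)} (hf : f ∈ zSpan lam x) (hf' : f' ∈ zSpan lam y) (u : ℂ)
    (d c : Fin 2) :
    pairZ α β lam (zRow n (-u) d (zRow n u c (bdOp 0 α β lam u d c f))) f' =
      pairZ α β lam f (zRow n (-u) c (zRow n u d (bdOp 0 α β lam u c d f'))) := by
  have h1 := bdOp_mem_zSpan (α := α) (β := β) u d c hf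
  have h2 := siteChain_succ_mem_zSpan u d hf'
  have hcomm : ∀ v a, Commute (zRow n v a) (bdOp 0 α β lam u c d) := fun v a =>
    commute_bdOp 0 u c d _ fun v' a' b' =>
      siteChain_commute_bdMat Fin.succ 0 (fun i => Fin.succ_ne_zero i) (-1) v lam v' 0 a a' b'
  have e1 : bdOp 0 α β lam u c d (zRow n (-u) c (zRow n u d f')) =
      zRow n (-u) c (zRow n u d (bdOp 0 α β lam u c d f')) := by
    rw [← Module.End.mul_apply, ← (hcomm _ _).eq, Module.End.mul_apply, ← Module.End.mul_apply _ (zRow n u d),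
      ← (hcomm _ _).eq, Module.End.mul_apply]
  rw [pairZ_siteChain h (siteChain_succ_mem_zSpan u c h1) hf', neg_neg, pairZ_siteChain h h1 h2,
    pairZ_bdOp h hf (siteChain_succ_mem_zSpan (-u) c h2), e1]
  have s1 := chainSign_sq (n + 1) d
  have s2 := chainSign_sq (n + 1) c
  linear_combination (pairZ α β lam f (zRow n (-u) c (zRow n u d (bdOp 0 α β lam u c d f')))) *
    (s1 * (chainSign (n + 1) c * chainSign (n + 1) c) + s2)

theorem pairZ_zOp (h : Admissible α β lam) {x y : Fin (n + 1) → ℝ}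
    {f f' : Smooth (n + 1 + 1)} (hf : f ∈ zSpan lam x) (hf' : f' ∈ zSpan lam y) (u : ℂ) :
    pairZ α β lam (zOp (Fin.succ : Fin (n + 1) → Fin (n + 1 + 1)) 0 α β lam u f) f' =
      pairZ α β lam f (zOp (Fin.succ : Fin (n + 1) → Fin (n + 1 + 1)) 0 α β lam u f') := by
  have e : ∀ f, zOp (Fin.succ : Fin (n + 1) → Fin (n + 1 + 1)) 0 α β lam u f =
      (zRow n (-u) 0 (zRow n u 0 (bdOp 0 α β lam u 0 0 f)) +
        zRow n (-u) 0 (zRow n u 1 (bdOp 0 α β lam u 0 1 f))) +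
      (zRow n (-u) 1 (zRow n u 0 (bdOp 0 α β lam u 1 0 f)) +
        zRow n (-u) 1 (zRow n u 1 (bdOp 0 α β lam u 1 1 f))) := by
    intro f
    simp only [zOp, zForm, Fin.sum_univ_two]
    rfl
  have m : ∀ {x : Fin (n + 1) → ℝ} {f : Smooth (n + 1 + 1)}, f ∈ zSpan lam x → ∀ a b d c,
      zRow n (-u) a (zRow n u b (bdOp 0 α β lam u d c f)) ∈ zSpan lam x := fun hf a b d c =>
    siteChain_succ_mem_zSpan _ _ (siteChain_succ_mem_zSpan _ _ (bdOp_mem_zSpan _ _ _ hf))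
  rw [e, e, pairZ_add_left h (Submodule.add_mem _ (m hf _ _ _ _) (m hf _ _ _ _))
      (Submodule.add_mem _ (m hf _ _ _ _) (m hf _ _ _ _)) hf',
    pairZ_add_left h (m hf _ _ _ _) (m hf _ _ _ _) hf',
    pairZ_add_left h (m hf _ _ _ _) (m hf _ _ _ _) hf',
    pairZ_add_right h hf (Submodule.add_mem _ (m hf' _ _ _ _) (m hf' _ _ _ _))
      (Submodule.add_mem _ (m hf' _ _ _ _) (m hf' _ _ _ _)),
    pairZ_add_right h hf (m hf' _ _ _ _) (m hf' _ _ _ _),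
    pairZ_add_right h hf (m hf' _ _ _ _) (m hf' _ _ _ _),
    pairZ_term h hf hf', pairZ_term h hf hf', pairZ_term h hf hf', pairZ_term h hf hf']
  ring

/-- The rows of the Lax chain in the variables `x` of functions of `(x, z)`. -/
abbrev xRow (n : ℕ) (u : ℂ) (b : Fin 2) : DiffOp (n + 1 + (n + 1 + 1)) :=
  siteChain (ixX n) 1 u 0 b

/-- The generating function of the Hamiltonians in the variables `x`, applied to the kernel. -/
def hamLam (n : ℕ) (α β : ℝ) (lam u : ℂ) : Smooth (n + 1 + (n + 1 + 1)) :=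
  bForm α β u (xRow n u) (xRow n (-u)) (lamS (n + 1) lam)

theorem weakCont_xRow {c : ℂ → ℂ} (hc : Continuous c) {F : ℂ → Smooth (n + 1 + (n + 1 + 1))}
    (hF : WeakCont (jointSpan n lam) F) (b : Fin 2) :
    WeakCont (jointSpan n lam) fun u => xRow n (c u) b (F u) := by
  let d : Fin (n + 1) → DiffOp (n + 1 + (n + 1 + 1)) := fun j => (1 : ℂ) • pd (ixX n j)
  let em : Fin (n + 1) → DiffOp (n + 1 + (n + 1 + 1)) := fun j => expMul (-1) (ixX n j)
  let ep : Fin (n + 1) → DiffOp (n + 1 + (n + 1 + 1)) := fun j => expMul 1 (ixX n j)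
  exact WeakCont.chain_zero d em ep
    (fun j f hf => Submodule.smul_mem _ _ (pd_mem_jointSpan _ hf))
    (fun j f hf => expMul_x_mem_jointSpan _ _ (Or.inl (by norm_num)) hf)
    (fun j f hf => expMul_x_mem_jointSpan _ _ (Or.inr (Fin.castSucc_lt_last j).ne) hf) hc hF b

theorem weakCont_hamLam : WeakCont (jointSpan n lam) (hamLam n α β lam) := by
  have h0 : WeakCont (jointSpan n lam) fun _ => lamS (n + 1) lam :=
    WeakCont.const (self_mem_expSpan _ _)
  have hr := fun a b => weakCont_xRow continuous_id
    (weakCont_xRow (continuous_neg (G := ℂ)) h0 b) a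
  exact (((hr 0 0).add ((hr 1 1).smul continuous_const)).smul (by fun_prop)).add
    (((hr 0 1).sub (hr 1 0)).smul continuous_const)

theorem hamLam_mem (u : ℂ) : hamLam n α β lam u ∈ jointSpan n lam := weakCont_hamLam.1 u

theorem sliceRight_hamLam (x : Fin (n + 1) → ℝ) (u : ℂ) :
    ((u - lam) * (-u - lam)) • sliceRight x (hamLam n α β lam u) =
      zOp (Fin.succ : Fin (n + 1) → Fin (n + 1 + 1)) 0 α β lam u
        (sliceRight x (lamS (n + 1) lam)) := by
  rw [sliceRight_zOp, ← map_smul, hamLam, bForm_lamS]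

/-- The kernel function identity: the Hamiltonians acting on the two kernels have the same
integrals. -/
theorem pairZ_hamLam (h : Admissible α β lam) (x y : Fin (n + 1) → ℝ) (u : ℂ) :
    pairZ α β lam (sliceRight x (hamLam n α β lam u)) (sliceRight y (lamS (n + 1) lam)) =
      pairZ α β lam (sliceRight x (lamS (n + 1) lam)) (sliceRight y (hamLam n α β lam u)) := by
  have hx : sliceRight x (lamS (n + 1) lam) ∈ zSpan lam x := self_mem_expSpan _ _
  have hy : sliceRight y (lamS (n + 1) lam) ∈ zSpan lam y := self_mem_expSpan _ _
  -- The difference of the two sides, as a linear functional of the function put in place of 𝔹Λ.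
  -- This is the form in which `WeakCont` gives continuity in u.
  let l : jointSpan n lam →ₗ[ℂ] ℂ :=
    { toFun := fun F => pairZ α β lam (sliceRight x F.1) (sliceRight y (lamS (n + 1) lam)) -
        pairZ α β lam (sliceRight x (lamS (n + 1) lam)) (sliceRight y F.1)
      map_add' := fun F G => by
        rw [Submodule.coe_add, map_add, map_add,
          pairZ_add_left h (sliceRight_mem_zSpan x F.2) (sliceRight_mem_zSpan x G.2) hy,
          pairZ_add_right h hx (sliceRight_mem_zSpan y F.2) (sliceRight_mem_zSpan y G.2)]
        ring
      map_smul' := fun c F => by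
        rw [Submodule.coe_smul, map_smul, map_smul, pairZ_smul_left, pairZ_smul_right,
          RingHom.id_apply, smul_eq_mul]
        ring }
  have hcont : Continuous fun u => l ⟨hamLam n α β lam u, hamLam_mem u⟩ :=
    (weakCont_hamLam (α := α) (β := β)).2 l
  have hzero : ∀ u, (u - lam) * (-u - lam) * l ⟨hamLam n α β lam u, hamLam_mem u⟩ = 0 := by
    intro u
    change (u - lam) * (-u - lam) * (pairZ α β lam _ _ - pairZ α β lam _ _) = 0
    rw [mul_sub, ← pairZ_smul_left, ← pairZ_smul_right, sliceRight_hamLam, sliceRight_hamLam,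
      pairZ_zOp h hx hy, sub_self]
  -- The identity is known after multiplication by (u - λ)(-u - λ). It can be divided out away from
  -- ±λ, and the two exceptional values follow by continuity.
  have hdense : Dense ({lam, -lam} : Set ℂ)ᶜ :=
    (Set.toFinite ({lam, -lam} : Set ℂ)).countable.dense_compl ℝ
  have := Continuous.ext_on hdense hcont continuous_const (g := fun _ => (0 : ℂ)) (by
    intro u hu
    have h1 := hzero u
    simp only [Set.mem_compl_iff, Set.mem_insert_iff, Set.mem_singleton_iff, not_or] at hu
    refine (mul_eq_zero.1 h1).resolve_left (mul_ne_zero (sub_ne_zero.2 hu.1) ?_)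
    intro h2
    exact hu.2 (by linear_combination -h2))
  exact sub_eq_zero.1 (congrFun this u)

end


section

variable {α β : ℝ} {lam : ℂ} {n : ℕ}

/-! ## The adjoint of the Hamiltonians -/

/-- The bilinear pairing of functions of `y`. -/
def pairY {N : ℕ} (f φ : Smooth N) : ℂ := ∫ y, f.1 y * φ.1 y

theorem pairY_smul_left {N : ℕ} (c : ℂ) (f φ : Smooth N) : pairY (c • f) φ = c * pairY f φ := by
  rw [pairY, pairY, ← integral_const_mul]
  refine integral_congr_ae (Eventually.of_forall fun z => ?_)
  simp only [Submodule.coe_smul, Pi.smul_apply, smul_eq_mul]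
  ring

theorem pairY_smul_right {N : ℕ} (c : ℂ) (f φ : Smooth N) : pairY f (c • φ) = c * pairY f φ := by
  rw [pairY, pairY, ← integral_const_mul]
  refine integral_congr_ae (Eventually.of_forall fun z => ?_)
  simp only [Submodule.coe_smul, Pi.smul_apply, smul_eq_mul]
  ring

theorem pairY_expMul {N : ℕ} (s : ℝ) (j : Fin N) (f φ : Smooth N) :
    pairY (expMul s j f) φ = pairY f (expMul s j φ) := by
  simp only [pairY, expMul_apply]
  refine integral_congr_ae (Eventually.of_forall fun z => ?_)
  ring

theorem pairY_add_left (h : Admissible α β lam) {z : Fin (n + 1 + 1) → ℝ}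
    {f₁ f₂ φ : Smooth (n + 1)} (h₁ : f₁ ∈ xSpan lam z) (h₂ : f₂ ∈ xSpan lam z)
    (hφ : φ ∈ polyClass (Fin.last n)) : pairY (f₁ + f₂) φ = pairY f₁ φ + pairY f₂ φ := by
  rw [pairY, pairY, pairY, ← integral_add (integrable_xSpan_mul h h₁ hφ)
    (integrable_xSpan_mul h h₂ hφ)]
  refine integral_congr_ae (Eventually.of_forall fun z => ?_)
  simp only [Submodule.coe_add, Pi.add_apply]
  ring

theorem pairY_add_right (h : Admissible α β lam) {z : Fin (n + 1 + 1) → ℝ}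
    {f φ₁ φ₂ : Smooth (n + 1)} (hf : f ∈ xSpan lam z) (h₁ : φ₁ ∈ polyClass (Fin.last n))
    (h₂ : φ₂ ∈ polyClass (Fin.last n)) : pairY f (φ₁ + φ₂) = pairY f φ₁ + pairY f φ₂ := by
  rw [pairY, pairY, pairY, ← integral_add (integrable_xSpan_mul h hf h₁)
    (integrable_xSpan_mul h hf h₂)]
  refine integral_congr_ae (Eventually.of_forall fun z => ?_)
  simp only [Submodule.coe_add, Pi.add_apply]
  ring

theorem pairY_pd (h : Admissible α β lam) {z : Fin (n + 1 + 1) → ℝ}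
    {f φ : Smooth (n + 1)} (hf : f ∈ xSpan lam z) (hφ : φ ∈ polyClass (Fin.last n))
    (j : Fin (n + 1)) : pairY (pd j f) φ = -pairY f (pd j φ) := by
  have key := integral_bilinear_hasLineDerivAt_right_eq_neg_left_of_integrable
    (μ := (volume : Measure (Fin (n + 1) → ℝ)))
    (f := f.1) (f' := (pd j f).1) (g := φ.1) (g' := (pd j φ).1) (v := Pi.single j (1 : ℝ))
    (B := ContinuousLinearMap.mul ℝ ℂ)
    (integrable_xSpan_mul h (pd_mem_xSpan j hf) hφ)
    (integrable_xSpan_mul h hf (pd_mem_polyClass j hφ)) (integrable_xSpan_mul h hf hφ)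
    (fun y _ => hasLineDerivAt_pd j f y) (fun y _ => hasLineDerivAt_pd j φ y)
  simp only [ContinuousLinearMap.mul_apply'] at key
  rw [pairY, pairY, key, neg_neg]

/-- The row of the Lax chain in `n + 1` variables. -/
abbrev laxRow (n : ℕ) (u : ℂ) (b : Fin 2) : DiffOp (n + 1) :=
  siteChain (id : Fin (n + 1) → Fin (n + 1)) 1 u 0 b

theorem laxRow_mem_xSpan {z : Fin (n + 1 + 1) → ℝ} (u : ℂ) (b : Fin 2) {f : Smooth (n + 1)}
    (hf : f ∈ xSpan lam z) : laxRow n u b f ∈ xSpan lam z := by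
  let S : Submodule ℂ (Smooth (n + 1)) := xSpan lam z
  let d : Fin (n + 1) → DiffOp (n + 1) := fun j => (1 : ℂ) • (pd j : DiffOp (n + 1))
  let em : Fin (n + 1) → DiffOp (n + 1) := fun j => expMul (-1) j
  let ep : Fin (n + 1) → DiffOp (n + 1) := fun j => expMul 1 j
  have h := chain_rel_zero (S.prod S) d em ep d em ep u
    (fun j g hg => ⟨S.smul_mem _ (pd_mem_xSpan j hg.1), S.smul_mem _ (pd_mem_xSpan j hg.2)⟩)
    (fun j g hg => ⟨expMul_mem_xSpan _ _ hg.1, expMul_mem_xSpan _ _ hg.2⟩)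
    (fun j g hg => ⟨expMul_mem_xSpan _ _ hg.1, expMul_mem_xSpan _ _ hg.2⟩) b (f, f) ⟨hf, hf⟩
  exact h.1

theorem pairY_laxRow (h : Admissible α β lam) {z : Fin (n + 1 + 1) → ℝ}
    {f φ : Smooth (n + 1)} (hf : f ∈ xSpan lam z) (hφ : φ ∈ polyClass (Fin.last n)) (u : ℂ)
    (b : Fin 2) :
    pairY (laxRow n u b f) φ = chainSign (n + 1) b * pairY f (laxRow n (-u) b φ) := by
  let d : Fin (n + 1) → DiffOp (n + 1) := fun j => (1 : ℂ) • (pd j : DiffOp (n + 1))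
  let em : Fin (n + 1) → DiffOp (n + 1) := fun j => expMul (-1) j
  let ep : Fin (n + 1) → DiffOp (n + 1) := fun j => expMul 1 j
  exact chain_adjoint_zero (xSpan lam z) (polyClass (Fin.last n)) pairY
    (fun f hf f' hf' g hg => pairY_add_left h hf hf' hg)
    (fun c f _ g _ => pairY_smul_left c f g)
    (fun f hf g hg g' hg' => pairY_add_right h hf hg hg')
    (fun c f _ g _ => pairY_smul_right c f g) d em ep d em ep u
    (fun j f hf => Submodule.smul_mem _ _ (pd_mem_xSpan j hf))
    (fun j f hf => expMul_mem_xSpan _ _ hf)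
    (fun j f hf => expMul_mem_xSpan _ _ hf)
    (fun j f hf => Submodule.smul_mem _ _ (pd_mem_polyClass j hf))
    (fun j f hf => expMul_mem_polyClass (Or.inl (by norm_num)) hf)
    (fun j f hf => expMul_mem_polyClass (Or.inr (Fin.castSucc_lt_last j).ne) hf)
    (fun j f hf g hg => by
      change pairY ((1 : ℂ) • pd j f) g = -pairY f ((1 : ℂ) • pd j g)
      rw [pairY_smul_left, pairY_smul_right, pairY_pd h hf hg]; ring)
    (fun j f _ g _ => pairY_expMul _ _ f g) (fun j f _ g _ => pairY_expMul _ _ f g)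
    (site_commute id Function.injective_id 1) b f hf φ hφ

/-- The transpose of r_a(u) r_b(-u) is r_b(u) r_a(-u), with a minus sign exactly when a ≠ b. The
diagonal terms of `bForm` are therefore symmetric, and so is the α-term, which is antisymmetric in
a, b. -/
theorem pairY_opB (h : Admissible α β lam) {z : Fin (n + 1 + 1) → ℝ}
    {f φ : Smooth (n + 1)} (hf : f ∈ xSpan lam z) (hφ : φ ∈ polyClass (Fin.last n)) (u : ℂ) :
    pairY (opB α β (n + 1) u f) φ = pairY f (opB α β (n + 1) u φ) := by
  have hx : ∀ a b, laxRow n u a (laxRow n (-u) b f) ∈ xSpan lam z := fun a b =>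
    laxRow_mem_xSpan _ _ (laxRow_mem_xSpan _ _ hf)
  have hp : ∀ a b, laxRow n u a (laxRow n (-u) b φ) ∈ polyClass (Fin.last n) := fun a b =>
    siteChain_mem_polyClass _ _ (siteChain_mem_polyClass _ _ hφ)
  have key : ∀ a b, pairY (laxRow n u a (laxRow n (-u) b f)) φ =
      chainSign (n + 1) a * chainSign (n + 1) b * pairY f (laxRow n u b (laxRow n (-u) a φ)) := by
    intro a b
    rw [pairY_laxRow h (laxRow_mem_xSpan _ _ hf) hφ,
      pairY_laxRow h hf (siteChain_mem_polyClass _ _ hφ), neg_neg, mul_assoc]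
  have hsub : ∀ a b : Smooth (n + 1), a - b = a + (-1 : ℂ) • b := fun a b => by
    rw [neg_one_smul ℂ b, sub_eq_add_neg]
  have hsq : ((-1 : ℂ) ^ (n + 1)) * (-1) ^ (n + 1) = 1 := by rw [← mul_pow]; simp
  rw [opB_eq_bForm, bForm_apply, bForm_apply, hsub, hsub,
    pairY_add_left h (Submodule.smul_mem _ _ (Submodule.add_mem _ (hx 0 0)
      (Submodule.smul_mem _ _ (hx 1 1)))) (Submodule.smul_mem _ _ (Submodule.add_mem _ (hx 0 1)
      (Submodule.smul_mem _ _ (hx 1 0)))) hφ,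
    pairY_add_right h hf (Submodule.smul_mem _ _ (Submodule.add_mem _ (hp 0 0)
      (Submodule.smul_mem _ _ (hp 1 1)))) (Submodule.smul_mem _ _ (Submodule.add_mem _ (hp 0 1)
      (Submodule.smul_mem _ _ (hp 1 0)))),
    pairY_smul_left, pairY_smul_left, pairY_smul_right, pairY_smul_right,
    pairY_add_left h (hx 0 0) (Submodule.smul_mem _ _ (hx 1 1)) hφ,
    pairY_add_left h (hx 0 1) (Submodule.smul_mem _ _ (hx 1 0)) hφ,
    pairY_add_right h hf (hp 0 0) (Submodule.smul_mem _ _ (hp 1 1)),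
    pairY_add_right h hf (hp 0 1) (Submodule.smul_mem _ _ (hp 1 0)),
    pairY_smul_left, pairY_smul_left, pairY_smul_right, pairY_smul_right,
    key, key, key, key]
  simp only [chainSign, if_true, one_ne_zero, if_false]
  generalize (-1 : ℂ) ^ (n + 1) = s at hsq
  generalize pairY f (laxRow n u 0 (laxRow n (-u) 0 φ)) = p00
  generalize pairY f (laxRow n u 0 (laxRow n (-u) 1 φ)) = p01
  generalize pairY f (laxRow n u 1 (laxRow n (-u) 0 φ)) = p10
  generalize pairY f (laxRow n u 1 (laxRow n (-u) 1 φ)) = p11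
  linear_combination ((u - Complex.I / 2) * (p00 + β ^ 2 * p11) + α * (p01 - p10)) * hsq

theorem sliceLeft_hamLam (z : Fin (n + 1 + 1) → ℝ) (u : ℂ) :
    sliceLeft z (hamLam n α β lam u) = opB α β (n + 1) u (sliceLeft z (lamS (n + 1) lam)) := by
  rw [opB_eq_bForm, hamLam]
  exact (bForm_map (sliceLeft z) α β u (xRow n u) (xRow n (-u)) (laxRow n u) (laxRow n (-u))
    (fun a f => sliceLeft_siteChain z id 1 u 0 a f)
    (fun a f => sliceLeft_siteChain z id 1 (-u) 0 a f) _).symm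

theorem pairInt_hamLam (h : Admissible α β lam) {φ : Smooth (n + 1)}
    (hφ : φ ∈ polyClass (Fin.last n)) (u : ℂ) :
    pairInt (hamLam n α β lam u) φ = pairInt (lamS (n + 1) lam) (opB α β (n + 1) u φ) := by
  funext z
  change pairY (sliceLeft z (hamLam n α β lam u)) φ =
    pairY (sliceLeft z (lamS (n + 1) lam)) (opB α β (n + 1) u φ)
  rw [sliceLeft_hamLam, pairY_opB h (self_mem_expSpan _ _) hφ]

/-! ## Exchange of the integrals -/

theorem integrable_pairZ_mul (h : Admissible α β lam) {x : Fin (n + 1) → ℝ}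
    {f : Smooth (n + 1 + 1)} (hf : f ∈ zSpan lam x) {F : Smooth (n + 1 + (n + 1 + 1))}
    (hF : F ∈ jointSpan n lam) {φ : Smooth (n + 1)} (hφ : φ ∈ polyClass (Fin.last n)) :
    Integrable fun y => pairZ α β lam f (sliceRight y F) * φ.1 y := by
  refine (integrable_prod_wt h hf hF hφ).integral_prod_right.congr
    (Eventually.of_forall fun y => ?_)
  simp only [pairZ, ← integral_mul_const, sliceRight_apply]
  refine integral_congr_ae (Eventually.of_forall fun z => ?_)
  ring

theorem integral_pairInt (h : Admissible α β lam) {x : Fin (n + 1) → ℝ}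
    {f : Smooth (n + 1 + 1)} (hf : f ∈ zSpan lam x) {F : Smooth (n + 1 + (n + 1 + 1))}
    (hF : F ∈ jointSpan n lam) {φ : Smooth (n + 1)} (hφ : φ ∈ polyClass (Fin.last n)) :
    ∫ z, wt α β lam (z 0) * (f.1 z * pairInt F φ z) =
      ∫ y, pairZ α β lam f (sliceRight y F) * φ.1 y := by
  have h1 := integral_integral_swap (f := fun z y => wt α β lam (z 0) *
    (f.1 z * (F.1 (Fin.append y z) * φ.1 y))) (integrable_prod_wt h hf hF hφ)
  calc _ = ∫ z, ∫ y, wt α β lam (z 0) * (f.1 z * (F.1 (Fin.append y z) * φ.1 y)) := by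
        refine integral_congr_ae (Eventually.of_forall fun z => ?_)
        simp only [integral_const_mul, pairInt]
    _ = _ := by
        rw [h1]
        refine integral_congr_ae (Eventually.of_forall fun y => ?_)
        simp only [pairZ, ← integral_mul_const, sliceRight_apply]
        refine integral_congr_ae (Eventually.of_forall fun z => ?_)
        ring

/-- The Hamiltonians can be moved from the first kernel to the function `φ`. -/
theorem integral_hamLam (h : Admissible α β lam) {φ : Smooth (n + 1)}
    (hφ : φ ∈ polyClass (Fin.last n)) (u : ℂ) (x : Fin (n + 1) → ℝ) :
    ∫ z, wt α β lam (z 0) *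
        ((hamLam n α β lam u).1 (Fin.append x z) * pairInt (lamS (n + 1) lam) φ z) =
      ∫ z, wt α β lam (z 0) * ((lamS (n + 1) lam).1 (Fin.append x z) *
        pairInt (lamS (n + 1) lam) (opB α β (n + 1) u φ) z) := by
  rw [← pairInt_hamLam h hφ]
  have e1 := integral_pairInt h (sliceRight_mem_zSpan x (hamLam_mem (α := α) (β := β) u))
    (self_mem_expSpan (lamS (n + 1) lam) (jointCone n)) hφ
  have e2 := integral_pairInt h
    (sliceRight_mem_zSpan x (self_mem_expSpan (lamS (n + 1) lam) (jointCone n)))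
    (hamLam_mem (α := α) (β := β) u) hφ
  simp only [sliceRight_apply] at e1 e2
  rw [e1, e2]
  simp only [pairZ_hamLam h]

end


section

variable {α β : ℝ} {lam : ℂ} {n : ℕ}

/-! ## Differentiation under the integral -/

/-- Measurable functions of `z` of admissible growth. -/
def GrowthZ (lam : ℂ) (G : (Fin (n + 1 + 1) → ℝ) → ℂ) : Prop :=
  AEStronglyMeasurable G ∧ ∃ K b : ℝ, 0 ≤ b ∧ ∀ z, ‖G z‖ ≤ K * LastBound 0 b (2 * rate lam) z

theorem growthZ_pairInt (h : Admissible α β lam) {F : Smooth (n + 1 + (n + 1 + 1))}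
    (hF : F ∈ jointSpan n lam) {φ : Smooth (n + 1)} (hφ : φ ∈ polyClass (Fin.last n)) :
    GrowthZ lam (pairInt F φ) :=
  ⟨aestronglyMeasurable_pairInt F φ, pairInt_bound h hF hφ⟩

/-- The integral of a function of `(x, z)` against a function of `z`. -/
def intZ (α β : ℝ) (lam : ℂ) (F : Smooth (n + 1 + (n + 1 + 1)))
    (G : (Fin (n + 1 + 1) → ℝ) → ℂ) (x : Fin (n + 1) → ℝ) : ℂ :=
  ∫ z, wt α β lam (z 0) * (F.1 (Fin.append x z) * G z)

/-- The majorant is a product of an exponential in x and one fixed integrable function of z. It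
yields at once convergence, exponential boundedness in x, and domination locally uniform in x. -/
theorem intZ_integrand_bound (h : Admissible α β lam) {F : Smooth (n + 1 + (n + 1 + 1))}
    (hF : F ∈ jointSpan n lam) {G : (Fin (n + 1 + 1) → ℝ) → ℂ} (hG : GrowthZ lam G) :
    ∃ C B : ℝ, 0 ≤ C ∧ 0 ≤ B ∧ ∀ x z, ‖wt α β lam (z 0) * (F.1 (Fin.append x z) * G z)‖ ≤
      C * Real.exp (B * ∑ i, |x i|) * (‖wt α β lam (z 0)‖ * decayZ (rate lam) z) := by
  obtain ⟨-, K, b, hb, hGb⟩ := hG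
  obtain ⟨C, B, hC, hB, hFb⟩ := jointSpan_bound_z h.rate_pos.le h.three_rate (Real.log β) hb hF
  have hK : 0 ≤ K := nonneg_of_mul_nonneg_left ((norm_nonneg _).trans (hGb 0))
    (lastBound_pos _ _ _ _)
  refine ⟨K * C, B, by positivity, hB, fun x z => ?_⟩
  refine (norm_wt_mul_le (b := K * C * Real.exp (B * ∑ i, |x i|) * decayZ (rate lam) z)
    fun hz => ?_).trans (le_of_eq (by ring))
  rw [norm_mul]
  calc _ ≤ ‖F.1 (Fin.append x z)‖ * (K * LastBound 0 b (2 * rate lam) z) :=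
        mul_le_mul_of_nonneg_left (hGb z) (norm_nonneg _)
    _ = K * (‖F.1 (Fin.append x z)‖ * LastBound 0 b (2 * rate lam) z) := by ring
    _ ≤ K * (C * Real.exp (B * ∑ i, |x i|) * decayZ (rate lam) z) :=
        mul_le_mul_of_nonneg_left (hFb x z hz) hK
    _ = _ := by ring

theorem intZ_integrable (h : Admissible α β lam) {F : Smooth (n + 1 + (n + 1 + 1))}
    (hF : F ∈ jointSpan n lam) {G : (Fin (n + 1 + 1) → ℝ) → ℂ} (hG : GrowthZ lam G)
    (x : Fin (n + 1) → ℝ) :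
    Integrable fun z => wt α β lam (z 0) * (F.1 (Fin.append x z) * G z) := by
  obtain ⟨hm, K, b, hb, hGb⟩ := hG
  exact integrable_wt_mul_growth h (sliceRight_mem_zSpan x hF) hm hb fun z _ => hGb z

theorem intZ_bound (h : Admissible α β lam) {F : Smooth (n + 1 + (n + 1 + 1))}
    (hF : F ∈ jointSpan n lam) {G : (Fin (n + 1 + 1) → ℝ) → ℂ} (hG : GrowthZ lam G) :
    ∃ C B : ℝ, 0 ≤ C ∧ 0 ≤ B ∧ ∀ x, ‖intZ α β lam F G x‖ ≤ C * Real.exp (B * ∑ i, |x i|) := by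
  obtain ⟨C, B, hC, hB, hb⟩ := intZ_integrand_bound h hF hG
  refine ⟨C * ∫ z : Fin (n + 1 + 1) → ℝ, ‖wt α β lam (z 0)‖ * decayZ (rate lam) z, B,
    mul_nonneg hC (integral_nonneg fun z => mul_nonneg (norm_nonneg _) (Real.exp_pos _).le), hB,
    fun x => ?_⟩
  have := norm_integral_le_of_norm_le
    (h.integrable_wt_decayZ.const_mul (C * Real.exp (B * ∑ i, |x i|)))
    (Eventually.of_forall fun z => hb x z)
  rw [integral_const_mul] at this
  exact this.trans (le_of_eq (by ring))

/-- The linear form with given values on the basis vectors. -/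
def gradForm {N : ℕ} (c : Fin N → ℂ) : (Fin N → ℝ) →L[ℝ] ℂ :=
  ∑ i, (ContinuousLinearMap.proj i : (Fin N → ℝ) →L[ℝ] ℝ).smulRight (c i)

theorem gradForm_single {N : ℕ} (c : Fin N → ℂ) (j : Fin N) :
    gradForm c (Pi.single j 1) = c j := by
  simp [gradForm, Pi.single_apply]

theorem norm_gradForm_le {N : ℕ} (c : Fin N → ℂ) : ‖gradForm c‖ ≤ ∑ i, ‖c i‖ := by
  refine (norm_sum_le _ _).trans (Finset.sum_le_sum fun i _ => ?_)
  rw [ContinuousLinearMap.norm_smulRight_apply]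
  have : ‖(ContinuousLinearMap.proj i : (Fin N → ℝ) →L[ℝ] ℝ)‖ ≤ 1 :=
    ContinuousLinearMap.opNorm_le_bound _ zero_le_one fun x => by
      rw [one_mul]; exact norm_le_pi_norm x i
  exact mul_le_of_le_one_left (norm_nonneg _) this

theorem hasFDerivAt_gradForm {N : ℕ} (f : Smooth N) (x : Fin N → ℝ) :
    HasFDerivAt f.1 (gradForm fun i => (pd i f).1 x) x := by
  have h := (smooth_differentiable f x).hasFDerivAt
  convert h using 1
  refine ContinuousLinearMap.coe_injective ((Pi.basisFun ℝ (Fin N)).ext fun i => ?_)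
  simp only [Pi.basisFun_apply]
  exact gradForm_single _ i

theorem continuous_gradForm {N : ℕ} : Continuous (gradForm : (Fin N → ℂ) → _) := by
  unfold gradForm
  refine continuous_finsetSum _ fun i _ => ?_
  exact (ContinuousLinearMap.smulRightL ℝ (Fin N → ℝ) ℂ
    (ContinuousLinearMap.proj i : (Fin N → ℝ) →L[ℝ] ℝ)).continuous.comp (continuous_apply i)

theorem integral_gradForm {N : ℕ} {X : Type*} [MeasurableSpace X] {μ : Measure X}
    {c : X → Fin N → ℂ} (hc : ∀ i, Integrable (fun z => c z i) μ) :
    ∫ z, gradForm (c z) ∂μ = gradForm fun i => ∫ z, c z i ∂μ := by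
  unfold gradForm
  have hi : ∀ i, Integrable (fun z => (ContinuousLinearMap.proj i : (Fin N → ℝ) →L[ℝ] ℝ).smulRight
      (c z i)) μ := fun i => (ContinuousLinearMap.smulRightL ℝ (Fin N → ℝ) ℂ
    (ContinuousLinearMap.proj i : (Fin N → ℝ) →L[ℝ] ℝ)).integrable_comp (hc i)
  rw [integral_finsetSum _ fun i _ => hi i]
  refine Finset.sum_congr rfl fun i _ => ?_
  exact (ContinuousLinearMap.smulRightL ℝ (Fin N → ℝ) ℂ
    (ContinuousLinearMap.proj i : (Fin N → ℝ) →L[ℝ] ℝ)).integral_comp_comm (hc i)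

/-- The x-derivatives of F stay in `jointSpan`, so their integrands obey bounds of the same kind,
uniform on the unit ball around x₀, where |x_k| ≤ |x₀_k| + 1. -/
theorem hasFDerivAt_intZ (h : Admissible α β lam) {F : Smooth (n + 1 + (n + 1 + 1))}
    (hF : F ∈ jointSpan n lam) {G : (Fin (n + 1 + 1) → ℝ) → ℂ} (hG : GrowthZ lam G)
    (x₀ : Fin (n + 1) → ℝ) :
    HasFDerivAt (intZ α β lam F G)
      (gradForm fun i => intZ α β lam (pd (Fin.castAdd (n + 1 + 1) i) F) G x₀) x₀ := by
  have hpd := fun i : Fin (n + 1) => pd_mem_jointSpan (Fin.castAdd (n + 1 + 1) i) hF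
  choose C B hC hB hb using fun i => intZ_integrand_bound h (hpd i) hG
  let c : (Fin (n + 1) → ℝ) → (Fin (n + 1 + 1) → ℝ) → Fin (n + 1) → ℂ := fun x z i =>
    wt α β lam (z 0) * ((pd (Fin.castAdd (n + 1 + 1) i) F).1 (Fin.append x z) * G z)
  have hci : ∀ i, Integrable fun z => c x₀ z i := fun i => intZ_integrable h (hpd i) hG x₀
  have key := hasFDerivAt_integral_of_dominated_of_fderiv_le (μ := volume)
    (F := fun x z => wt α β lam (z 0) * (F.1 (Fin.append x z) * G z))
    (F' := fun x z => gradForm (c x z)) (x₀ := x₀) (s := Metric.ball x₀ 1)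
    (bound := fun z => (∑ i, C i * Real.exp (B i * ∑ k, (|x₀ k| + 1))) *
      (‖wt α β lam (z 0)‖ * decayZ (rate lam) z))
    (Metric.ball_mem_nhds x₀ one_pos)
    (Eventually.of_forall fun x => (intZ_integrable h hF hG x).aestronglyMeasurable)
    (intZ_integrable h hF hG x₀)
    (continuous_gradForm.comp_aestronglyMeasurable
      (aemeasurable_pi_lambda _ fun i => (hci i).aemeasurable).aestronglyMeasurable)
    (Eventually.of_forall fun z x hx => ?_)
    (h.integrable_wt_decayZ.const_mul _)
    (Eventually.of_forall fun z x _ => ?_)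
  · rw [integral_gradForm hci] at key
    exact key
  · refine (norm_gradForm_le _).trans ?_
    rw [Finset.sum_mul]
    refine Finset.sum_le_sum fun i _ => (hb i x z).trans ?_
    have hd : 0 ≤ ‖wt α β lam (z 0)‖ * decayZ (rate lam) z :=
      mul_nonneg (norm_nonneg _) (Real.exp_pos _).le
    have hx' : ∀ k, |x k| ≤ |x₀ k| + 1 := fun k => by
      have h1 : |x k - x₀ k| < 1 := by
        have := (dist_le_pi_dist x x₀ k).trans_lt hx
        rwa [Real.dist_eq] at this
      have h2 := abs_add_le (x k - x₀ k) (x₀ k)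
      rw [sub_add_cancel] at h2
      linarith
    have := hC i
    have := hB i
    gcongr with k
    exact hx' k
  · have h1 := hasFDerivAt_gradForm (sliceLeft z F) x
    have h2 := h1.const_mul (wt α β lam (z 0) * G z)
    convert! h2 using 1
    · funext x
      rw [sliceLeft_apply]; ring
    · refine ContinuousLinearMap.coe_injective ((Pi.basisFun ℝ (Fin (n + 1))).ext fun i => ?_)
      simp only [Pi.basisFun_apply, ContinuousLinearMap.coe_coe, smul_apply,
        gradForm_single, c, sliceLeft_pd, sliceLeft_apply, smul_eq_mul]
      ring

theorem contDiff_intZ (h : Admissible α β lam) {F : Smooth (n + 1 + (n + 1 + 1))}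
    (hF : F ∈ jointSpan n lam) {G : (Fin (n + 1 + 1) → ℝ) → ℂ} (hG : GrowthZ lam G) :
    ContDiff ℝ ∞ (intZ α β lam F G) := by
  rw [contDiff_infty]
  intro k
  -- The partial derivatives of the integral are integrals of the same type with F replaced by ∂F,
  -- so F has to vary in the induction on the order.
  induction k generalizing F with
  | zero =>
    rw [Nat.cast_zero, contDiff_zero, continuous_iff_continuousAt]
    exact fun x => (hasFDerivAt_intZ h hF hG x).continuousAt
  | succ k ih =>
    rw [Nat.cast_add, Nat.cast_one, contDiff_succ_iff_hasFDerivAt]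
    refine ⟨_, ?_, hasFDerivAt_intZ h hF hG⟩
    unfold gradForm
    refine ContDiff.sum fun i _ => ?_
    exact (ContinuousLinearMap.smulRightL ℝ (Fin (n + 1) → ℝ) ℂ
      (ContinuousLinearMap.proj i : (Fin (n + 1) → ℝ) →L[ℝ] ℝ)).contDiff.comp
        (ih (pd_mem_jointSpan _ hF))

/-! ### Passing differential operators through the integral over z. -/

/-- The pairs of a function of `(x, z)` and its integral against `G`. -/
def intRel (h : Admissible α β lam) {G : (Fin (n + 1 + 1) → ℝ) → ℂ} (hG : GrowthZ lam G) :
    Submodule ℂ (Smooth (n + 1 + (n + 1 + 1)) × Smooth (n + 1)) where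
  carrier := {p | p.1 ∈ jointSpan n lam ∧ p.2.1 = intZ α β lam p.1 G}
  add_mem' := by
    rintro p q ⟨hp, hp'⟩ ⟨hq, hq'⟩
    refine ⟨Submodule.add_mem _ hp hq, ?_⟩
    funext x
    rw [Prod.snd_add, Submodule.coe_add, Pi.add_apply, hp', hq', intZ, intZ, intZ,
      ← integral_add (intZ_integrable h hp hG x) (intZ_integrable h hq hG x)]
    refine integral_congr_ae (Eventually.of_forall fun z => ?_)
    simp only [Prod.fst_add, Submodule.coe_add, Pi.add_apply]
    ring
  zero_mem' := ⟨Submodule.zero_mem _, by funext x; simp [intZ]⟩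
  smul_mem' := by
    rintro c p ⟨hp, hp'⟩
    refine ⟨Submodule.smul_mem _ _ hp, ?_⟩
    funext x
    rw [Prod.smul_snd, Submodule.coe_smul, Pi.smul_apply, hp', smul_eq_mul, intZ, intZ,
      ← integral_const_mul]
    refine integral_congr_ae (Eventually.of_forall fun z => ?_)
    simp only [Prod.smul_fst, Submodule.coe_smul, Pi.smul_apply, smul_eq_mul]
    ring

variable {h : Admissible α β lam} {G : (Fin (n + 1 + 1) → ℝ) → ℂ} {hG : GrowthZ lam G}

theorem intRel_pd (j : Fin (n + 1)) {p : Smooth (n + 1 + (n + 1 + 1)) × Smooth (n + 1)}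
    (hp : p ∈ intRel h hG) : (pd (ixX n j) p.1, pd j p.2) ∈ intRel h hG := by
  refine ⟨pd_mem_jointSpan _ hp.1, ?_⟩
  funext x
  have h1 := hasFDerivAt_intZ h hp.1 hG x
  rw [← hp.2] at h1
  change fderiv ℝ p.2.1 x (Pi.single j 1) = _
  rw [h1.fderiv, gradForm_single]

theorem intRel_expMul (s : ℝ) (j : Fin (n + 1)) (hs : s ≤ 0 ∨ j ≠ Fin.last n)
    {p : Smooth (n + 1 + (n + 1 + 1)) × Smooth (n + 1)}
    (hp : p ∈ intRel h hG) : (expMul s (ixX n j) p.1, expMul s j p.2) ∈ intRel h hG := by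
  refine ⟨expMul_x_mem_jointSpan s j hs hp.1, ?_⟩
  funext x
  rw [expMul_apply, hp.2, intZ, intZ, ← integral_const_mul]
  refine integral_congr_ae (Eventually.of_forall fun z => ?_)
  simp only [expMul_apply, Fin.append_left]
  ring

theorem intRel_row (u : ℂ) (b : Fin 2) {p : Smooth (n + 1 + (n + 1 + 1)) × Smooth (n + 1)}
    (hp : p ∈ intRel h hG) : (xRow n u b p.1, laxRow n u b p.2) ∈ intRel h hG := by
  let d₁ : Fin (n + 1) → DiffOp (n + 1 + (n + 1 + 1)) := fun j => (1 : ℂ) • pd (ixX n j)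
  let em₁ : Fin (n + 1) → DiffOp (n + 1 + (n + 1 + 1)) := fun j => expMul (-1) (ixX n j)
  let ep₁ : Fin (n + 1) → DiffOp (n + 1 + (n + 1 + 1)) := fun j => expMul 1 (ixX n j)
  let d : Fin (n + 1) → DiffOp (n + 1) := fun j => (1 : ℂ) • (pd j : DiffOp (n + 1))
  let em : Fin (n + 1) → DiffOp (n + 1) := fun j => expMul (-1) j
  let ep : Fin (n + 1) → DiffOp (n + 1) := fun j => expMul 1 j
  exact chain_rel_zero (intRel h hG) d₁ em₁ ep₁ d em ep u
    (fun j p hp => Submodule.smul_mem _ (1 : ℂ) (intRel_pd j hp))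
    (fun j p hp => intRel_expMul _ j (Or.inl (by norm_num)) hp)
    (fun j p hp => intRel_expMul _ _ (Or.inr (Fin.castSucc_lt_last j).ne) hp) b p hp

/-- Every iterated derivative of the integral is again the integral of an element of `jointSpan`, so
`intZ_bound` applies to each of them. -/
theorem intRel_tempered {p : Smooth (n + 1 + (n + 1 + 1)) × Smooth (n + 1)}
    (hp : p ∈ intRel h hG) : p.2 ∈ tempered (n + 1) := by
  intro k
  obtain ⟨F, hF, hF'⟩ := multiPd_induction (p := fun f => ∃ F, (F, f) ∈ intRel h hG)
    (fun i f ⟨F, hF⟩ => ⟨_, intRel_pd i hF⟩) k ⟨p.1, hp⟩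
  obtain ⟨C, B, hC, hB, hb⟩ := intZ_bound h hF hG
  refine ⟨C, B, hC, hB, fun x => ?_⟩
  rw [hF']
  exact hb x

/-- The intertwining property for the integral transform. -/
theorem exists_intertwined (h : Admissible α β lam) {φ : Smooth (n + 1)}
    (hφ : φ ∈ polyClass (Fin.last n)) : ∃ ψ : Smooth (n + 1), ψ ∈ tempered (n + 1) ∧
      ψ.1 = intZ α β lam (lamS (n + 1) lam) (pairInt (lamS (n + 1) lam) φ) ∧
      ∀ u, (opB α β (n + 1) u ψ).1 = intZ α β lam (lamS (n + 1) lam)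
        (pairInt (lamS (n + 1) lam) (opB α β (n + 1) u φ)) := by
  have hL : lamS (n + 1) lam ∈ jointSpan n lam := self_mem_expSpan _ _
  have hG := growthZ_pairInt h hL hφ
  let ψ : Smooth (n + 1) := ⟨_, contDiff_intZ h hL hG⟩
  have hψ : (lamS (n + 1) lam, ψ) ∈ intRel h hG := ⟨hL, rfl⟩
  refine ⟨ψ, intRel_tempered hψ, rfl, fun u => ?_⟩
  have := bForm_rel (intRel h hG) α β u (xRow n u) (xRow n (-u)) (laxRow n u) (laxRow n (-u))
    (fun a p hp => intRel_row u a hp) (fun a p hp => intRel_row (-u) a hp) _ hψ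
  have e : opB α β (n + 1) u ψ = bForm α β u (laxRow n u) (laxRow n (-u)) ψ := by
    rw [opB_eq_bForm]
  rw [e, this.2]
  funext x
  exact integral_hamLam h hφ u x

end


/-! ## Iterated integrals -/

/-- The iterated integral, the first variable being integrated last. -/
def iterInt : (m : ℕ) → ((Fin m → ℝ) → ℂ) → ℂ
  | 0, f => f 0
  | m + 1, f => ∫ t : ℝ, iterInt m fun w => f (Fin.cons t w)

/-- The iterated integral, the last variable being integrated last. -/
def iterIntLast : (m : ℕ) → ((Fin m → ℝ) → ℂ) → ℂ
  | 0, f => f 0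
  | m + 1, f => ∫ t : ℝ, iterIntLast m fun w => f (Fin.snoc w t)

theorem integral_fin_zero (f : (Fin 0 → ℝ) → ℂ) : ∫ z, f z = f 0 := by
  have : (volume : Measure (Fin 0 → ℝ)) = Measure.dirac 0 := by
    rw [volume_pi, Measure.pi_of_empty _ 0]
  rw [this, integral_dirac]

/-- Slices of an integrable function are integrable only for almost every value of the outer
variable. The inner values on the exceptional null set do not affect the outer integral. -/
theorem iterInt_eq_integral {m : ℕ} {f : (Fin m → ℝ) → ℂ} (hf : Integrable f) :
    iterInt m f = ∫ z, f z := by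
  induction m with
  | zero => rw [integral_fin_zero]; rfl
  | succ m ih =>
    have h := integrable_comp_cons hf
    rw [iterInt, ← integral_comp_cons, integral_prod _ h]
    refine integral_congr_ae ?_
    filter_upwards [h.prod_right_ae] with t ht
    exact ih ht

theorem measurePreserving_snoc (n : ℕ) :
    MeasurePreserving (fun p : ℝ × (Fin n → ℝ) => (Fin.snoc p.2 p.1 : Fin (n + 1) → ℝ))
      (volume.prod volume) volume := by
  have h := (volume_preserving_piFinSuccAbove (fun _ : Fin (n + 1) => ℝ) (Fin.last n)).symm
  convert! h using 1
  funext p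
  simp [MeasurableEquiv.piFinSuccAbove, Fin.insertNthEquiv]

theorem measurableEmbedding_snoc (n : ℕ) :
    MeasurableEmbedding (fun p : ℝ × (Fin n → ℝ) => (Fin.snoc p.2 p.1 : Fin (n + 1) → ℝ)) := by
  have h := (MeasurableEquiv.piFinSuccAbove (fun _ : Fin (n + 1) => ℝ)
    (Fin.last n)).symm.measurableEmbedding
  convert! h using 1
  funext p
  simp [MeasurableEquiv.piFinSuccAbove, Fin.insertNthEquiv]

theorem iterIntLast_eq_integral {m : ℕ} {f : (Fin m → ℝ) → ℂ} (hf : Integrable f) :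
    iterIntLast m f = ∫ z, f z := by
  induction m with
  | zero => rw [integral_fin_zero]; rfl
  | succ m ih =>
    have h : Integrable (fun p : ℝ × (Fin m → ℝ) => f (Fin.snoc p.2 p.1)) (volume.prod volume) :=
      ((measurePreserving_snoc m).integrable_comp_emb (measurableEmbedding_snoc m)).2 hf
    have e : ∫ p : ℝ × (Fin m → ℝ), f (Fin.snoc p.2 p.1) ∂(volume.prod volume) = ∫ z, f z :=
      (measurePreserving_snoc m).integral_comp (measurableEmbedding_snoc m) f
    rw [iterIntLast, ← e, integral_prod _ h]
    refine integral_congr_ae ?_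
    filter_upwards [h.prod_right_ae] with t ht
    exact ih ht

theorem iterInt_const_mul {m : ℕ} (c : ℂ) (f : (Fin m → ℝ) → ℂ) :
    iterInt m (fun z => c * f z) = c * iterInt m f := by
  induction m with
  | zero => rfl
  | succ m ih => simp only [iterInt, ih, integral_const_mul]

theorem iterIntLast_const_mul {m : ℕ} (c : ℂ) (f : (Fin m → ℝ) → ℂ) :
    iterIntLast m (fun z => c * f z) = c * iterIntLast m f := by
  induction m with
  | zero => rfl
  | succ m ih => simp only [iterIntLast, ih, integral_const_mul]

/-! ## Products of the integral operators -/

section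

variable {N : ℕ}

/-- Replacement of the coordinates `ι j` of `x` by the `y j`. -/
def replaceAt : (m : ℕ) → (Fin m → Fin N) → (Fin N → ℝ) → (Fin m → ℝ) → Fin N → ℝ
  | 0, _, x, _ => x
  | m + 1, ι, x, y =>
    replaceAt m (fun j => ι j.succ) (Function.update x (ι 0) (y 0)) fun j => y j.succ

theorem replaceAt_of_ne {m : ℕ} (ι : Fin m → Fin N) (x : Fin N → ℝ) (y : Fin m → ℝ) (i : Fin N)
    (hi : ∀ j, ι j ≠ i) : replaceAt m ι x y i = x i := by
  induction m generalizing x with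
  | zero => rfl
  | succ m ih =>
    rw [replaceAt, ih _ _ _ fun j => hi _, Function.update_of_ne (hi 0).symm]

theorem replaceAt_apply {m : ℕ} (ι : Fin m → Fin N) (hι : Function.Injective ι) (x : Fin N → ℝ)
    (y : Fin m → ℝ) (j : Fin m) : replaceAt m ι x y (ι j) = y j := by
  induction m generalizing x with
  | zero => exact j.elim0
  | succ m ih =>
    rw [replaceAt]
    refine Fin.cases ?_ (fun j => ?_) j
    · rw [replaceAt_of_ne _ _ _ _ fun j h => Fin.succ_ne_zero j (hι h), Function.update_self]
    · exact ih (fun j => ι j.succ) (hι.comp (Fin.succ_injective _)) _ _ j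

theorem replaceAt_id (x y : Fin N → ℝ) : replaceAt N id x y = y :=
  funext fun j => replaceAt_apply id Function.injective_id x y j

/-- Replacements at distinct coordinates do not interfere, so the last may be made first. The
product of the 𝓡 operators needs this order. -/
theorem replaceAt_snoc {m : ℕ} (ι : Fin (m + 1) → Fin N) (x : Fin N → ℝ) (y : Fin (m + 1) → ℝ)
    (hι : Function.Injective ι) : replaceAt (m + 1) ι x y =
      replaceAt m (fun j => ι j.castSucc) (Function.update x (ι (Fin.last m)) (y (Fin.last m)))
        fun j => y j.castSucc := by
  funext i
  by_cases hi : ∃ j, ι j = i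
  · obtain ⟨j, rfl⟩ := hi
    rw [replaceAt_apply ι hι]
    refine Fin.lastCases ?_ (fun j => ?_) j
    · rw [replaceAt_of_ne _ _ _ _ fun j h => (Fin.castSucc_lt_last j).ne (hι h),
        Function.update_self]
    · exact (replaceAt_apply (fun j => ι j.castSucc) (hι.comp (Fin.castSucc_injective _)) _
        (fun j => y j.castSucc) j).symm
  · push Not at hi
    rw [replaceAt_of_ne _ _ _ _ hi, replaceAt_of_ne _ _ _ _ fun j => hi _,
      Function.update_of_ne (hi _).symm]

/-- The kernel of the product of the reflected operators. -/
def starKer {m : ℕ} (v : ℂ) (y : Fin m → ℝ) (z : Fin (m + 1) → ℝ) : ℂ :=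
  Complex.exp (∑ j : Fin m, (Complex.I * v * ((y j : ℂ) - (z j.succ : ℂ)) -
    (Real.exp (z j.castSucc - y j) : ℂ) - (Real.exp (y j - z j.succ) : ℂ)))

/-- The substitution y ↦ -y undoes the reflections. The auxiliary argument is written -t because 𝓚
evaluates there; the next factor then receives -x_j, again of this form. -/
theorem opRstar_apply (v : ℂ) (j : Fin N) (Φ : AuxFun N) (x : Fin N → ℝ) (t : ℝ) :
    opRstar v j Φ x (-t) = ∫ y : ℝ, Complex.exp (Complex.I * v * ((y : ℂ) - (x j : ℂ)) -
      (Real.exp (t - y) : ℂ) - (Real.exp (y - x j) : ℂ)) *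
        Φ (Function.update x j y) (-x j) := by
  change ∫ y : ℝ, _ = _
  rw [← integral_neg_eq_self]
  refine integral_congr_ae (Eventually.of_forall fun y => ?_)
  simp only [reflect, Function.update_self, Function.update_idem, neg_neg]
  congr 2
  have e1 : -x j - -y = y - x j := by ring
  have e2 : -y - -t = t - y := by ring
  rw [e1, e2]
  push_cast
  ring

/-- The leftmost operator gives the outermost integral, over the first variable, and hands its old x
to the next operator as auxiliary argument. The remaining variables are shifted by one, hence the
general index map ι. -/
theorem opRstar_prod_apply (v : ℂ) (Φ : AuxFun N) {m : ℕ} (ι : Fin m → Fin N)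
    (hι : Function.Injective ι) (φ : (Fin N → ℝ) → ℂ) (hΦ : ∀ x t, Φ x t = φ x)
    (x : Fin N → ℝ) (t : ℝ) :
    (List.ofFn fun j => opRstar v (ι j)).prod Φ x (-t) = iterInt m fun y =>
      starKer v y (Fin.cons t fun j => x (ι j)) * φ (replaceAt m ι x y) := by
  induction m generalizing x t with
  | zero =>
    simp only [iterInt, starKer, replaceAt, Finset.univ_eq_empty, Finset.sum_empty,
      Complex.exp_zero, one_mul]
    exact hΦ x (-t)
  | succ m ih =>
    rw [List.ofFn_succ, List.prod_cons]
    change opRstar v (ι 0) ((List.ofFn fun j : Fin m => opRstar v (ι j.succ)).prod Φ) x (-t) = _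
    rw [opRstar_apply, iterInt]
    refine integral_congr_ae (Eventually.of_forall fun y => ?_)
    simp only
    rw [ih (fun j => ι j.succ) (hι.comp (Fin.succ_injective _)), ← iterInt_const_mul]
    congr 1
    funext w
    have e1 : (fun j : Fin m => Function.update x (ι 0) y (ι j.succ)) = fun j => x (ι j.succ) := by
      funext j
      exact Function.update_of_ne (fun h => Fin.succ_ne_zero j (hι h)) _ _
    have e2 : (Fin.cons (x (ι 0)) fun j : Fin m => x (ι j.succ) : Fin (m + 1) → ℝ) =
        fun j => x (ι j) := by
      funext j
      refine Fin.cases ?_ (fun j => ?_) j <;> simp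
    rw [e1, e2, replaceAt, ← mul_assoc, starKer, starKer, ← Complex.exp_add, Fin.sum_univ_succ]
    simp only [Fin.cons_zero, Fin.cons_succ, Fin.castSucc_zero, ← Fin.succ_castSucc]

/-- The kernel of the product of the operators `𝓡`. -/
def prodKer {m : ℕ} (v : ℂ) (X : Fin (m + 1) → ℝ) (w : Fin m → ℝ) : ℂ :=
  Complex.exp (∑ j : Fin m, (Complex.I * v * ((X j.castSucc : ℂ) - (w j : ℂ)) -
    (Real.exp (X j.castSucc - w j) : ℂ) - (Real.exp (w j - X j.succ) : ℂ)))

theorem opR_prod_apply (v : ℂ) (Φ : AuxFun N) {m : ℕ} (ι : Fin m → Fin N)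
    (hι : Function.Injective ι) (x : Fin N → ℝ) (t : ℝ) :
    (List.ofFn fun j => opR v (ι j)).reverse.prod Φ x t = iterIntLast m fun w =>
      prodKer v (Fin.snoc (fun j => x (ι j)) t) w * Φ (replaceAt m ι x w)
        ((Fin.snoc (fun j => x (ι j)) t : Fin (m + 1) → ℝ) 0) := by
  induction m generalizing x t with
  | zero =>
    simp only [iterIntLast, prodKer, replaceAt, Finset.univ_eq_empty, Finset.sum_empty,
      Complex.exp_zero, one_mul]
    rfl
  | succ m ih =>
    rw [List.ofFn_succ_last, List.reverse_append, List.reverse_singleton, List.singleton_append,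
      List.prod_cons]
    change opR v (ι (Fin.last m))
      ((List.ofFn fun j : Fin m => opR v (ι j.castSucc)).reverse.prod Φ) x t = _
    rw [opR, iterIntLast]
    refine integral_congr_ae (Eventually.of_forall fun y => ?_)
    simp only
    rw [ih (fun j => ι j.castSucc) (hι.comp (Fin.castSucc_injective _)), ← iterIntLast_const_mul]
    congr 1
    funext w
    have e1 : (fun j : Fin m => Function.update x (ι (Fin.last m)) y (ι j.castSucc)) =
        fun j => x (ι j.castSucc) := by
      funext j
      exact Function.update_of_ne (fun h => (Fin.castSucc_lt_last j).ne (hι h)) _ _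
    have e2 : (Fin.snoc (fun j : Fin m => x (ι j.castSucc)) (x (ι (Fin.last m))) :
        Fin (m + 1) → ℝ) = fun j => x (ι j) := by
      funext j
      refine Fin.lastCases ?_ (fun j => ?_) j <;> simp
    rw [e1, e2, replaceAt_snoc ι x _ hι, ← mul_assoc, prodKer, prodKer, ← Complex.exp_add,
      Fin.sum_univ_castSucc (n := m)]
    have e3 : (Fin.snoc (fun j => x (ι j)) t : Fin (m + 1 + 1) → ℝ) 0 = x (ι 0) := by
      rw [← Fin.castSucc_zero, Fin.snoc_castSucc]
    simp only [Fin.snoc_castSucc, Fin.snoc_last, Fin.succ_last, e3, Fin.succ_castSucc]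
    rw [add_comm]

end


section

variable {α β : ℝ} {lam : ℂ} {n : ℕ}

/-! ## The monodromy operator as an integral operator -/

/-- The 𝓡* operators produce only z_1, z_2, … in the oscillating factor, while Λ contains all of Σz.
The factor e^{iλ z_0} makes up the difference. -/
theorem starKer_eq (y : Fin n → ℝ) (z : Fin (n + 1) → ℝ) :
    starKer lam y z = Complex.exp (Complex.I * lam * z 0) * kerLam lam y z := by
  rw [starKer, kerLam, ← Complex.exp_add, Fin.sum_univ_succ (n := n)]
  congr 1
  simp only [Finset.sum_sub_distrib, Finset.sum_add_distrib, ← Finset.mul_sum]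
  push_cast
  ring

theorem prodKer_snoc_eq (x w : Fin (n + 1) → ℝ) (t xa : ℝ) :
    prodKer lam (Fin.snoc x xa) w *
      (Complex.exp (-Complex.I * lam * t) * Complex.exp (-(Real.exp (t - x 0) : ℂ))) =
      kerLam lam x (Fin.cons t w) * Complex.exp (-(Real.exp (w (Fin.last n) - xa) : ℂ)) := by
  rw [prodKer, kerLam, ← Complex.exp_add, ← Complex.exp_add, ← Complex.exp_add]
  congr 1
  simp only [Finset.sum_sub_distrib, Finset.sum_add_distrib, ← Finset.mul_sum, Fin.snoc_castSucc,
    Fin.cons_succ]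
  rw [Fin.sum_univ_castSucc (n := n) (f := fun j => ((Real.exp (w j -
    (Fin.snoc x xa : Fin (n + 1 + 1) → ℝ) j.succ) : ℝ) : ℂ)),
    Fin.sum_univ_succ (n := n) (f := fun j => Real.exp ((Fin.cons t w :
      Fin (n + 1 + 1) → ℝ) j.castSucc - x j)),
    Fin.sum_univ_succ (n := n + 1) (f := (Fin.cons t w : Fin (n + 1 + 1) → ℝ))]
  simp only [Fin.succ_last, Fin.snoc_last, Fin.castSucc_zero, Fin.cons_zero, Fin.cons_succ]
  have e1 : ∀ j : Fin n, (Fin.snoc x xa : Fin (n + 1 + 1) → ℝ) j.castSucc.succ = x j.succ :=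
    fun j => by rw [Fin.succ_castSucc]; exact Fin.snoc_castSucc (α := fun _ => ℝ) _ _ _
  have e2 : ∀ j : Fin n, (Fin.cons t w : Fin (n + 1 + 1) → ℝ) j.succ.castSucc = w j.castSucc :=
    fun j => by rw [← Fin.succ_castSucc]; exact Fin.cons_succ (α := fun _ => ℝ) _ _ _
  simp only [e1, e2]
  push_cast
  ring

/-- The normalization of the reflection operator. -/
def normK (α β : ℝ) (lam : ℂ) : ℂ :=
  ((2 * β : ℝ) : ℂ) ^ (Complex.I * lam) / Complex.Gamma (g α β - Complex.I * lam)

/-- The integrand of the monodromy operator. -/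
def monoInt (α β : ℝ) (lam : ℂ) (φ : Smooth (n + 1)) (x : Fin (n + 1) → ℝ) (xa : ℝ)
    (z : Fin (n + 1 + 1) → ℝ) : ℂ :=
  wt α β lam (z 0) * ((lamS (n + 1) lam).1 (Fin.append x z) * pairInt (lamS (n + 1) lam) φ z) *
    Complex.exp (-(Real.exp (z (Fin.last (n + 1)) - xa) : ℂ))

theorem norm_exp_neg_exp_le (t : ℝ) : ‖Complex.exp (-(Real.exp t : ℂ))‖ ≤ 1 := by
  rw [← Complex.ofReal_neg, Complex.norm_exp_ofReal, Real.exp_le_one_iff]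
  exact neg_nonpos.2 (Real.exp_pos t).le

theorem measurable_exp_neg_exp (xa : ℝ) : Measurable fun z : Fin (n + 1 + 1) → ℝ =>
    Complex.exp (-(Real.exp (z (Fin.last (n + 1)) - xa) : ℂ)) := by
  fun_prop

theorem norm_monoInt_le (φ : Smooth (n + 1)) (x : Fin (n + 1) → ℝ) (xa : ℝ)
    (z : Fin (n + 1 + 1) → ℝ) : ‖monoInt α β lam φ x xa z‖ ≤ ‖wt α β lam (z 0) *
      ((lamS (n + 1) lam).1 (Fin.append x z) * pairInt (lamS (n + 1) lam) φ z)‖ := by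
  rw [monoInt, norm_mul]
  exact mul_le_of_le_one_right (norm_nonneg _) (norm_exp_neg_exp_le _)

theorem integrable_lamS (h : Admissible α β lam) {φ : Smooth (n + 1)}
    (hφ : φ ∈ polyClass (Fin.last n)) (x : Fin (n + 1) → ℝ) :
    Integrable fun z => wt α β lam (z 0) *
      ((lamS (n + 1) lam).1 (Fin.append x z) * pairInt (lamS (n + 1) lam) φ z) :=
  intZ_integrable h (self_mem_expSpan _ _) (growthZ_pairInt h (self_mem_expSpan _ _) hφ) x

theorem integrable_monoInt (h : Admissible α β lam) {φ : Smooth (n + 1)}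
    (hφ : φ ∈ polyClass (Fin.last n)) (x : Fin (n + 1) → ℝ) (xa : ℝ) :
    Integrable (monoInt α β lam φ x xa) :=
  (integrable_lamS h hφ x).mono ((integrable_lamS h hφ x).aestronglyMeasurable.mul
    (measurable_exp_neg_exp xa).aestronglyMeasurable)
    (Eventually.of_forall fun z => norm_monoInt_le φ x xa z)

theorem opRstar_all_apply (h : Admissible α β lam) {φ : Smooth (n + 1)}
    (hφ : φ ∈ polyClass (Fin.last n)) (w : Fin (n + 1) → ℝ) (t : ℝ) :
    (List.ofFn fun j : Fin (n + 1) => opRstar lam j).prod (fun x _ => φ.1 x) w (-t) =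
      Complex.exp (Complex.I * lam * t) *
        pairInt (lamS (n + 1) lam) φ (Fin.cons t w : Fin (n + 1 + 1) → ℝ) := by
  have h1 := opRstar_prod_apply lam (fun x _ => φ.1 x) (id : Fin (n + 1) → Fin (n + 1))
    Function.injective_id φ.1 (fun _ _ => rfl) w t
  simp only [replaceAt_id, id] at h1
  rw [h1]
  have e : ∀ y : Fin (n + 1) → ℝ, starKer lam y (Fin.cons t w : Fin (n + 1 + 1) → ℝ) * φ.1 y =
      Complex.exp (Complex.I * lam * t) * ((lamS (n + 1) lam).1
        (Fin.append y (Fin.cons t w : Fin (n + 1 + 1) → ℝ)) * φ.1 y) := fun y => by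
    rw [starKer_eq, lamS_append, Fin.cons_zero, mul_assoc]
  simp only [e]
  rw [iterInt_const_mul, iterInt_eq_integral
    (integrable_jointSpan_mul h (self_mem_expSpan _ _) hφ _), pairInt]

/-- The open half-line of 𝓚 and the closed one of `heaviside` differ by the point log β, which has
measure zero. -/
theorem setIntegral_Ioi_eq_wt (F : ℝ → ℂ) :
    ∫ t in Set.Ioi (Real.log β), ((1 + β * Real.exp (-t) : ℝ) : ℂ) ^ (-Complex.I * lam - g α β) *
      ((1 - β * Real.exp (-t) : ℝ) : ℂ) ^ (-Complex.I * lam + g α β - 1) * F t =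
      ∫ t, wt α β lam t * F t := by
  rw [← integral_indicator measurableSet_Ioi]
  refine integral_congr_ae ?_
  filter_upwards [compl_mem_ae_iff.2 (measure_singleton (μ := volume) (Real.log β))] with t ht
  rcases lt_or_gt_of_ne ht with ht | ht
  · rw [Set.indicator_of_notMem (by simpa using ht.le), wt_of_lt ht, zero_mul]
  · rw [Set.indicator_of_mem (by exact ht), wt_of_gt ht]

/-- The factor e^{-2iλt} of 𝓚 times e^{iλt} from the 𝓡* product leaves e^{-iλt}, the z_0-part of
Λ(x|z) at z_0 = t. With the kernel of the 𝓡 product it completes Λ(x|z), and x_a survives only in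
the cutoff factor. -/
theorem opURestr_eq (h : Admissible α β lam) {φ : Smooth (n + 1)}
    (hφ : φ ∈ polyClass (Fin.last n)) (x : Fin (n + 1) → ℝ) (xa : ℝ) :
    opURestr α β lam φ.1 x xa = normK α β lam * ∫ z, monoInt α β lam φ x xa z := by
  let S : AuxFun (n + 1) :=
    (List.ofFn fun j : Fin (n + 1) => opRstar lam j).prod (fun x _ => φ.1 x)
  change (List.ofFn fun j : Fin (n + 1) => opR lam j).reverse.prod (opK α β lam S) x xa = _
  have h1 := opR_prod_apply lam (opK α β lam S) (id : Fin (n + 1) → Fin (n + 1))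
    Function.injective_id x xa
  simp only [replaceAt_id, id] at h1
  have e0 : (Fin.snoc x xa : Fin (n + 1 + 1) → ℝ) 0 = x 0 := by
    rw [← Fin.castSucc_zero, Fin.snoc_castSucc]
  have hi := integrable_comp_cons (integrable_monoInt h hφ x xa)
  have e : ∀ w : Fin (n + 1) → ℝ, prodKer lam (Fin.snoc x xa) w * opK α β lam S w (x 0) =
      normK α β lam * ∫ t : ℝ, monoInt α β lam φ x xa (Fin.cons t w) := fun w => by
    have e2 := setIntegral_Ioi_eq_wt (α := α) (β := β) (lam := lam) fun t =>
      Complex.exp (-2 * Complex.I * lam * t - (Real.exp (t - x 0) : ℂ)) * S w (-t)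
    have e3 : opK α β lam S w (x 0) = normK α β lam * ∫ t, wt α β lam t *
        (Complex.exp (-2 * Complex.I * lam * t - (Real.exp (t - x 0) : ℂ)) * S w (-t)) := by
      rw [opK, normK, ← e2]
      congr 1
      refine integral_congr_ae (Eventually.of_forall fun t => ?_)
      simp only
      ring
    rw [e3, mul_left_comm, ← integral_const_mul]
    congr 1
    refine integral_congr_ae (Eventually.of_forall fun t => ?_)
    have e4 : S w (-t) = _ := opRstar_all_apply h hφ w t
    have e5 := prodKer_snoc_eq (lam := lam) x w t xa
    have e6 : Complex.exp (-2 * Complex.I * lam * t - (Real.exp (t - x 0) : ℂ)) *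
        Complex.exp (Complex.I * lam * t) =
        Complex.exp (-Complex.I * lam * t) * Complex.exp (-(Real.exp (t - x 0) : ℂ)) := by
      rw [← Complex.exp_add, ← Complex.exp_add]
      congr 1
      ring
    have e7 : (Fin.cons t w : Fin (n + 1 + 1) → ℝ) (Fin.last (n + 1)) = w (Fin.last n) := by
      rw [← Fin.succ_last, Fin.cons_succ]
    simp only [monoInt, lamS_append, Fin.cons_zero]
    rw [e4, e7]
    calc _ = wt α β lam t * (prodKer lam (Fin.snoc x xa) w *
          (Complex.exp (-2 * Complex.I * lam * t - (Real.exp (t - x 0) : ℂ)) *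
            Complex.exp (Complex.I * lam * t))) *
          pairInt (lamS (n + 1) lam) φ (Fin.cons t w : Fin (n + 1 + 1) → ℝ) := by ring
      _ = _ := by rw [e6, e5]; ring
  rw [h1, e0]
  simp only [e]
  -- The variable z_0 is integrated inside, by 𝓚, and z_1, z_2, … outside. Joint integrability
  -- merges them into one integral over all of z.
  rw [iterIntLast_const_mul, iterIntLast_eq_integral hi.integral_prod_right,
    ← integral_prod_symm _ hi, integral_comp_cons]

/-! ## The Baxter operator -/

/-- The cutoff exp(-e^{z_last - x_a}) is at most 1 in norm and tends to 1 pointwise, and the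
integrand without it is integrable, so dominated convergence applies. -/
theorem tendsto_opURestr (h : Admissible α β lam) {φ : Smooth (n + 1)}
    (hφ : φ ∈ polyClass (Fin.last n)) (x : Fin (n + 1) → ℝ) :
    Tendsto (fun xa : ℝ => opURestr α β lam φ.1 x xa) atTop
      (𝓝 (normK α β lam * intZ α β lam (lamS (n + 1) lam) (pairInt (lamS (n + 1) lam) φ) x)) := by
  simp only [opURestr_eq h hφ]
  refine Tendsto.const_mul _ ?_
  refine tendsto_integral_filter_of_dominated_convergence _
    (Eventually.of_forall fun xa => (integrable_monoInt h hφ x xa).aestronglyMeasurable)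
    (Eventually.of_forall fun xa => Eventually.of_forall fun z => norm_monoInt_le φ x xa z)
    (integrable_lamS h hφ x).norm (Eventually.of_forall fun z => ?_)
  have h1 : Tendsto (fun xa : ℝ => Real.exp (z (Fin.last (n + 1)) - xa)) atTop (𝓝 0) :=
    Real.tendsto_exp_atBot.comp (tendsto_const_nhds.add_atBot tendsto_neg_atTop_atBot)
  have h2 : Tendsto (fun xa : ℝ => Complex.exp (-(Real.exp (z (Fin.last (n + 1)) - xa) : ℂ))) atTop
      (𝓝 1) := by
    have hc : Continuous fun t : ℝ => Complex.exp (-(t : ℂ)) := by fun_prop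
    simpa [Function.comp_def] using (hc.tendsto 0).comp h1
  simpa only [monoInt, mul_one] using h2.const_mul (wt α β lam (z 0) *
    ((lamS (n + 1) lam).1 (Fin.append x z) * pairInt (lamS (n + 1) lam) φ z))

theorem opQ_eq (h : Admissible α β lam) {φ : Smooth (n + 1)}
    (hφ : φ ∈ polyClass (Fin.last n)) (x : Fin (n + 1) → ℝ) :
    opQ α β lam φ.1 x =
      normK α β lam * intZ α β lam (lamS (n + 1) lam) (pairInt (lamS (n + 1) lam) φ) x :=
  (tendsto_opURestr h hφ x).limUnder_eq

theorem kernelQ_eq (x y : Fin (n + 1) → ℝ) : kernelQ α β lam x y = normK α β lam *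
    pairZ α β lam (sliceRight x (lamS (n + 1) lam)) (sliceRight y (lamS (n + 1) lam)) := by
  simp only [kernelQ, kernelIntegrand_eq]
  rfl

theorem integrable_kernelQ_mul (h : Admissible α β lam) {φ : Smooth (n + 1)}
    (hφ : φ ∈ polyClass (Fin.last n)) (x : Fin (n + 1) → ℝ) :
    Integrable fun y => kernelQ α β lam x y * φ.1 y := by
  simp only [kernelQ_eq, mul_assoc]
  exact (integrable_pairZ_mul h (self_mem_expSpan _ _) (self_mem_expSpan _ _) hφ).const_mul _

theorem opQ_eq_integral (h : Admissible α β lam) {φ : Smooth (n + 1)}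
    (hφ : φ ∈ polyClass (Fin.last n)) (x : Fin (n + 1) → ℝ) :
    opQ α β lam φ.1 x = ∫ y, kernelQ α β lam x y * φ.1 y := by
  simp only [kernelQ_eq, mul_assoc]
  rw [opQ_eq h hφ, integral_const_mul, ← integral_pairInt h (self_mem_expSpan _ _)
    (self_mem_expSpan _ _) hφ]
  rfl

theorem smul_mem_tempered {N : ℕ} (c : ℂ) {f : Smooth N} (hf : f ∈ tempered N) :
    c • f ∈ tempered N := fun k => by
  obtain ⟨a, b, ha, hb, hk⟩ := hf k
  refine ⟨‖c‖ * a, b, by positivity, hb, fun x => ?_⟩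
  rw [map_smul]
  change ‖c * (multiPd k f).1 x‖ ≤ _
  rw [norm_mul, mul_assoc]
  exact mul_le_mul_of_nonneg_left (hk x) (norm_nonneg c)

theorem exists_opQ_intertwined (h : Admissible α β lam) {φ : Smooth (n + 1)}
    (hφ : φ ∈ polyClass (Fin.last n)) : ∃ ψ : Smooth (n + 1), ψ ∈ tempered (n + 1) ∧
      ψ.1 = opQ α β lam φ.1 ∧
      ∀ u, (opB α β (n + 1) u ψ).1 = opQ α β lam (opB α β (n + 1) u φ).1 := by
  obtain ⟨ψ, h1, h2, h3⟩ := exists_intertwined h hφ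
  refine ⟨normK α β lam • ψ, smul_mem_tempered _ h1, funext fun x => ?_, fun u => funext fun x => ?_⟩
  · rw [opQ_eq h hφ, ← h2]
    rfl
  · rw [opQ_eq h (opB_mem_polyClass α β u hφ), ← h3, map_smul]
    rfl

end

end BCToda

end

/-! ### The theorem. -/

theorem mainTheorem4 (α β : ℝ) (hβ : 0 < β) (hg : 0 < 1 / 2 + α / β) (n : ℕ) (hn : 0 < n)
    (lam : ℂ) (hlam : lam.im ∈ Set.Ioo (-(1 / 2 + α / β)) 0) :
    -- the integral that defines the kernel converges absolutely
    (∀ x y : Fin n → ℝ,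
      MeasureTheory.Integrable (fun z : Fin (n + 1) → ℝ =>
        BCToda.kernelIntegrand α β lam x y z)) ∧
    ∀ φ : BCToda.Smooth n, φ ∈ BCToda.temperedPoly (⟨n - 1, by omega⟩ : Fin n) →
      -- the limit that defines the Baxter operator exists, and it is given by the kernel
      (∀ x : Fin n → ℝ,
        Filter.Tendsto (fun xa : ℝ => BCToda.opURestr α β lam φ x xa) Filter.atTop
          (nhds (BCToda.opQ α β lam φ x)) ∧
        MeasureTheory.Integrable (fun y : Fin n → ℝ =>
          BCToda.kernelQ α β lam x y * (φ : (Fin n → ℝ) → ℂ) y) ∧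
        BCToda.opQ α β lam φ x =
          ∫ y : Fin n → ℝ, BCToda.kernelQ α β lam x y * (φ : (Fin n → ℝ) → ℂ) y) ∧
      -- the operators `𝔹_n(u)` preserve the space of functions
      (∀ u : ℂ, BCToda.opB α β n u φ ∈ BCToda.temperedPoly (⟨n - 1, by omega⟩ : Fin n)) ∧
      -- `ℚ_n(λ) φ` is smooth and exponentially tempered, and
      -- `𝔹_n(u) ℚ_n(λ) φ = ℚ_n(λ) 𝔹_n(u) φ`
      ∃ ψ : BCToda.Smooth n, ψ ∈ BCToda.tempered n ∧
        (ψ : (Fin n → ℝ) → ℂ) = BCToda.opQ α β lam φ ∧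
        ∀ u : ℂ, (BCToda.opB α β n u ψ : (Fin n → ℝ) → ℂ) =
          BCToda.opQ α β lam (BCToda.opB α β n u φ) := by
  obtain _ | m := n
  · exact absurd hn (lt_irrefl 0)
  have h : BCToda.Admissible α β lam := ⟨hβ, hg, hlam.2, by
    have := hlam.1
    unfold BCToda.g
    linarith⟩
  refine ⟨fun x y => BCToda.integrable_kernelIntegrand h x y, fun φ hφ => ?_⟩
  -- For n = m + 1 the index n - 1 is `Fin.last m` by definition.
  have hφ' : φ ∈ BCToda.polyClass (Fin.last m) := (BCToda.mem_temperedPoly_iff _ φ).1 hφ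
  refine ⟨fun x => ⟨?_, BCToda.integrable_kernelQ_mul h hφ' x, BCToda.opQ_eq_integral h hφ' x⟩,
    fun u => (BCToda.mem_temperedPoly_iff _ _).2 (BCToda.opB_mem_polyClass α β u hφ'),
    BCToda.exists_opQ_intertwined h hφ'⟩
  rw [BCToda.opQ_eq h hφ' x]
  exact BCToda.tendsto_opURestr h hφ' x
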